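/- Let $D=t\,\frac{d}{dt}$ and consider the following three differential operators (the regularized quantum differential operators of the Mukai threefolds $V_{2N}$, $N=6,8,9$): $$V_{12}:\; D^3-t(1+2D)(17D^2+17D+5)+t^2(D+1)^3,$$ $$V_{16}:\; D^3-4t(1+2D)(3D^2+3D+1)+16t^2(D+1)^3,$$ $$V_{18}:\; D^3-3t(1+2D)(3D^2+3D+1)-27t^2(D+1)^3.$$ To an operator $p_0(D)+t\,p_1(D)+t^2p_2(D)$ one associates the recurrence $p_0(n)u_n+p_1(n-1)u_{n-1}+p_2(n-2)u_{n-2}=0$, $n\ge 2$. In each case the recurrence has a unique integer-valued solution $(a_n)_{n\ge0}$ with $a_0=1$ and a unique rational solution $(b_n)_{n\ge0}$ with $b_0=0$, $b_1=1$. Put $q=e^{2\pi i\tau}$ and $E_{4,i}=\frac{i^2}{240}\bigl(1+240\sum_{n\ge1}\sigma_3(n)q^{in}\bigr)$, let $\chi_3(n)=\left(\frac n3\right)$ be the odd quadratic character modulo $3$, and let $F$ be $$E_{4,1}-7E_{4,2}+7E_{4,3}-E_{4,6},\qquad E_{4,1}-\tfrac{21}{4}E_{4,2}+\tfrac{21}{4}E_{4,4}-E_{4,8},\qquad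 \sum_{n\ge1}\chi_3(n)\sigma_3(n)q^n$$ for $V_{12},V_{16},V_{18}$ respectively. Then $F=\sum_{n\ge1}c_nq^n$ is a modular form of weight $4$ for $\Gamma_0(N)$ with $F(-1/(N\tau))=-(\tau\sqrt N)^4F(\tau)$. Its Dirichlet series $\sum_{n\ge1}c_nn^{-s}$ converges absolutely for $\operatorname{Re}s>4$ and extends to an entire function $L(F,s)$, which equals respectively $$(1-7\cdot2^{2-s}+7\cdot3^{2-s}-6^{2-s})\,\zeta(s)\zeta(s-3),\qquad (1-\tfrac{21}{4}2^{2-s}+\tfrac{21}{4}4^{2-s}-8^{2-s})\,\zeta(s)\zeta(s-3)$$ (both for $s\ne1,4$) and $$L(\chi_3,s)\,L(\chi_3,s-3)\ \ \text{for all } s,\qquad\text{which equals } \prod_p\bigl(1-\chi_3(p)p^{3-s}\bigr)^{-1}\bigl(1-\chi_3(p)p^{-s}\bigr)^{-1}\ \text{ for } \operatorname{Re}s>4.$$ In each of the three cases $$\lim_{n\to\infty}\frac{b_n}{a_n}=L(F,3),$$ and $L(F,3)$ equals $\frac16\zeta(3)$ for $V_{12}$, $\frac7{32}\zeta(3)$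 for $V_{16}$, and $\frac13L(\chi_3,3)$ for $V_{18}$. -/

import Mathlib

open Filter Topology
open scoped MatrixGroups UpperHalfPlane ArithmeticFunction.sigma

noncomputable section

/-- The three rational Mukai threefolds. -/
inductive RationalMukai
  | V12
  | V16
  | V18

namespace RationalMukai

open Polynomial in
/-- The regularized quantum differential operator `∑ i, t ^ i * pᵢ(D)`, `D = t d/dt`,
`0 ≤ i ≤ 2`, given by its coefficient polynomials `pᵢ` (the variable `X` stands for `D`). -/
def operator : RationalMukai → Fin 3 → ℚ[X]
  | V12 => ![X ^ 3, -((1 + 2 * X) * (17 * X ^ 2 + 17 * X + 5)), (X + 1) ^ 3]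
  | V16 => ![X ^ 3, -(4 * (1 + 2 * X) * (3 * X ^ 2 + 3 * X + 1)), 16 * (X + 1) ^ 3]
  | V18 => ![X ^ 3, -(3 * (1 + 2 * X) * (3 * X ^ 2 + 3 * X + 1)), -(27 * (X + 1) ^ 3)]

/-- `u` solves the quantum recurrence `∑ i, pᵢ(n - i) * u (n - i) = 0`, imposed for all `n` for
which the three indices `n`, `n - 1`, `n - 2` are nonnegative. -/
def IsSolution (V : RationalMukai) (u : ℕ → ℚ) : Prop :=
  ∀ n : ℕ, 2 ≤ n → ∑ i : Fin 3, (V.operator i).eval ((n : ℚ) - (i : ℕ)) * u (n - i) = 0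

/-- The integral solution normalized by `a 0 = 1`. -/
def IsIntegralSolution (V : RationalMukai) (a : ℕ → ℤ) : Prop :=
  V.IsSolution (fun n => (a n : ℚ)) ∧ a 0 = 1

/-- The solution with `b 0 = 0`, `b 1 = 1`. -/
def IsSecondSolution (V : RationalMukai) (b : ℕ → ℚ) : Prop :=
  V.IsSolution b ∧ b 0 = 0 ∧ b 1 = 1

/-- The level: `N` for `V_{2N}`. -/
def level : RationalMukai → ℕ
  | V12 => 6
  | V16 => 8
  | V18 => 9

instance (V : RationalMukai) : NeZero V.level := ⟨by cases V <;> decide⟩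

end RationalMukai

/-- The "Eisenstein harmonic" `E_{4,i} = i² / 240 * (1 + 240 ∑_{n ≥ 1} σ₃(n) q ^ (i n))`
with `q = exp (2 π i τ)`. -/
def eisensteinHarmonic4 (i : ℕ) (τ : ℍ) : ℂ :=
  (i : ℂ) ^ 2 / 240 *
    (1 + 240 * ∑' n : ℕ+, (σ 3 (n : ℕ) : ℂ) *
      Complex.exp (2 * Real.pi * Complex.I * (τ : ℂ)) ^ (i * (n : ℕ)))

/-- The odd quadratic character modulo `3`, `n ↦ (n / 3)`. -/
def chi3 : DirichletCharacter ℂ 3 :=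
  (quadraticChar (ZMod 3)).ringHomComp (Int.castRingHom ℂ)

namespace RationalMukai

/-- The weight 4 form attached to the threefold, as a function on the upper half plane. -/
def formFun : RationalMukai → ℍ → ℂ
  | V12 => fun τ => eisensteinHarmonic4 1 τ - 7 * eisensteinHarmonic4 2 τ
      + 7 * eisensteinHarmonic4 3 τ - eisensteinHarmonic4 6 τ
  | V16 => fun τ => eisensteinHarmonic4 1 τ - 21 / 4 * eisensteinHarmonic4 2 τ
      + 21 / 4 * eisensteinHarmonic4 4 τ - eisensteinHarmonic4 8 τ
  | V18 => fun τ => ∑' n : ℕ+, chi3 ((n : ℕ) : ZMod 3) * (σ 3 (n : ℕ) : ℂ) *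
      Complex.exp (2 * Real.pi * Complex.I * (τ : ℂ)) ^ (n : ℕ)

/-- The explicit shape of the `L`-function. For `V12` and `V16` the points `1` and `4`, where a
zeta factor has its pole, are left out. -/
def HasExplicitL (V : RationalMukai) (L : ℂ → ℂ) : Prop :=
  match V with
  | V12 => ∀ s : ℂ, s ≠ 1 → s ≠ 4 →
      L s = (1 - 7 * (2 : ℂ) ^ (2 - s) + 7 * (3 : ℂ) ^ (2 - s) - (6 : ℂ) ^ (2 - s)) *
        riemannZeta s * riemannZeta (s - 3)
  | V16 => ∀ s : ℂ, s ≠ 1 → s ≠ 4 →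
      L s = (1 - 21 / 4 * (2 : ℂ) ^ (2 - s) + 21 / 4 * (4 : ℂ) ^ (2 - s) - (8 : ℂ) ^ (2 - s)) *
        riemannZeta s * riemannZeta (s - 3)
  | V18 => (∀ s : ℂ, 4 < s.re →
      HasProd (fun p : Nat.Primes =>
        (1 - chi3 ((p : ℕ) : ZMod 3) * ((p : ℕ) : ℂ) ^ (3 - s))⁻¹ *
          (1 - chi3 ((p : ℕ) : ZMod 3) * ((p : ℕ) : ℂ) ^ (-s))⁻¹) (L s)) ∧
      ∀ s : ℂ, L s = chi3.LFunction s * chi3.LFunction (s - 3)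

/-- The Apéry constant. -/
def aperyConstant : RationalMukai → ℂ
  | V12 => riemannZeta 3 / 6
  | V16 => 7 * riemannZeta 3 / 32
  | V18 => chi3.LFunction 3 / 3

end RationalMukai

/-- `F(-1/(Nτ)) = -(τ √N)⁴ F(τ)`. -/
def IsAtkinLehnerOdd (N : ℕ) (F : ℍ → ℂ) : Prop :=
  ∀ τ τ' : ℍ, (τ' : ℂ) = -1 / (N * (τ : ℂ)) → F τ' = -((τ : ℂ) * (√(N : ℝ) : ℝ)) ^ 4 * F τ

/-- The `L`-function of a weight 4 modular form of level `Γ₀(N)`: Mathlib's Mellin transform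
definition, which is the meromorphic continuation of `∑_{n ≥ 1} c_n / n ^ s`. -/
def formL {N : ℕ} [NeZero N]
    (F : ModularForm ((CongruenceSubgroup.Gamma0 N : Subgroup SL(2, ℤ)) :
      Subgroup (GL (Fin 2) ℝ)) 4) : ℂ → ℂ :=
  ModularForm.L (by norm_num : (0 : ℤ) < 4) F

end

/-! The limit is found by Apéry's method. The recurrence has a two-dimensional solution space, so
any solution `r` with `r 0 = κ * l` and `r 1 = κ * (l * a 1 - 1)` equals `κ * (l * a n - b n)`. If
`r n` is negligible against `a n`, then `b n / a n` tends to `l`. This is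
`tendsto_div_of_remainder`; the lower bound for `a n` is `growth_le`, and the small solutions are
built in `exists_remainder_V12`, `exists_remainder_V16` and `exists_remainder_V18`.

Integrality determines `a 1`: the Casoratian `W` of two integral solutions satisfies `(n+1)³ W n = c
^ n W 0` with `c` the last coefficient, which makes `W 0` divisible by arbitrarily high powers of a
prime not dividing `c`. For existence, `V12` has the Apéry numbers and `V16` has `∑ C(n,k)²
C(2(n-k),n)²`, both proved by telescoping certificates. For `V18` the generating series is `G ∑
(6k)!/((3k)! k!³) (t G²)^(3k)` with `G = (1 - 6t - 27t²)^(-1/2)`; it is integral because `G` can be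
written through the Catalan series.

For `V12` and `V16` the small solution is `∑ d/ds A_n(s)²` over a shifted set of natural numbers,
for an explicit rational function `A_n`; a second telescoping certificate, now in `s`, gives the
recurrence (`recurs_of_rational_certificate`), and the first two sums are explicit in `ζ(3)`.

For `V18` the small solution is a period integral. There are level three forms `f`, `g`, `S` of
weight 2 with `S² = f² - 18fg - 27g²`. For `t = g/f` the function `t^m/f` has weight -2, so its
third derivative has weight 4 (Bol's identity), and it equals `gS` times a three-term combination of
powers of `t` whose coefficients are those of the recurrence. Integrating against `y²` along the
imaginary axis shows that the moments of `y² g S` against `t^n`, multiplied by `(-27)^n`, solve the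
recurrence. Since `F(z/3) = g(z) S(z)`, the zeroth moment is `L(F, 3)` up to a constant, and `0 < t
≤ 1/18` makes the solution small.

On the modular side, `F` is a combination of dilates of `E₄`, or of its translates by thirds. The
inversion `z ↦ -1/z` permutes the summands and yields the Fricke sign; hence `F` vanishes at both
ends of the imaginary axis and its Mellin transform is entire. For `Re s > 4` it is the Dirichlet
series, which factors because `σ₃` is a convolution; the identity theorem extends the product
formula. At `s = 3` the second factor is `ζ(0) = -1/2` or `L(χ₃, 0) = 1/3`. -/

namespace RationalMukai

/-! ### The recurrence: solution space and uniqueness of the integral solution -/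

/-- The middle coefficient of the recurrence relating `u (n + 2)`, `u (n + 1)` and `u n`. -/
def midCoeff (V : RationalMukai) (n : ℕ) : ℤ :=
  match V with
  | V12 => (2 * n + 3) * (17 * n ^ 2 + 51 * n + 39)
  | V16 => 4 * (2 * n + 3) * (3 * n ^ 2 + 9 * n + 7)
  | V18 => 3 * (2 * n + 3) * (3 * n ^ 2 + 9 * n + 7)

/-- The leading coefficient of the last polynomial of the operator. -/
def lastCoeff : RationalMukai → ℤ
  | V12 => 1
  | V16 => 16
  | V18 => -27

/-- The value at `1` of the integral solution. -/
def secondTerm : RationalMukai → ℤ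
  | V12 => 5
  | V16 => 4
  | V18 => 3

/-- The quantum recurrence over an arbitrary field, with shifted index. -/
def Recurs {K : Type*} [Field K] (V : RationalMukai) (u : ℕ → K) : Prop :=
  ∀ n : ℕ, ((n : K) + 2) ^ 3 * u (n + 2) - (V.midCoeff n : K) * u (n + 1)
    + (V.lastCoeff : K) * ((n : K) + 1) ^ 3 * u n = 0

lemma isSolution_iff_recurs (V : RationalMukai) (u : ℕ → ℚ) : V.IsSolution u ↔ V.Recurs u := by
  have key : ∀ n : ℕ, ∑ i : Fin 3, (V.operator i).eval (((n + 2 : ℕ) : ℚ) - (i : ℕ)) *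
      u (n + 2 - i) = ((n : ℚ) + 2) ^ 3 * u (n + 2) - (V.midCoeff n : ℚ) * u (n + 1)
    + (V.lastCoeff : ℚ) * ((n : ℚ) + 1) ^ 3 * u n := by
    intro n
    rw [Fin.sum_univ_three]
    cases V <;>
    simp only [operator, midCoeff, lastCoeff, Matrix.cons_val_zero, Matrix.cons_val_one,
      Matrix.cons_val, Fin.val_zero, Fin.val_one, Fin.val_two, Polynomial.eval_pow,
      Polynomial.eval_X, Polynomial.eval_neg, Polynomial.eval_mul, Polynomial.eval_add,
      Polynomial.eval_one, Polynomial.eval_ofNat, Nat.add_sub_cancel, Nat.sub_zero,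
      show n + 2 - 1 = n + 1 from rfl] <;> push_cast <;> ring
  constructor
  · intro h n
    rw [← key]
    exact h (n + 2) (by omega)
  · intro h n hn
    obtain ⟨m, rfl⟩ := Nat.exists_eq_add_of_le hn
    have := h m
    rw [← key, add_comm m 2] at this
    exact this

lemma Recurs.linear_combination {K : Type*} [Field K] {V : RationalMukai} {u v : ℕ → K} (hu : V.Recurs u)
    (hv : V.Recurs v) (x y : K) : V.Recurs fun n => x * u n + y * v n := fun n => by
  linear_combination x * hu n + y * hv n

lemma Recurs.map {K : Type*} [Field K] {L : Type*} [Field L] (φ : K →+* L) {V : RationalMukai} {u : ℕ → K}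
    (hu : V.Recurs u) : V.Recurs fun n => φ (u n) := fun n => by
  have := congrArg φ (hu n)
  simpa [map_ofNat] using this

section Field

variable {K : Type*} [Field K] [CharZero K]

lemma natCast_add_two_pow_three_ne_zero (n : ℕ) : ((n : K) + 2) ^ 3 ≠ 0 :=
  pow_ne_zero _ (by exact_mod_cast (by omega : n + 2 ≠ 0))

/-- A solution of the recurrence is determined by its first two terms. -/
lemma Recurs.ext {V : RationalMukai} {u v : ℕ → K} (hu : V.Recurs u) (hv : V.Recurs v)
    (h0 : u 0 = v 0) (h1 : u 1 = v 1) : u = v := by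
  have key : ∀ n, u n = v n ∧ u (n + 1) = v (n + 1) := by
    intro n
    induction n with
    | zero => exact ⟨h0, h1⟩
    | succ n ih =>
      refine ⟨ih.2, mul_left_cancel₀ (natCast_add_two_pow_three_ne_zero (K := K) n) ?_⟩
      have e1 := hu n
      have e2 := hv n
      rw [ih.1, ih.2] at e1
      linear_combination e1 - e2
  exact funext fun n => (key n).1

/-- The recurrence can be solved for arbitrary initial values. -/
lemma exists_recurs (V : RationalMukai) (x y : K) : ∃ u : ℕ → K, V.Recurs u ∧ u 0 = x ∧ u 1 = y := by
  let step : ℕ → K × K → K × K := fun n p =>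
    (p.2, ((V.midCoeff n : K) * p.2 - (V.lastCoeff : K) * ((n : K) + 1) ^ 3 * p.1) /
      ((n : K) + 2) ^ 3)
  let w : ℕ → K × K := fun n => Nat.rec (x, y) step n
  have hw : ∀ n, w (n + 1) = step n (w n) := fun n => rfl
  refine ⟨fun n => (w n).1, fun n => ?_, rfl, rfl⟩
  have h1 : (w (n + 1)).1 = (w n).2 := rfl
  have h2 : (w (n + 2)).1 = ((V.midCoeff n : K) * (w n).2 -
    (V.lastCoeff : K) * ((n : K) + 1) ^ 3 * (w n).1) / ((n : K) + 2) ^ 3 := rfl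
  simp only [h1, h2]
  rw [mul_div_cancel₀ _ (natCast_add_two_pow_three_ne_zero n)]
  ring

end Field

/-- The second solution exists and is unique. -/
lemma existsUnique_secondSolution (V : RationalMukai) : ∃! b : ℕ → ℚ, V.IsSecondSolution b := by
  obtain ⟨b, hb, h0, h1⟩ := exists_recurs V (0 : ℚ) 1
  refine ⟨b, ⟨(isSolution_iff_recurs V b).2 hb, h0, h1⟩, fun b' ⟨hb', h0', h1'⟩ => ?_⟩
  exact ((isSolution_iff_recurs V b').1 hb').ext hb (h0'.trans h0.symm) (h1'.trans h1.symm)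

/-- Two integral solutions with the same initial term agree: otherwise their Casoratian
would be divisible by arbitrarily high powers of a prime. -/
lemma IsIntegralSolution.unique {V : RationalMukai} {a a' : ℕ → ℤ} (ha : V.IsIntegralSolution a)
    (ha' : V.IsIntegralSolution a') : a = a' := by
  have r := (isSolution_iff_recurs V _).1 ha.1
  have r' := (isSolution_iff_recurs V _).1 ha'.1
  let W : ℕ → ℤ := fun n => a (n + 1) * a' n - a n * a' (n + 1)
  -- The middle coefficient cancels in the Casoratian, and the outer ones leave a first-order
  -- recurrence.
  have hW : ∀ n : ℕ, ((n : ℤ) + 1) ^ 3 * W n = V.lastCoeff ^ n * W 0 := by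
    intro n
    induction n with
    | zero => simp
    | succ n ih =>
      have e : ((n : ℚ) + 2) ^ 3 * (W (n + 1) : ℚ) =
          (V.lastCoeff : ℚ) * (((n : ℚ) + 1) ^ 3 * (W n : ℚ)) := by
        have e1 := r n
        have e2 := r' n
        simp only [W]
        push_cast
        linear_combination (a' (n + 1) : ℚ) * e1 - (a (n + 1) : ℚ) * e2
      have e' : ((n : ℤ) + 2) ^ 3 * W (n + 1) = V.lastCoeff * (((n : ℤ) + 1) ^ 3 * W n) := by
        exact_mod_cast e
      rw [ih] at e'
      push_cast
      rw [pow_succ]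
      linear_combination e'
  -- At `n + 1 = p ^ m` the left side of `hW` is divisible by `p ^ m`. When `p` is prime to the last
  -- coefficient this divisibility passes to the fixed integer `W 0`, for every `m`.
  obtain ⟨p, hp, hc⟩ : ∃ p : ℤ, 1 < p ∧ IsCoprime p V.lastCoeff := by
    cases V
    · exact ⟨2, by norm_num, by simp [lastCoeff, isCoprime_one_right]⟩
    · exact ⟨3, by norm_num, by simp only [lastCoeff]; norm_num [Int.isCoprime_iff_gcd_eq_one]⟩
    · exact ⟨2, by norm_num, by simp only [lastCoeff]; norm_num [Int.isCoprime_iff_gcd_eq_one]⟩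
  have hW0 : W 0 = 0 := by
    by_contra hne
    obtain ⟨m, hm⟩ := pow_unbounded_of_one_lt |W 0| hp
    have hpm : (1 : ℤ) ≤ p ^ m := one_le_pow₀ hp.le
    have h := hW (p ^ m - 1).toNat
    have hcast : (((p ^ m - 1).toNat : ℕ) : ℤ) + 1 = p ^ m := by
      rw [Int.toNat_of_nonneg (by linarith)]; ring
    rw [hcast] at h
    have hd : p ^ m ∣ V.lastCoeff ^ (p ^ m - 1).toNat * W 0 := by
      rw [← h]
      exact Dvd.dvd.mul_right (dvd_pow_self _ (by norm_num)) _
    have hd' : p ^ m ∣ W 0 := (hc.pow).dvd_of_dvd_mul_left hd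
    have := Int.le_of_dvd (abs_pos.2 hne) ((dvd_abs _ _).2 hd')
    linarith
  have h1 : a 1 = a' 1 := by
    have : a 1 * a' 0 - a 0 * a' 1 = 0 := hW0
    rw [ha.2, ha'.2] at this
    linarith
  have := r.ext r' (by rw [ha.2, ha'.2]) (by rw [h1])
  funext n
  exact_mod_cast congrFun this n

lemma isIntegralSolution_of_recurs {V : RationalMukai} {a : ℕ → ℤ}
    (h : V.Recurs fun n => (a n : ℚ)) (h0 : a 0 = 1) : V.IsIntegralSolution a :=
  ⟨(isSolution_iff_recurs V _).2 h, h0⟩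

/-! ### Integral solutions for `V12` and `V16` by creative telescoping -/

/-- Summing a telescoping certificate over a range of indices beyond the supports. -/
lemma recurs_of_certificate {V : RationalMukai} {T : ℕ → ℕ → ℚ} {B : ℕ → ℕ → ℚ}
    (hT : ∀ n k, n < k → T n k = 0)
    (hcert : ∀ n k : ℕ, k ≤ n + 2 → ((n : ℚ) + 2) ^ 3 * T (n + 2) k - (V.midCoeff n : ℚ) * T (n + 1) k
      + (V.lastCoeff : ℚ) * ((n : ℚ) + 1) ^ 3 * T n k = B n (k + 1) - B n k)
    (hB0 : ∀ n, B n 0 = 0) (hB : ∀ n, B n (n + 3) = 0) :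
    V.Recurs fun n => ∑ k ∈ Finset.range (n + 1), T n k := by
  have ext : ∀ n m, n + 1 ≤ m →
      ∑ k ∈ Finset.range (n + 1), T n k = ∑ k ∈ Finset.range m, T n k := fun n m h =>
    Finset.sum_subset (Finset.range_subset_range.2 h) fun k _ hk => hT n k (by
      rw [Finset.mem_range] at hk; omega)
  intro n
  simp only
  rw [ext n (n + 3) (by omega), ext (n + 1) (n + 3) (by omega), Finset.mul_sum, Finset.mul_sum,
    Finset.mul_sum, ← Finset.sum_sub_distrib, ← Finset.sum_add_distrib,
    Finset.sum_congr rfl fun k hk => hcert n k (by rw [Finset.mem_range] at hk; omega),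
    Finset.sum_range_sub, hB0]
  rw [show n + 2 + 1 = n + 3 by rfl, hB, sub_zero]

/-- The factorial quotient `(n + k)! / ((n - k)! k! k!)`, zero for `n < k`. -/
def aperyTerm (n k : ℕ) : ℕ := n.choose k * (n + k).choose k

lemma aperyTerm_eq (n k j : ℕ) (h : k + j = n) :
    (aperyTerm n k : ℚ) = ((n + k).factorial : ℚ) / (j.factorial * k.factorial ^ 2) := by
  subst h
  have h1 := Nat.add_choose_mul_factorial_mul_factorial j k
  have h2 := Nat.add_choose_mul_factorial_mul_factorial (k + j) k
  rw [add_comm j k] at h1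
  have hk := Nat.factorial_ne_zero k
  have hj := Nat.factorial_ne_zero j
  have hkj := Nat.factorial_ne_zero (k + j)
  rw [eq_div_iff (by positivity)]
  rw [aperyTerm]
  have : (k + j).choose k * (k + j + k).choose k * (j.factorial * k.factorial ^ 2)
      = (k + j + k).factorial := by
    rw [← h2, ← h1]; ring
  exact_mod_cast this

/-- The base `u = (n+k)! / ((n+2-k)! k!²)` is chosen so that every term of the certificate is a
polynomial multiple of it. The certificate then becomes a polynomial identity; at `k = n+1` and `k =
n+2` the vanishing of the binomials is reproduced by the polynomial factors. -/
lemma exists_base_aperyTerm (n k : ℕ) (hk : k ≤ n + 2) : ∃ u : ℚ,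
    (aperyTerm n k : ℚ) = ((n : ℚ) + 2 - k) * (n + 1 - k) * u ∧
    (aperyTerm (n + 1) k : ℚ) = ((n : ℚ) + 1 + k) * (n + 2 - k) * u ∧
    (aperyTerm (n + 2) k : ℚ) = ((n : ℚ) + 2 + k) * (n + 1 + k) * u ∧
    (k : ℚ) ^ 2 * u = if k = 0 then 0 else (aperyTerm (n + 1) (k - 1) : ℚ) := by
  obtain ⟨j, hj⟩ := Nat.exists_eq_add_of_le hk
  have hn : (n : ℚ) = k + j - 2 := by
    have : ((n + 2 : ℕ) : ℚ) = ((k + j : ℕ) : ℚ) := by rw [hj]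
    push_cast at this
    linarith
  have fk := Nat.factorial_ne_zero k
  have fj := Nat.factorial_ne_zero j
  refine ⟨((n + k).factorial : ℚ) / (j.factorial * k.factorial ^ 2), ?_, ?_, ?_, ?_⟩
  · rcases j with - | - | j
    · rw [aperyTerm, Nat.choose_eq_zero_of_lt (by omega), hn]; simp
    · rw [aperyTerm, Nat.choose_eq_zero_of_lt (by omega), hn]; push_cast; ring
    · rw [aperyTerm_eq n k j (by omega), Nat.factorial_succ, Nat.factorial_succ, hn]
      have := Nat.factorial_ne_zero j
      push_cast
      field_simp
      ring
  · rcases j with - | j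
    · rw [aperyTerm, Nat.choose_eq_zero_of_lt (by omega), hn]; simp
    · rw [aperyTerm_eq (n + 1) k j (by omega), Nat.factorial_succ j,
        show n + 1 + k = n + k + 1 by ring, Nat.factorial_succ (n + k), hn]
      have := Nat.factorial_ne_zero j
      push_cast
      rw [hn]
      push_cast
      field_simp
      ring
  · rw [aperyTerm_eq (n + 2) k j (by omega), show n + 2 + k = n + k + 1 + 1 by ring,
      Nat.factorial_succ, Nat.factorial_succ]
    push_cast
    ring
  · rcases k with - | k
    · simp
    · rw [if_neg (by omega), Nat.add_sub_cancel, aperyTerm_eq (n + 1) k j (by omega),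
        Nat.factorial_succ k, show n + 1 + k = n + (k + 1) by ring]
      have := Nat.factorial_ne_zero k
      push_cast
      field_simp

lemma recurs_apery : V12.Recurs fun n => ∑ k ∈ Finset.range (n + 1), ((aperyTerm n k : ℚ)) ^ 2 := by
  -- Zagier's certificate for the Apéry numbers, shifted by one in `n` and in `k`.
  refine recurs_of_certificate (B := fun n k => if k = 0 then 0 else
    4 * (2 * (n : ℚ) + 3) * (((k : ℚ) - 1) * (2 * k - 1) - (2 * n + 3) ^ 2) *
      (aperyTerm (n + 1) (k - 1) : ℚ) ^ 2) ?_ ?_ ?_ ?_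
  · intro n k h
    rw [aperyTerm, Nat.choose_eq_zero_of_lt h]; simp
  · intro n k hk
    obtain ⟨u, h0, h1, h2, h3⟩ := exists_base_aperyTerm n k hk
    have e : (if k = 0 then 0 else 4 * (2 * (n : ℚ) + 3) *
        (((k : ℚ) - 1) * (2 * k - 1) - (2 * n + 3) ^ 2) * (aperyTerm (n + 1) (k - 1) : ℚ) ^ 2)
        = 4 * (2 * (n : ℚ) + 3) * (((k : ℚ) - 1) * (2 * k - 1) - (2 * n + 3) ^ 2) *
          ((k : ℚ) ^ 2 * u) ^ 2 := by
      rw [h3]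
      split_ifs <;> simp
    rw [e, if_neg (by omega), Nat.add_sub_cancel, h0, h1, h2]
    simp only [midCoeff, lastCoeff]
    push_cast
    ring
  · intro n; simp
  · intro n
    rw [if_neg (by omega), aperyTerm, Nat.choose_eq_zero_of_lt (by omega)]; simp

/-- The binomial product `(2 m)! / (m! k! (m - k)!)` with `m = n - k`, zero for `n < 2 * k`. -/
def doubleTerm (n k : ℕ) : ℕ := n.choose k * (2 * (n - k)).choose n

lemma doubleTerm_eq (k j : ℕ) : (doubleTerm (2 * k + j) k : ℚ) =
    ((2 * (k + j)).factorial : ℚ) / ((k + j).factorial * k.factorial * j.factorial) := by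
  have h1 := Nat.add_choose_mul_factorial_mul_factorial (k + j) k
  have h2 := Nat.add_choose_mul_factorial_mul_factorial (2 * k + j) j
  have hk := Nat.factorial_ne_zero k
  have hj := Nat.factorial_ne_zero j
  have hkj := Nat.factorial_ne_zero (k + j)
  rw [eq_div_iff (by positivity), doubleTerm, show 2 * k + j - k = k + j by omega]
  have : (2 * k + j).choose k * (2 * (k + j)).choose (2 * k + j) *
      ((k + j).factorial * k.factorial * j.factorial) = (2 * (k + j)).factorial := by
    rw [show 2 * (k + j) = 2 * k + j + j by ring, Nat.choose_symm_add, ← h2]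
    rw [show k + j + k = 2 * k + j by ring] at h1
    rw [← h1]
    ring
  exact_mod_cast this

lemma doubleTerm_eq_zero {n k : ℕ} (h : n < 2 * k) : doubleTerm n k = 0 := by
  rw [doubleTerm]
  rcases Nat.lt_or_ge n k with h' | h'
  · rw [Nat.choose_eq_zero_of_lt h', zero_mul]
  · rcases Nat.eq_zero_or_pos n with rfl | hn
    · omega
    · rw [Nat.choose_eq_zero_of_lt (n := 2 * (n - k)) (by omega), mul_zero]

/-- The same device as `exists_base_aperyTerm`, with base `(2(n-k))! / ((n-k)! k! (n-2k+3)!)`. Here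
`k ≤ n` is needed for the factorials of `n - k`. -/
lemma exists_base_doubleTerm (n k : ℕ) (hk : k ≤ n) (hk2 : 2 * k ≤ n + 3) : ∃ u : ℚ,
    (doubleTerm n k : ℚ) = ((n : ℚ) - 2 * k + 3) * (n - 2 * k + 2) * (n - 2 * k + 1) * u ∧
    (doubleTerm (n + 1) k : ℚ) =
      2 * (2 * ((n : ℚ) - k) + 1) * (n - 2 * k + 3) * (n - 2 * k + 2) * u ∧
    (doubleTerm (n + 2) k : ℚ) =
      4 * (2 * ((n : ℚ) - k) + 1) * (2 * (n - k) + 3) * (n - 2 * k + 3) * u ∧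
    4 * (2 * ((n : ℚ) - k) + 1) * (2 * (n - k) + 3) * k * u =
      if k = 0 then 0 else (doubleTerm (n + 1) (k - 1) : ℚ) := by
  obtain ⟨m, rfl⟩ := Nat.exists_eq_add_of_le hk
  obtain ⟨j, hj⟩ := Nat.exists_eq_add_of_le (show k ≤ m + 3 by omega)
  have hm : (m : ℚ) = k + j - 3 := by
    have : ((m + 3 : ℕ) : ℚ) = ((k + j : ℕ) : ℚ) := by rw [hj]
    push_cast at this
    linarith
  have fk := Nat.factorial_ne_zero k
  have fj := Nat.factorial_ne_zero j
  have fm := Nat.factorial_ne_zero m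
  have sk : ∀ i, m + i = k + (j + i - 3) → 3 ≤ j + i →
      (doubleTerm (k + m + i) k : ℚ) = ((2 * (m + i)).factorial : ℚ) /
        ((m + i).factorial * k.factorial * (j + i - 3).factorial) := by
    intro i hi _
    rw [show k + m + i = 2 * k + (j + i - 3) by omega, doubleTerm_eq, ← hi]
  have f1 : ((2 * (m + 1)).factorial : ℚ) = (2 * m + 2) * (2 * m + 1) * (2 * m).factorial := by
    rw [show 2 * (m + 1) = 2 * m + 1 + 1 by ring, Nat.factorial_succ, Nat.factorial_succ]
    push_cast; ring
  have f2 : ((2 * (m + 2)).factorial : ℚ) =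
      (2 * m + 4) * (2 * m + 3) * (2 * m + 2) * (2 * m + 1) * (2 * m).factorial := by
    rw [show 2 * (m + 2) = 2 * (m + 1) + 1 + 1 by ring, Nat.factorial_succ, Nat.factorial_succ]
    push_cast; rw [f1]; ring
  have g1 : ((m + 1).factorial : ℚ) = (m + 1) * m.factorial := by
    rw [Nat.factorial_succ]; push_cast; ring
  have g2 : ((m + 2).factorial : ℚ) = (m + 2) * (m + 1) * m.factorial := by
    rw [Nat.factorial_succ]; push_cast; rw [g1]; ring
  have p1 : (m : ℚ) + 1 ≠ 0 := by positivity
  have p2 : (m : ℚ) + 2 ≠ 0 := by positivity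
  have hc : ((k + m : ℕ) : ℚ) - 2 * k = j - 3 := by push_cast; linarith
  have hc' : ((k + m : ℕ) : ℚ) - k = m := by push_cast; ring
  refine ⟨((2 * m).factorial : ℚ) / (m.factorial * k.factorial * j.factorial), ?_, ?_, ?_, ?_⟩
  · rw [hc]
    rcases Nat.lt_or_ge j 3 with h | h
    · rw [doubleTerm_eq_zero (by omega)]
      interval_cases j <;> norm_num
    · obtain ⟨i, rfl⟩ := Nat.exists_eq_add_of_le' h
      have := sk 0 (by omega) (by omega)
      simp only [Nat.add_zero, Nat.add_sub_cancel] at this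
      have fi := Nat.factorial_ne_zero i
      rw [this, Nat.factorial_succ, Nat.factorial_succ, Nat.factorial_succ]
      push_cast
      field_simp
      ring
  · rw [hc, hc']
    rcases Nat.lt_or_ge j 2 with h | h
    · rw [doubleTerm_eq_zero (by omega)]
      interval_cases j <;> norm_num
    · obtain ⟨i, rfl⟩ := Nat.exists_eq_add_of_le' h
      have := sk 1 (by omega) (by omega)
      rw [show i + 2 + 1 - 3 = i by omega] at this
      have fi := Nat.factorial_ne_zero i
      rw [this, Nat.factorial_succ (i + 1), Nat.factorial_succ i, f1, g1]
      push_cast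
      field_simp
      ring
  · rw [hc, hc']
    rcases Nat.lt_or_ge j 1 with h | h
    · rw [doubleTerm_eq_zero (by omega)]
      interval_cases j; norm_num
    · obtain ⟨i, rfl⟩ := Nat.exists_eq_add_of_le' h
      have := sk 2 (by omega) (by omega)
      rw [show i + 1 + 2 - 3 = i by omega] at this
      have fi := Nat.factorial_ne_zero i
      rw [this, Nat.factorial_succ i, f2, g2]
      push_cast
      field_simp
      ring
  · rcases k with - | k
    · simp
    · rw [if_neg (by omega), Nat.add_sub_cancel, hc',
        show k + 1 + m + 1 = 2 * k + j by omega, doubleTerm_eq, show k + j = m + 2 by omega, f2, g2,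
        Nat.factorial_succ k]
      have := Nat.factorial_ne_zero k
      push_cast
      field_simp
      ring

lemma recurs_double : V16.Recurs fun n => ∑ k ∈ Finset.range (n + 1), ((doubleTerm n k : ℚ)) ^ 2 := by
  -- The numerator of the rational certificate. The denominator `2(2(n-k)+3)` below cancels against
  -- the factor relating `doubleTerm (n+1) (k-1)` to the base `u`.
  let p : ℚ → ℚ → ℚ := fun n K =>
    -(3744 + 9840 * n + 10064 * n ^ 2 + 4992 * n ^ 3 + 1200 * n ^ 4 + 112 * n ^ 5)
    + (10176 + 21824 * n + 17088 * n ^ 2 + 5760 * n ^ 3 + 704 * n ^ 4) * K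
    - (10304 + 17088 * n + 9216 * n ^ 2 + 1600 * n ^ 3) * K ^ 2
    + (4608 + 5376 * n + 1536 * n ^ 2) * K ^ 3 - (768 + 512 * n) * K ^ 4
  refine recurs_of_certificate (B := fun n k => (if k = 0 then 0 else
    (doubleTerm (n + 1) (k - 1) : ℚ)) ^ 2 * p n k / (2 * (2 * ((n : ℚ) - k) + 3)) ^ 2) ?_ ?_ ?_ ?_
  · intro n k h
    rw [doubleTerm_eq_zero (by omega)]; simp
  · intro n k hk
    rw [if_neg (by omega : k + 1 ≠ 0), Nat.add_sub_cancel]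
    rcases Nat.lt_or_ge (n + 3) (2 * k) with h | h
    · rw [doubleTerm_eq_zero (n := n) (by omega), doubleTerm_eq_zero (n := n + 1) (by omega),
        doubleTerm_eq_zero (n := n + 2) (by omega), if_neg (by omega),
        doubleTerm_eq_zero (n := n + 1) (by omega)]
      simp
    rcases Nat.lt_or_ge n k with h' | h'
    -- The only two pairs with `n < k` and `2k ≤ n + 3`, to which the base term does not apply.
    · obtain ⟨rfl, rfl⟩ | ⟨rfl, rfl⟩ : (n = 0 ∧ k = 1) ∨ (n = 1 ∧ k = 2) := by omega
      · norm_num [doubleTerm, p, midCoeff, lastCoeff, Nat.choose]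
      · norm_num [doubleTerm, p, midCoeff, lastCoeff, Nat.choose]
    · obtain ⟨u, h0, h1, h2, h3⟩ := exists_base_doubleTerm n k h' h
      have o1 : (2 * ((n : ℚ) - k) + 1) ≠ 0 := by
        have : (2 * ((n : ℤ) - k) + 1) ≠ 0 := by omega
        exact_mod_cast this
      have o3 : (2 * ((n : ℚ) - k) + 3) ≠ 0 := by
        have : (2 * ((n : ℤ) - k) + 3) ≠ 0 := by omega
        exact_mod_cast this
      have e1 : (2 * (2 * ((n : ℚ) - (k + 1 : ℕ)) + 3)) = 2 * (2 * ((n : ℚ) - k) + 1) := by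
        push_cast; ring
      have e2 : ((doubleTerm (n + 1) k : ℚ)) ^ 2 * p n (k + 1 : ℕ) / (2 * (2 * ((n : ℚ) - k) + 1)) ^ 2
          = ((n - 2 * k + 3) * (n - 2 * k + 2) * u) ^ 2 * p n (k + 1 : ℕ) := by
        rw [h1]; field_simp
      have e3 : (4 * (2 * ((n : ℚ) - k) + 1) * (2 * (n - k) + 3) * k * u) ^ 2 * p n k /
          (2 * (2 * ((n : ℚ) - k) + 3)) ^ 2 = (2 * (2 * ((n : ℚ) - k) + 1) * k * u) ^ 2 * p n k := by
        rw [div_eq_iff (by positivity)]; ring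
      rw [← h3, e1, e2, e3, h0, h1, h2]
      simp only [midCoeff, lastCoeff, p]
      push_cast
      ring
  · intro n; simp
  · intro n
    rw [if_neg (by omega), doubleTerm_eq_zero (by omega)]; simp

/-! ### The integral solution for `V18`: a pulled-back hypergeometric series -/

section PowerSeries

open PowerSeries

/-- `1 - 6 X - 27 X ^ 2` is the inverse square of an integral power series. -/
lemma exists_inverse_sqrt : ∃ G : ℤ⟦X⟧, constantCoeff G = 1 ∧
    G ^ 2 * (1 - 6 * X - 27 * X ^ 2) = 1 := by
  -- The factorization behind the proof is `1 - 6X - 27X² = (1-3X)² (1 - 4Z)` with `Z =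
  -- 9X²/(1-3X)²`. The square root of `1 - 4Z` is `1 - 2Z c(Z)` for the Catalan series `c`, which
  -- has integer coefficients.
  obtain ⟨w', hw⟩ : ∃ w', (1 - 3 * X : ℤ⟦X⟧) * w' = 1 :=
    IsUnit.exists_right_inv (isUnit_iff_constantCoeff.2 (by simp))
  have hs : HasSubst (9 * X ^ 2 * w' ^ 2 : ℤ⟦X⟧) := HasSubst.of_constantCoeff_zero' (by simp)
  obtain ⟨c, hc⟩ : ∃ c : ℤ⟦X⟧, c = 9 * X ^ 2 * w' ^ 2 * c ^ 2 + 1 := by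
    have h := congrArg (PowerSeries.map (Nat.castRingHom ℤ)) catalanSeries_sq_mul_X_add_one
    have h' := congrArg (subst (9 * X ^ 2 * w' ^ 2 : ℤ⟦X⟧)) h
    refine ⟨subst (9 * X ^ 2 * w' ^ 2 : ℤ⟦X⟧) (PowerSeries.map (Nat.castRingHom ℤ) catalanSeries), ?_⟩
    have h1 : subst (9 * X ^ 2 * w' ^ 2 : ℤ⟦X⟧) (1 : ℤ⟦X⟧) = 1 := by
      rw [← coe_substAlgHom hs, map_one]
    simp only [map_add, map_mul, map_pow, map_one, PowerSeries.map_X] at h'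
    rw [subst_add hs, subst_mul hs, subst_pow hs, subst_X hs, h1] at h'
    linear_combination -h'
  have hR : ((1 - 3 * X : ℤ⟦X⟧) * (1 - 18 * X ^ 2 * w' ^ 2 * c)) ^ 2 = 1 - 6 * X - 27 * X ^ 2 := by
    linear_combination (-(36 * X ^ 2) * ((1 - 3 * X) * w' + 1)) * hw -
      36 * X ^ 2 * w' ^ 2 * (1 - 3 * X : ℤ⟦X⟧) ^ 2 * hc
  have hR0 : constantCoeff ((1 - 3 * X : ℤ⟦X⟧) * (1 - 18 * X ^ 2 * w' ^ 2 * c)) = 1 := by simp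
  obtain ⟨G, hG⟩ := IsUnit.exists_right_inv (isUnit_iff_constantCoeff.2 (by rw [hR0]; exact isUnit_one))
  refine ⟨G, ?_, ?_⟩
  · have := congrArg constantCoeff hG
    rwa [map_mul, hR0, one_mul, map_one] at this
  · rw [← hR, ← mul_pow, mul_comm G, hG, one_pow]

/-- The Euler derivation `X d/dX`. -/
noncomputable def eulerDeriv (f : ℚ⟦X⟧) : ℚ⟦X⟧ := X * d⁄dX ℚ f

lemma coeff_eulerDeriv (f : ℚ⟦X⟧) (n : ℕ) : coeff n (eulerDeriv f) = n * coeff n f := by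
  rcases n with - | n
  · simp [eulerDeriv]
  · rw [eulerDeriv, coeff_succ_X_mul, coeff_derivative]; push_cast; ring

lemma eulerDeriv_mul (f g : ℚ⟦X⟧) :
    eulerDeriv (f * g) = eulerDeriv f * g + f * eulerDeriv g := by
  simp only [eulerDeriv, Derivation.leibniz, smul_eq_mul]; ring

lemma eulerDeriv_add (f g : ℚ⟦X⟧) : eulerDeriv (f + g) = eulerDeriv f + eulerDeriv g := by
  simp only [eulerDeriv, map_add]; ring

lemma eulerDeriv_natCast (n : ℕ) : eulerDeriv (n : ℚ⟦X⟧) = 0 := by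
  simp [eulerDeriv]

lemma eulerDeriv_X : eulerDeriv X = X := by simp [eulerDeriv]

lemma eulerDeriv_pow (f : ℚ⟦X⟧) (n : ℕ) :
    f * eulerDeriv (f ^ n) = n * f ^ n * eulerDeriv f := by
  induction n with
  | zero => simp [eulerDeriv]
  | succ n ih => rw [pow_succ, eulerDeriv_mul, mul_add, ← mul_assoc, ih]; push_cast; ring

/-- The operator of `V18` acting on power series. -/
noncomputable def opV18 (f : ℚ⟦X⟧) : ℚ⟦X⟧ :=
  (1 - 18 * X - 27 * X ^ 2) * eulerDeriv (eulerDeriv (eulerDeriv f))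
    - (27 * X + 81 * X ^ 2) * eulerDeriv (eulerDeriv f)
    - (15 * X + 81 * X ^ 2) * eulerDeriv f - (3 * X + 27 * X ^ 2) * f

lemma opV18_eq (f : ℚ⟦X⟧) : opV18 f = eulerDeriv (eulerDeriv (eulerDeriv f))
    - X * (C (18 : ℚ) * eulerDeriv (eulerDeriv (eulerDeriv f)) + C (27 : ℚ) * eulerDeriv (eulerDeriv f)
      + C (15 : ℚ) * eulerDeriv f + C (3 : ℚ) * f)
    - X ^ 2 * (C (27 : ℚ) * (eulerDeriv (eulerDeriv (eulerDeriv f))) + C (81 : ℚ) *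
      eulerDeriv (eulerDeriv f) + C (81 : ℚ) * eulerDeriv f + C (27 : ℚ) * f) := by
  simp only [opV18, map_ofNat]; ring

lemma coeff_opV18 (f : ℚ⟦X⟧) (n : ℕ) : coeff (n + 2) (opV18 f) =
    ((n : ℚ) + 2) ^ 3 * coeff (n + 2) f - (V18.midCoeff n : ℚ) * coeff (n + 1) f
      + (V18.lastCoeff : ℚ) * ((n : ℚ) + 1) ^ 3 * coeff n f := by
  rw [opV18_eq]
  simp only [map_sub, map_add, coeff_C_mul, coeff_eulerDeriv,
    show n + 2 = n + 1 + 1 from rfl, coeff_succ_X_mul, midCoeff, lastCoeff]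
  rw [show n + 1 + 1 = n + 2 from rfl, coeff_X_pow_mul]
  simp only [map_add, coeff_C_mul, coeff_eulerDeriv]
  push_cast
  ring

lemma coeff_one_opV18 (f : ℚ⟦X⟧) : coeff 1 (opV18 f) = coeff 1 f - 3 * coeff 0 f := by
  rw [opV18_eq, map_sub, map_sub, show (1 : ℕ) = 0 + 1 from rfl, coeff_succ_X_mul,
    pow_two, mul_assoc, coeff_succ_X_mul]
  have h0 : ∀ g, constantCoeff (eulerDeriv g) = 0 := fun g => by simp [eulerDeriv]
  simp [coeff_eulerDeriv, h0]

lemma opV18_add (f g : ℚ⟦X⟧) : opV18 (f + g) = opV18 f + opV18 g := by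
  simp only [opV18, eulerDeriv_add]; ring

lemma opV18_natCast_mul (c : ℕ) (f : ℚ⟦X⟧) : opV18 (c * f) = c * opV18 f := by
  simp only [opV18, eulerDeriv_mul, eulerDeriv_natCast, zero_mul, zero_add]; ring

lemma eulerDeriv_inverse_sqrt {G : ℚ⟦X⟧} (hG : G ^ 2 * (1 - 6 * X - 27 * X ^ 2) = 1) :
    eulerDeriv G = G * (G ^ 2 * (3 * X + 27 * X ^ 2)) := by
  have h := congrArg eulerDeriv hG
  have h0 : eulerDeriv (1 : ℚ⟦X⟧) = 0 := by simp [eulerDeriv]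
  have hQ : eulerDeriv (1 - 6 * X - 27 * X ^ 2 : ℚ⟦X⟧) = -(6 * X) - 54 * X ^ 2 := by
    have e1 : d⁄dX ℚ (6 : ℚ⟦X⟧) = 0 := by
      simpa using (d⁄dX ℚ).map_natCast 6
    have e2 : d⁄dX ℚ (27 : ℚ⟦X⟧) = 0 := by
      simpa using (d⁄dX ℚ).map_natCast 27
    simp only [eulerDeriv, map_sub, Derivation.leibniz, smul_eq_mul, derivative_X, e1, e2,
      Derivation.map_one_eq_zero, Derivation.leibniz_pow]
    simp only [nsmul_eq_mul]
    push_cast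
    ring
  rw [pow_two, eulerDeriv_mul, eulerDeriv_mul, hQ, h0] at h
  have h2 : (2 : ℚ⟦X⟧) ≠ 0 := fun h => by
    have h' := congrArg constantCoeff h
    rw [map_ofNat, map_zero] at h'
    norm_num at h'
  apply mul_left_cancel₀ h2
  linear_combination G * h - 2 * eulerDeriv G * hG

lemma eulerDeriv_eulerDeriv_of_eq_mul {T κ c H H1 : ℚ⟦X⟧} (dT : eulerDeriv T = T * (κ + c * H))
    (dκ : eulerDeriv κ = 0) (dc : eulerDeriv c = 0) (dH : eulerDeriv H = H1) :
    eulerDeriv (eulerDeriv T) = T * ((κ + c * H) ^ 2 + c * H1) := by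
  rw [dT, eulerDeriv_mul, dT, eulerDeriv_add, eulerDeriv_mul, dκ, dc, dH]; ring

lemma eulerDeriv_eulerDeriv_eulerDeriv_of_eq_mul {T κ c H H1 H2 : ℚ⟦X⟧}
    (dT : eulerDeriv T = T * (κ + c * H))
    (dκ : eulerDeriv κ = 0) (dc : eulerDeriv c = 0) (dH : eulerDeriv H = H1)
    (dH1 : eulerDeriv H1 = H2) :
    eulerDeriv (eulerDeriv (eulerDeriv T)) =
      T * ((κ + c * H) ^ 3 + 3 * c * (κ + c * H) * H1 + c * H2) := by
  rw [eulerDeriv_eulerDeriv_of_eq_mul dT dκ dc dH, eulerDeriv_mul, dT, eulerDeriv_add, pow_two,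
    eulerDeriv_mul, eulerDeriv_mul c H1, eulerDeriv_add, eulerDeriv_mul c H, dκ, dc, dH, dH1]
  ring

/-- The term is `G z^k` with `z = (X G²)³`. In the modular parametrization `z` is `1/j`, and the
operator is a pullback of the one for `₃F₂(1/6, 1/2, 5/6; 1, 1; 1728 z)`; hence the image involves
only the terms `k` and `k + 1`. The proof writes all derivatives of the term through the logarithmic
derivative `H` of `G` and clears the denominator `Q³`. -/
lemma opV18_term {G : ℚ⟦X⟧} (hG : G ^ 2 * (1 - 6 * X - 27 * X ^ 2) = 1) (k : ℕ) :
    opV18 (X ^ (3 * k) * G ^ (6 * k + 1)) =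
    27 * (1 + 27 * X ^ 2) * ((k : ℚ⟦X⟧) ^ 3 * (X ^ (3 * k) * G ^ (6 * k + 1)) -
      24 * (6 * (k : ℚ⟦X⟧) + 1) * (2 * (k : ℚ⟦X⟧) + 1) * (6 * (k : ℚ⟦X⟧) + 5) *
        (X ^ (3 * (k + 1)) * G ^ (6 * (k + 1) + 1))) := by
  set Q : ℚ⟦X⟧ := 1 - 6 * X - 27 * X ^ 2 with hQ
  have hQ0 : Q ≠ 0 := by rintro h; rw [h, mul_zero] at hG; exact zero_ne_one hG
  have hG0 : G ≠ 0 := by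
    rintro rfl
    rw [zero_pow two_ne_zero, zero_mul] at hG; exact zero_ne_one hG
  set y : ℚ⟦X⟧ := G ^ 2 with hy
  set T : ℚ⟦X⟧ := X ^ (3 * k) * G ^ (6 * k + 1) with hT
  set h : ℚ⟦X⟧ := 3 * X + 27 * X ^ 2 with hh
  set j : ℚ⟦X⟧ := 3 * X + 54 * X ^ 2 with hj
  set l : ℚ⟦X⟧ := 3 * X + 108 * X ^ 2 with hl
  set H : ℚ⟦X⟧ := y * h with hH
  set H1 : ℚ⟦X⟧ := 2 * y ^ 2 * h ^ 2 + y * j with hH1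
  set H2 : ℚ⟦X⟧ := 8 * y ^ 3 * h ^ 3 + 6 * y ^ 2 * h * j + y * l with hH2
  set c : ℚ⟦X⟧ := 6 * (k : ℚ⟦X⟧) + 1 with hc
  set κ : ℚ⟦X⟧ := 3 * (k : ℚ⟦X⟧) with hκ
  have dG : eulerDeriv G = G * H := eulerDeriv_inverse_sqrt hG
  have n0 : ∀ n : ℕ, eulerDeriv (n : ℚ⟦X⟧) = 0 := eulerDeriv_natCast
  have dX2 : eulerDeriv (X ^ 2 : ℚ⟦X⟧) = 2 * X ^ 2 := by
    rw [pow_two, eulerDeriv_mul, eulerDeriv_X]; ring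
  have lin : ∀ m : ℕ, eulerDeriv (3 * X + (m : ℚ⟦X⟧) * X ^ 2) = 3 * X + 2 * (m : ℚ⟦X⟧) * X ^ 2 := by
    intro m
    have : (3 : ℚ⟦X⟧) = ((3 : ℕ) : ℚ⟦X⟧) := by norm_num
    rw [eulerDeriv_add, eulerDeriv_mul, eulerDeriv_mul, this, n0, n0, dX2, eulerDeriv_X]
    ring
  have dh : eulerDeriv h = j := by
    have := lin 27
    norm_num at this
    exact this
  have dj : eulerDeriv j = l := by
    have := lin 54
    norm_num at this
    exact this
  have dy : eulerDeriv y = 2 * y * H := by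
    rw [hy, pow_two, eulerDeriv_mul, dG]; ring
  have dH : eulerDeriv H = H1 := by
    rw [hH, eulerDeriv_mul, dy, dh]; ring
  have d2 : eulerDeriv (2 : ℚ⟦X⟧) = 0 := by simpa using n0 2
  have dH1 : eulerDeriv H1 = H2 := by
    rw [hH1, eulerDeriv_add, pow_two, pow_two, eulerDeriv_mul, eulerDeriv_mul, eulerDeriv_mul,
      eulerDeriv_mul, eulerDeriv_mul, d2, dy, dh, dj]
    ring
  have dc : eulerDeriv c = 0 := by
    have := n0 (6 * k + 1); push_cast at this; exact this
  have dκ : eulerDeriv κ = 0 := by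
    have := n0 (3 * k); push_cast at this; exact this
  have dT : eulerDeriv T = T * (κ + c * H) := by
    have e1 := eulerDeriv_pow (X : ℚ⟦X⟧) (3 * k)
    have e2 := eulerDeriv_pow G (6 * k + 1)
    rw [eulerDeriv_X] at e1
    rw [dG] at e2
    have e1' : eulerDeriv (X ^ (3 * k) : ℚ⟦X⟧) = κ * X ^ (3 * k) := by
      apply mul_left_cancel₀ (X_ne_zero (R := ℚ))
      rw [e1, hκ]; push_cast; ring
    have e2' : eulerDeriv (G ^ (6 * k + 1)) = c * G ^ (6 * k + 1) * H := by
      apply mul_left_cancel₀ hG0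
      rw [e2, hc]; push_cast; ring
    rw [hT, eulerDeriv_mul, e1', e2']; ring
  have dT2 : eulerDeriv (eulerDeriv T) = T * ((κ + c * H) ^ 2 + c * H1) := by
    exact eulerDeriv_eulerDeriv_of_eq_mul dT dκ dc dH
  have dT3 : eulerDeriv (eulerDeriv (eulerDeriv T)) =
      T * ((κ + c * H) ^ 3 + 3 * c * (κ + c * H) * H1 + c * H2) := by
    exact eulerDeriv_eulerDeriv_eulerDeriv_of_eq_mul dT dκ dc dH dH1
  have hT' : (X ^ (3 * (k + 1)) * G ^ (6 * (k + 1) + 1) : ℚ⟦X⟧) = T * (X ^ 3 * y ^ 3) := by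
    rw [hT, hy]; ring
  have E0 : y * Q = 1 := hG
  have E3 : Q ^ 3 * y ^ 3 = 1 := by rw [← mul_pow, mul_comm, E0, one_pow]
  have F1 : Q * H = h := by rw [hH]; linear_combination h * E0
  have F11 : Q ^ 2 * H ^ 2 = h ^ 2 := by rw [← mul_pow, F1]
  have F111 : Q ^ 3 * H ^ 3 = h ^ 3 := by rw [← mul_pow, F1]
  have F2 : Q ^ 2 * H1 = 2 * h ^ 2 + Q * j := by
    rw [hH1]; linear_combination (2 * h ^ 2 * (y * Q + 1) + Q * j) * E0
  have F12 : Q ^ 3 * (H * H1) = h * (2 * h ^ 2 + Q * j) := by rw [← F2, ← F1]; ring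
  have F3 : Q ^ 3 * H2 = 8 * h ^ 3 + 6 * Q * h * j + Q ^ 2 * l := by
    rw [hH2]
    linear_combination (8 * h ^ 3 * (y ^ 2 * Q ^ 2 + y * Q + 1) + 6 * Q * h * j * (y * Q + 1)
      + Q ^ 2 * l) * E0
  rw [opV18, dT3, dT2, dT, hT']
  apply mul_left_cancel₀ (pow_ne_zero 3 hQ0)
  set α : ℚ⟦X⟧ := 1 - 18 * X - 27 * X ^ 2 with hα
  set β : ℚ⟦X⟧ := -(27 * X + 81 * X ^ 2) with hβ
  set γ : ℚ⟦X⟧ := -(15 * X + 81 * X ^ 2) with hγ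
  -- What remains after clearing `Q³`: a polynomial identity in `X` and `k`.
  have key : Q ^ 3 * (α * κ ^ 3 + β * κ ^ 2 + γ * κ - (3 * X + 27 * X ^ 2))
      + (3 * α * κ ^ 2 * c + 2 * β * κ * c + γ * c) * Q ^ 2 * h
      + (3 * α * κ * c ^ 2 + β * c ^ 2) * Q * h ^ 2 + α * c ^ 3 * h ^ 3
      + (3 * α * c * κ + β * c) * Q * (2 * h ^ 2 + Q * j)
      + 3 * α * c ^ 2 * (h * (2 * h ^ 2 + Q * j))
      + α * c * (8 * h ^ 3 + 6 * Q * h * j + Q ^ 2 * l) =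
      27 * (1 + 27 * X ^ 2) * ((k : ℚ⟦X⟧) ^ 3 * Q ^ 3 -
      24 * (6 * (k : ℚ⟦X⟧) + 1) * (2 * (k : ℚ⟦X⟧) + 1) * (6 * (k : ℚ⟦X⟧) + 5) * X ^ 3) := by
    rw [hα, hβ, hγ, hκ, hc, hh, hj, hl, hQ]; ring
  linear_combination T * key + T * (3 * α * κ ^ 2 * c + 2 * β * κ * c + γ * c) * Q ^ 2 * F1
    + T * (3 * α * κ * c ^ 2 + β * c ^ 2) * Q * F11 + T * α * c ^ 3 * F111
    + T * (3 * α * c * κ + β * c) * Q * F2 + T * 3 * α * c ^ 2 * F12 + T * α * c * F3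
    + T * 27 * (1 + 27 * X ^ 2) * 24 * (6 * (k : ℚ⟦X⟧) + 1) * (2 * (k : ℚ⟦X⟧) + 1) * (6 * (k : ℚ⟦X⟧) + 5) * X ^ 3 * E3

end PowerSeries

/-- `(6 k)! / ((3 k)! (k !) ^ 3)`. -/
def sexticCoeff (k : ℕ) : ℕ := (6 * k).choose (3 * k) * (3 * k).choose k * (2 * k).choose k

lemma sexticCoeff_mul (k : ℕ) :
    sexticCoeff k * ((3 * k).factorial * k.factorial ^ 3) = (6 * k).factorial := by
  have h1 := Nat.choose_mul_factorial_mul_factorial (show 3 * k ≤ 6 * k by omega)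
  have h2 := Nat.choose_mul_factorial_mul_factorial (show k ≤ 3 * k by omega)
  have h3 := Nat.choose_mul_factorial_mul_factorial (show k ≤ 2 * k by omega)
  rw [show 6 * k - 3 * k = 3 * k by omega] at h1
  rw [show 3 * k - k = 2 * k by omega] at h2
  rw [show 2 * k - k = k by omega] at h3
  calc _ = (6 * k).choose (3 * k) * (3 * k).factorial * ((3 * k).choose k * k.factorial *
        ((2 * k).choose k * k.factorial * k.factorial)) := by rw [sexticCoeff]; ring
    _ = _ := by rw [h3, h2, h1]

/-- This is the ratio for which the two parts of `opV18_term` telescope when summed over `k`. -/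
lemma sexticCoeff_succ (k : ℕ) : sexticCoeff (k + 1) * (k + 1) ^ 3 =
    24 * (6 * k + 1) * (2 * k + 1) * (6 * k + 5) * sexticCoeff k := by
  have h0 := sexticCoeff_mul k
  have h1 := sexticCoeff_mul (k + 1)
  have e1 : (6 * (k + 1)).factorial = (6 * k + 6) * ((6 * k + 5) * ((6 * k + 4) * ((6 * k + 3) *
      ((6 * k + 2) * ((6 * k + 1) * (6 * k).factorial))))) := by
    rw [show 6 * (k + 1) = 6 * k + 5 + 1 by ring]
    simp only [Nat.factorial_succ]
  have e2 : (3 * (k + 1)).factorial = (3 * k + 3) * ((3 * k + 2) * ((3 * k + 1) *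
      (3 * k).factorial)) := by
    rw [show 3 * (k + 1) = 3 * k + 2 + 1 by ring]
    simp only [Nat.factorial_succ]
  rw [e1, e2, Nat.factorial_succ, ← h0] at h1
  have hp : 0 < (3 * k + 3) * (3 * k + 2) * (3 * k + 1) * ((3 * k).factorial * k.factorial ^ 3) := by
    positivity
  apply Nat.eq_of_mul_eq_mul_right hp
  calc _ = sexticCoeff (k + 1) * ((3 * k + 3) * ((3 * k + 2) * ((3 * k + 1) *
      (3 * k).factorial)) * ((k + 1) * k.factorial) ^ 3) := by ring
    _ = _ := by rw [h1]; ring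

section PowerSeries

open PowerSeries

/-- Partial sums of the expansion of the holomorphic solution for `V18`. -/
noncomputable def sexticSum {R : Type*} [CommRing R] (G : R⟦X⟧) (K : ℕ) : R⟦X⟧ :=
  ∑ k ∈ Finset.range K, (sexticCoeff k : R⟦X⟧) * (X ^ (3 * k) * G ^ (6 * k + 1))

lemma coeff_sexticSum {R : Type*} [CommRing R] (G : R⟦X⟧) {n K : ℕ} (h : n + 1 ≤ K) :
    coeff n (sexticSum G K) = coeff n (sexticSum G (n + 1)) := by
  induction K, h using Nat.le_induction with
  | base => rfl
  | succ K hK ih =>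
    rw [sexticSum, Finset.sum_range_succ, ← sexticSum, map_add, ih, mul_left_comm, coeff_X_pow_mul',
      if_neg (by omega), add_zero]

/-- Consecutive terms cancel by `opV18_term` and `sexticCoeff_succ`, leaving one boundary term
divisible by `X ^ (3 * K)`. Any fixed coefficient is therefore killed by a long enough partial sum,
and no infinite sum of power series is needed. -/
lemma opV18_sexticSum {G : ℚ⟦X⟧} (hG : G ^ 2 * (1 - 6 * X - 27 * X ^ 2) = 1) (K : ℕ) :
    opV18 (sexticSum G K) = -(27 * (1 + 27 * X ^ 2) * (K : ℚ⟦X⟧) ^ 3 * (sexticCoeff K : ℚ⟦X⟧) *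
      (X ^ (3 * K) * G ^ (6 * K + 1))) := by
  induction K with
  | zero =>
    simp [sexticSum, opV18, eulerDeriv]
  | succ K ih =>
    have h : ((sexticCoeff (K + 1) : ℕ) : ℚ⟦X⟧) * ((K : ℚ⟦X⟧) + 1) ^ 3 =
        24 * (6 * (K : ℚ⟦X⟧) + 1) * (2 * (K : ℚ⟦X⟧) + 1) * (6 * (K : ℚ⟦X⟧) + 5) *
          (sexticCoeff K : ℚ⟦X⟧) := by
      exact_mod_cast congrArg (Nat.cast (R := ℚ⟦X⟧)) (sexticCoeff_succ K)
    rw [sexticSum, Finset.sum_range_succ, ← sexticSum, opV18_add, opV18_natCast_mul, ih,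
      opV18_term hG]
    push_cast
    linear_combination 27 * (1 + 27 * X ^ 2) * (X ^ (3 * (K + 1)) * G ^ (6 * (K + 1) + 1)) * h

lemma coeff_opV18_sexticSum {G : ℚ⟦X⟧} (hG : G ^ 2 * (1 - 6 * X - 27 * X ^ 2) = 1) {n K : ℕ}
    (h : n + 1 ≤ K) : coeff n (opV18 (sexticSum G K)) = 0 := by
  rw [opV18_sexticSum hG, mul_left_comm, ← mul_neg, coeff_X_pow_mul', if_neg (by omega)]

lemma exists_recurs_V18 : ∃ a : ℕ → ℤ, a 0 = 1 ∧ a 1 = 3 ∧ V18.Recurs fun n => (a n : ℚ) := by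
  obtain ⟨G, hG0, hG⟩ := exists_inverse_sqrt
  set G' : ℚ⟦X⟧ := PowerSeries.map (Int.castRingHom ℚ) G with hG'
  have hQ : G' ^ 2 * (1 - 6 * X - 27 * X ^ 2) = 1 := by
    have := congrArg (PowerSeries.map (Int.castRingHom ℚ)) hG
    simpa only [map_mul, map_pow, map_sub, map_one, map_ofNat, PowerSeries.map_X] using this
  have hA : ∀ K, PowerSeries.map (Int.castRingHom ℚ) (sexticSum G K) = sexticSum G' K := by
    intro K
    simp only [sexticSum, map_sum, map_mul, map_pow, map_natCast, PowerSeries.map_X, hG']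
  have hc : ∀ n K, n + 1 ≤ K →
      (((coeff n (sexticSum G (n + 1)) : ℤ)) : ℚ) = coeff n (sexticSum G' K) := by
    intro n K h
    rw [coeff_sexticSum G' h, ← hA, PowerSeries.coeff_map]; rfl
  have h0 : coeff 0 (sexticSum G (0 + 1)) = 1 := by
    simp [sexticSum, sexticCoeff, hG0]
  refine ⟨fun n => coeff n (sexticSum G (n + 1)), h0, ?_, fun n => ?_⟩
  -- The coefficient of `X` lies below the range of the recurrence; it is the extra equation `a 1 =
  -- 3 * a 0`.
  · have h := coeff_opV18_sexticSum hQ (le_refl (1 + 1))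
    rw [coeff_one_opV18, ← hc 1 2 le_rfl, ← hc 0 2 (by norm_num), h0] at h
    have : ((coeff 1 (sexticSum G (1 + 1)) : ℤ) : ℚ) = 3 := by
      push_cast at h; linarith
    exact_mod_cast this
  · have h := coeff_opV18_sexticSum hQ (le_refl (n + 2 + 1))
    rw [coeff_opV18, ← hc (n + 2) _ le_rfl, ← hc (n + 1) _ (by omega), ← hc n _ (by omega)] at h
    exact h

end PowerSeries

lemma exists_integralSolution (V : RationalMukai) : ∃ a : ℕ → ℤ, V.IsIntegralSolution a ∧
    a 1 = V.secondTerm ∧ V.Recurs fun n => (a n : ℚ) := by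
  suffices h : ∃ a : ℕ → ℤ, a 0 = 1 ∧ a 1 = V.secondTerm ∧ V.Recurs fun n => (a n : ℚ) by
    obtain ⟨a, h0, h1, h⟩ := h
    exact ⟨a, isIntegralSolution_of_recurs h h0, h1, h⟩
  cases V with
  | V12 =>
    refine ⟨fun n => ∑ k ∈ Finset.range (n + 1), (aperyTerm n k : ℤ) ^ 2, rfl, rfl, ?_⟩
    convert recurs_apery using 2
    push_cast; rfl
  | V16 =>
    refine ⟨fun n => ∑ k ∈ Finset.range (n + 1), (doubleTerm n k : ℤ) ^ 2, rfl, rfl, ?_⟩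
    convert recurs_double using 2
    push_cast; rfl
  | V18 => exact exists_recurs_V18

lemma existsUnique_integralSolution (V : RationalMukai) : ∃! a : ℕ → ℤ, V.IsIntegralSolution a := by
  obtain ⟨a, ha, -⟩ := exists_integralSolution V
  exact ⟨a, ha, fun a' ha' => ha'.unique ha⟩

/-! ### Growth of the integral solution and the criterion for the limit -/

/-- A lower bound for the growth rate of the integral solution. -/
def growth : RationalMukai → ℝ
  | V12 => 5
  | V16 => 8
  | V18 => 7

lemma growth_pos (V : RationalMukai) : 0 < V.growth := by cases V <;> norm_num [growth]

/-- From index 1 on, each ratio of successive terms is at least `growth`. The first ratio is only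
`secondTerm`, and the factor 3 compensates for it. For `V12` and `V16` the last term of the
recurrence enters negatively and is controlled by the previous ratio, hence the simultaneous
induction. -/
lemma growth_le {V : RationalMukai} {a : ℕ → ℝ} (h0 : a 0 = 1) (h1 : a 1 = V.secondTerm)
    (h : V.Recurs a) (n : ℕ) : V.growth ^ n / 3 ≤ a n := by
  have key : ∀ n, 0 < a n ∧ (V.secondTerm : ℝ) * a n ≤ a (n + 1) ∧
      V.growth * a (n + 1) ≤ a (n + 2) := by
    intro n
    have step : ∀ m : ℕ, 0 < a m → (V.secondTerm : ℝ) * a m ≤ a (m + 1) →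
        V.growth * a (m + 1) ≤ a (m + 2) := by
      intro m hm hm'
      have hr := h m
      have hp : (0 : ℝ) < ((m : ℝ) + 2) ^ 3 := by positivity
      have hm0 : (0 : ℝ) ≤ m := m.cast_nonneg
      refine le_of_mul_le_mul_left ?_ hp
      have q1 : 0 ≤ ((m : ℝ) + 1) ^ 3 * a m := by positivity
      have q2 : ((m : ℝ) + 1) ^ 3 * ((V.secondTerm : ℝ) * a m) ≤ ((m : ℝ) + 1) ^ 3 * a (m + 1) := by
        gcongr
      cases V with
      | V12 =>
        simp only [midCoeff, lastCoeff, secondTerm, growth] at *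
        push_cast at *
        have q3 : 0 ≤ a (m + 1) := by linarith
        have : 0 ≤ (28 * (m : ℝ) ^ 3 + 120 * m ^ 2 + 165 * m + 70) * a (m + 1) := by positivity
        nlinarith
      | V16 =>
        simp only [midCoeff, lastCoeff, secondTerm, growth] at *
        push_cast at *
        have q3 : 0 ≤ a (m + 1) := by linarith
        have : 0 ≤ (12 * (m : ℝ) ^ 3 + 48 * m ^ 2 + 56 * m + 16) * a (m + 1) := by positivity
        nlinarith
      | V18 =>
        simp only [midCoeff, lastCoeff, secondTerm, growth] at *
        push_cast at *
        have q3 : 0 ≤ a (m + 1) := by linarith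
        have : 0 ≤ (11 * (m : ℝ) ^ 3 + 39 * m ^ 2 + 39 * m + 7) * a (m + 1) := by positivity
        nlinarith
    have hs : (0 : ℝ) < V.secondTerm := by cases V <;> norm_num [secondTerm]
    have hsg : (V.secondTerm : ℝ) ≤ V.growth := by cases V <;> norm_num [secondTerm, growth]
    induction n with
    | zero =>
      have e : (V.secondTerm : ℝ) * a 0 ≤ a (0 + 1) := by rw [h0, zero_add, h1, mul_one]
      exact ⟨by rw [h0]; exact one_pos, e, step 0 (by rw [h0]; exact one_pos) e⟩
    | succ n ih =>
      obtain ⟨i1, i2, i3⟩ := ih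
      have p1 : 0 < a (n + 1) := lt_of_lt_of_le (mul_pos hs i1) i2
      have p2 : (V.secondTerm : ℝ) * a (n + 1) ≤ a (n + 1 + 1) :=
        (mul_le_mul_of_nonneg_right hsg p1.le).trans i3
      exact ⟨p1, p2, step (n + 1) p1 p2⟩
  rcases n with - | n
  · rw [h0]; norm_num
  · induction n with
    | zero =>
      rw [h1]; cases V <;> norm_num [secondTerm, growth]
    | succ n ih =>
      refine le_trans ?_ (key n).2.2
      rw [pow_succ', mul_div_assoc]
      exact mul_le_mul_of_nonneg_left ih V.growth_pos.le

/-- The limit of `b n / a n` from a small solution of the recurrence. -/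
lemma tendsto_div_of_remainder {V : RationalMukai} {r : ℕ → ℝ} {κ l : ℝ} (hκ : κ ≠ 0)
    (hr : V.Recurs r) (h0 : r 0 = κ * l) (h1 : r 1 = κ * (l * V.secondTerm - 1))
    (hlim : Tendsto (fun n => r n / V.growth ^ n) atTop (𝓝 0))
    {a : ℕ → ℤ} {b : ℕ → ℚ} (ha : V.IsIntegralSolution a) (hb : V.IsSecondSolution b) :
    Tendsto (fun n => ((b n : ℚ) : ℂ) / ((a n : ℤ) : ℂ)) atTop (𝓝 (l : ℂ)) := by
  obtain ⟨a', ha', ha1, har⟩ := exists_integralSolution V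
  obtain rfl := ha.unique ha'
  have haR : V.Recurs fun n => (a n : ℝ) := by
    have := har.map (Rat.castHom ℝ)
    simpa using this
  have hbR : V.Recurs fun n => (b n : ℝ) := by
    have := ((isSolution_iff_recurs V _).1 hb.1).map (Rat.castHom ℝ)
    simpa using this
  have hab : ∀ n, r n = κ * l * a n + -κ * b n := by
    have := hr.ext (haR.linear_combination hbR (κ * l) (-κ))
      (by simp [h0, ha.2, hb.2.1]) (by simp only [h1, ha1, hb.2.2]; push_cast; ring)
    exact fun n => congrFun this n
  have hg : ∀ n, V.growth ^ n / 3 ≤ (a n : ℝ) := growth_le (a := fun n => (a n : ℝ))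
    (by simp [ha.2]) (by simp [ha1]) haR
  have hpos : ∀ n, (0 : ℝ) < a n := fun n =>
    lt_of_lt_of_le (div_pos (pow_pos V.growth_pos n) three_pos) (hg n)
  have hra : Tendsto (fun n => r n / a n) atTop (𝓝 0) := by
    refine squeeze_zero_norm (a := fun n => 3 * ‖r n / V.growth ^ n‖) (fun n => ?_)
      (by simpa using hlim.norm.const_mul 3)
    have hgn := pow_pos V.growth_pos n
    rw [norm_div, norm_div, Real.norm_of_nonneg (hpos n).le, Real.norm_of_nonneg hgn.le,
      ← mul_div_assoc, div_le_div_iff₀ (hpos n) hgn]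
    nlinarith [hg n, norm_nonneg (r n)]
  have hlimR : Tendsto (fun n => (b n : ℝ) / a n) atTop (𝓝 l) := by
    have := (tendsto_const_nhds (x := l)).sub (hra.const_mul κ⁻¹)
    rw [mul_zero, sub_zero] at this
    refine this.congr fun n => ?_
    rw [hab n]
    have := (hpos n).ne'
    field_simp
    ring
  have := (Complex.continuous_ofReal.tendsto l).comp hlimR
  refine this.congr fun n => ?_
  simp

/-! ### Small solutions for `V12` and `V16`: sums of derivatives of rational functions -/

lemma summable_one_div_shift_cube {c : ℝ} (hc : 0 < c) :
    Summable fun m : ℕ => 1 / (c + m) ^ 3 := by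
  refine ((Real.summable_one_div_nat_add_rpow c 3).2 (by norm_num)).congr fun m => ?_
  rw [abs_of_pos (by positivity), add_comm, ← Real.rpow_natCast]
  norm_num

/-- Telescoping of a summable sequence. -/
lemma tsum_eq_neg_of_telescope {f g : ℕ → ℝ} (hf : Summable f) (h : ∀ m, f m = g (m + 1) - g m)
    (hg : Tendsto g atTop (𝓝 0)) : ∑' m, f m = -g 0 := by
  have h1 := hf.hasSum.tendsto_sum_nat
  have h2 : ∀ n, ∑ i ∈ Finset.range n, f i = g n - g 0 := fun n => by
    rw [Finset.sum_congr rfl fun i _ => h i, Finset.sum_range_sub]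
  have h3 := hg.sub_const (g 0)
  rw [zero_sub] at h3
  exact tendsto_nhds_unique h1 (h3.congr fun n => (h2 n).symm)

lemma norm_two_mul_mul_le {x y s C : ℝ} (hs : 0 < s) (hx : |x| ≤ C / s) (hy : |y| ≤ C / s ^ 2) :
    ‖2 * x * y‖ ≤ 2 * C ^ 2 * (1 / s ^ 3) := by
  rw [Real.norm_eq_abs, abs_mul, abs_mul, abs_two, mul_assoc]
  have := (abs_nonneg x).trans hx
  calc 2 * (|x| * |y|) ≤ 2 * (C / s * (C / s ^ 2)) := by gcongr
    _ = _ := by field_simp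

lemma summable_two_mul_mul {f g : ℝ → ℝ} {C c : ℝ} (hc : 0 < c)
    (hf : ∀ s, 0 < s → |f s| ≤ C / s) (hg : ∀ s, 0 < s → |g s| ≤ C / s ^ 2) :
    Summable fun m : ℕ => 2 * f (c + m) * g (c + m) :=
  Summable.of_norm_bounded ((summable_one_div_shift_cube hc).mul_left (2 * C ^ 2)) fun m =>
    norm_two_mul_mul_le (by positivity) (hf _ (by positivity)) (hg _ (by positivity))

/-- The expression is the derivative of `B²` times a quadratic polynomial. The decay of `B` and `dB`
leaves `O(1/s)`. -/
lemma tendsto_telescope_boundary {B dB : ℝ → ℝ} {C c : ℝ} (hc : 0 < c) (p₀ p₁ p₂ : ℝ)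
    (hf : ∀ s, 0 < s → |B s| ≤ C / s) (hg : ∀ s, 0 < s → |dB s| ≤ C / s ^ 2) :
    Tendsto (fun m : ℕ => 2 * B (c + m) * dB (c + m) * (p₀ + p₁ * (c + m) + p₂ * (c + m) ^ 2)
      + B (c + m) ^ 2 * (p₁ + 2 * p₂ * (c + m))) atTop (𝓝 0) := by
  have hs : Tendsto (fun m : ℕ => c + (m : ℝ)) atTop atTop :=
    tendsto_atTop_add_const_left _ _ tendsto_natCast_atTop_atTop
  have hinv := hs.inv_tendsto_atTop
  have hbound : Tendsto (fun m : ℕ => 2 * C ^ 2 * (|p₀| * (c + m : ℝ)⁻¹ ^ 3 + |p₁| * (c + m : ℝ)⁻¹ ^ 2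
      + |p₂| * (c + m : ℝ)⁻¹) + C ^ 2 * (|p₁| * (c + m : ℝ)⁻¹ ^ 2 + 2 * |p₂| * (c + m : ℝ)⁻¹))
      atTop (𝓝 0) := by
    have h := (((hinv.pow 3).const_mul |p₀|).add ((hinv.pow 2).const_mul |p₁|)).add
      (hinv.const_mul |p₂|)
    have h' := ((hinv.pow 2).const_mul |p₁|).add (hinv.const_mul (2 * |p₂|))
    have := (h.const_mul (2 * C ^ 2)).add (h'.const_mul (C ^ 2))
    simpa using this
  refine squeeze_zero_norm (fun m => ?_) hbound
  set s : ℝ := c + m with hsdef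
  have hs0 : 0 < s := by positivity
  have h1 := norm_two_mul_mul_le hs0 (hf s hs0) (hg s hs0)
  have h2 : ‖B s ^ 2‖ ≤ C ^ 2 / s ^ 2 := by
    rw [norm_pow, Real.norm_eq_abs, ← div_pow]
    exact pow_le_pow_left₀ (abs_nonneg _) (hf s hs0) 2
  have h3 : ‖p₀ + p₁ * s + p₂ * s ^ 2‖ ≤ |p₀| + |p₁| * s + |p₂| * s ^ 2 := by
    refine (norm_add₃_le).trans ?_
    simp only [norm_mul, norm_pow, Real.norm_eq_abs, abs_of_pos hs0]; exact le_rfl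
  have h4 : ‖p₁ + 2 * p₂ * s‖ ≤ |p₁| + 2 * |p₂| * s := by
    refine (norm_add_le _ _).trans ?_
    simp only [norm_mul, Real.norm_eq_abs, abs_of_pos hs0, abs_two]; exact le_rfl
  refine (norm_add_le _ _).trans ?_
  rw [norm_mul _ (p₀ + p₁ * s + p₂ * s ^ 2), norm_mul (B s ^ 2)]
  refine (add_le_add (mul_le_mul h1 h3 (norm_nonneg _) (by positivity))
    (mul_le_mul h2 h4 (norm_nonneg _) (by positivity))).trans (le_of_eq ?_)
  field_simp

/-- Sums of derivatives of squares of rational functions satisfy the recurrence, given a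
telescoping certificate. -/
lemma recurs_of_rational_certificate (V : RationalMukai) {c : ℝ} (hc : 0 < c)
    {A dA B dB : ℕ → ℝ → ℝ} {p₀ p₁ p₂ C E : ℕ → ℝ}
    (hA : ∀ n s, 0 < s → HasDerivAt (A n) (dA n s) s)
    (hB : ∀ n s, 0 < s → HasDerivAt (B n) (dB n s) s)
    (bA : ∀ n s, 0 < s → |A n s| ≤ C n / s) (bdA : ∀ n s, 0 < s → |dA n s| ≤ C n / s ^ 2)
    (bB : ∀ n s, 0 < s → |B n s| ≤ E n / s) (bdB : ∀ n s, 0 < s → |dB n s| ≤ E n / s ^ 2)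
    (hBc : ∀ n, B n c = 0)
    (hcert : ∀ (n : ℕ) (s : ℝ), 0 < s → ((n : ℝ) + 2) ^ 3 * A (n + 2) s ^ 2
      - (V.midCoeff n : ℝ) * A (n + 1) s ^ 2 + (V.lastCoeff : ℝ) * ((n : ℝ) + 1) ^ 3 * A n s ^ 2
      = B n (s + 1) ^ 2 * (p₀ n + p₁ n * (s + 1) + p₂ n * (s + 1) ^ 2)
        - B n s ^ 2 * (p₀ n + p₁ n * s + p₂ n * s ^ 2)) :
    V.Recurs fun n => ∑' m : ℕ, 2 * A n (c + m) * dA n (c + m) := by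
  have hsum : ∀ n, Summable fun m : ℕ => 2 * A n (c + m) * dA n (c + m) := fun n =>
    summable_two_mul_mul hc (bA n) (bdA n)
  intro n
  have hsq : ∀ k s, 0 < s → HasDerivAt (fun s => A k s ^ 2) (2 * A k s * dA k s) s := by
    intro k s hs
    refine HasDerivAt.congr_deriv ((hA k s hs).pow 2) ?_
    simp
  set dS : ℝ → ℝ := fun s => 2 * B n s * dB n s * (p₀ n + p₁ n * s + p₂ n * s ^ 2)
    + B n s ^ 2 * (p₁ n + 2 * p₂ n * s) with hdS
  have hS : ∀ s, 0 < s → HasDerivAt (fun s => B n s ^ 2 * (p₀ n + p₁ n * s + p₂ n * s ^ 2))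
      (dS s) s := by
    intro s hs
    have h1 := (hB n s hs).pow 2
    have h2 : HasDerivAt (fun s : ℝ => p₀ n + p₁ n * s + p₂ n * s ^ 2) (p₁ n + 2 * p₂ n * s) s := by
      have := (((hasDerivAt_id s).const_mul (p₁ n)).const_add (p₀ n)).add
        (((hasDerivAt_id s).pow 2).const_mul (p₂ n))
      refine HasDerivAt.congr_deriv this ?_
      simp; ring
    refine HasDerivAt.congr_deriv (h1.mul h2) ?_
    simp [hdS]
  have hd : ∀ s, 0 < s → ((n : ℝ) + 2) ^ 3 * (2 * A (n + 2) s * dA (n + 2) s)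
      - (V.midCoeff n : ℝ) * (2 * A (n + 1) s * dA (n + 1) s)
      + (V.lastCoeff : ℝ) * ((n : ℝ) + 1) ^ 3 * (2 * A n s * dA n s) = dS (s + 1) - dS s := by
    intro s hs
    have h1 := (((hsq (n + 2) s hs).const_mul (((n : ℝ) + 2) ^ 3)).sub
      ((hsq (n + 1) s hs).const_mul (V.midCoeff n : ℝ))).add
      ((hsq n s hs).const_mul ((V.lastCoeff : ℝ) * ((n : ℝ) + 1) ^ 3))
    have h2 := ((hS (s + 1) (by linarith)).comp_add_const s 1).sub (hS s hs)
    -- The certificate holds on a neighbourhood of `s`, so it may be differentiated.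
    refine h1.unique (h2.congr_of_eventuallyEq ?_)
    filter_upwards [lt_mem_nhds hs] with x hx
    exact hcert n x hx
  have htel := tsum_eq_neg_of_telescope
    (f := fun m : ℕ => ((n : ℝ) + 2) ^ 3 * (2 * A (n + 2) (c + m) * dA (n + 2) (c + m))
      - (V.midCoeff n : ℝ) * (2 * A (n + 1) (c + m) * dA (n + 1) (c + m))
      + (V.lastCoeff : ℝ) * ((n : ℝ) + 1) ^ 3 * (2 * A n (c + m) * dA n (c + m)))
    (g := fun m : ℕ => dS (c + m))
    ((((hsum (n + 2)).mul_left _).sub ((hsum (n + 1)).mul_left _)).add ((hsum n).mul_left _))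
    (fun m => by rw [hd _ (by positivity)]; push_cast; rw [add_assoc])
    (tendsto_telescope_boundary hc _ _ _ (bB n) (bdB n))
  -- Since `B n` vanishes at `c`, its square has a double zero there and the telescoping sum has no
  -- boundary term at the start.
  have h0 : dS (c + (0 : ℕ)) = 0 := by simp [hdS, hBc]
  rw [h0, neg_zero, Summable.tsum_add (((hsum (n + 2)).mul_left _).sub ((hsum (n + 1)).mul_left _))
    ((hsum n).mul_left _), Summable.tsum_sub ((hsum (n + 2)).mul_left _)
    ((hsum (n + 1)).mul_left _), tsum_mul_left, tsum_mul_left, tsum_mul_left] at htel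
  exact htel

/-- Growth of the sums of derivatives of squares. -/
lemma tendsto_tsum_div_pow {c θ ρ : ℝ} (hc : 0 < c) (hθ : 0 < θ) (hρ : θ ^ 2 < ρ) {A dA : ℕ → ℝ → ℝ}
    (bA : ∀ n s, 0 < s → |A n s| ≤ θ ^ n * (n + 1) / s)
    (bdA : ∀ n s, 0 < s → |dA n s| ≤ θ ^ n * (n + 1) / s ^ 2) :
    Tendsto (fun n : ℕ => (∑' m : ℕ, 2 * A n (c + m) * dA n (c + m)) / ρ ^ n) atTop (𝓝 0) := by
  have hρ0 : 0 < ρ := (pow_pos hθ 2).trans hρ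
  set Z := ∑' m : ℕ, 1 / (c + m : ℝ) ^ 3
  have hle : ∀ n : ℕ, ‖∑' m : ℕ, 2 * A n (c + m) * dA n (c + m)‖ ≤ 2 * (θ ^ n * (n + 1)) ^ 2 * Z := by
    intro n
    refine (tsum_of_norm_bounded (((summable_one_div_shift_cube hc).mul_left
      (2 * (θ ^ n * (n + 1)) ^ 2)).hasSum) fun m => norm_two_mul_mul_le (by positivity)
      (bA n _ (by positivity)) (bdA n _ (by positivity))).trans (le_of_eq ?_)
    rw [tsum_mul_left]
  have hlim : Tendsto (fun n : ℕ => 2 * Z * (((n + 1 : ℕ) : ℝ) ^ 2 * (θ ^ 2 / ρ) ^ (n + 1)) * (ρ / θ ^ 2))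
      atTop (𝓝 0) := by
    have := (tendsto_pow_const_mul_const_pow_of_lt_one 2 (r := θ ^ 2 / ρ) (by positivity)
      ((div_lt_one hρ0).2 hρ)).comp (tendsto_add_atTop_nat 1)
    simpa using (this.const_mul (2 * Z)).mul_const (ρ / θ ^ 2)
  refine squeeze_zero_norm (fun n => ?_) hlim
  rw [norm_div, norm_pow, Real.norm_of_nonneg hρ0.le]
  refine (div_le_div_of_nonneg_right (hle n) (by positivity)).trans (le_of_eq ?_)
  push_cast
  rw [div_pow, pow_succ ρ, pow_succ (θ ^ 2), ← pow_mul, mul_pow, ← pow_mul, mul_comm n 2]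
  field_simp

/-- `∑ 1 / n ^ 3` as a real number. -/
noncomputable def zetaThree : ℝ := ∑' m : ℕ, 1 / (1 + (m : ℝ)) ^ 3

lemma summable_one_div_cube : Summable fun m : ℕ => 1 / (m : ℝ) ^ 3 :=
  Real.summable_one_div_nat_pow.2 (by norm_num)

lemma tsum_one_div_cube : ∑' m : ℕ, 1 / (m : ℝ) ^ 3 = zetaThree := by
  rw [summable_one_div_cube.tsum_eq_zero_add, zetaThree]
  simp [add_comm]

lemma ofReal_zetaThree : (zetaThree : ℂ) = riemannZeta 3 := by
  have := zeta_nat_eq_tsum_of_gt_one (k := 3) (by norm_num)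
  rw [← tsum_one_div_cube]
  push_cast at this ⊢
  exact this.symm

/-- The sum is eight times that of the odd reciprocal cubes, and removing the even ones from `ζ(3)`
leaves `7/8` of it. -/
lemma tsum_one_div_half_cube : ∑' m : ℕ, 1 / (1 / 2 + (m : ℝ)) ^ 3 = 7 * zetaThree := by
  have h1 : ∀ m : ℕ, 1 / (1 / 2 + (m : ℝ)) ^ 3 = 8 * (1 / ((2 * m + 1 : ℕ) : ℝ) ^ 3) := by
    intro m
    push_cast
    have : (2 * (m : ℝ) + 1) ≠ 0 := by positivity
    have h2 : (1 / 2 + (m : ℝ)) ≠ 0 := by positivity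
    field_simp
    ring
  have h2 : ∀ m : ℕ, 1 / ((2 * m : ℕ) : ℝ) ^ 3 = 1 / 8 * (1 / (m : ℝ) ^ 3) := by
    intro m; push_cast; rw [mul_pow]; field_simp; norm_num
  have s1 : Summable fun m : ℕ => 1 / ((2 * m : ℕ) : ℝ) ^ 3 :=
    summable_one_div_cube.comp_injective (i := fun m : ℕ => 2 * m) fun a b h => by simpa using h
  have s2 : Summable fun m : ℕ => 1 / ((2 * m + 1 : ℕ) : ℝ) ^ 3 :=
    summable_one_div_cube.comp_injective (i := fun m : ℕ => 2 * m + 1) fun a b h => by simpa using h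
  have h3 := tsum_even_add_odd (f := fun m : ℕ => 1 / (m : ℝ) ^ 3) s1 s2
  rw [tsum_one_div_cube, tsum_congr h2, tsum_mul_left, tsum_one_div_cube] at h3
  rw [tsum_congr h1, tsum_mul_left]
  linarith

lemma abs_mul_le_of_abs_le {x y a b : ℝ} (hx : |x| ≤ a) (hy : |y| ≤ b) : |x * y| ≤ a * b := by
  rw [abs_mul]
  exact mul_le_mul hx hy (abs_nonneg _) ((abs_nonneg _).trans hx)

/-- `∏ (t - j) / ∏ (t + j)`, products over `1 ≤ j ≤ n` and `0 ≤ j ≤ n`. -/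
noncomputable def aperyRational : ℕ → ℝ → ℝ
  | 0, t => 1 / t
  | n + 1, t => aperyRational n t * ((t - (n + 1)) / (t + (n + 1)))

/-- The derivative of `aperyRational`. -/
noncomputable def aperyRationalDeriv : ℕ → ℝ → ℝ
  | 0, t => -1 / t ^ 2
  | n + 1, t => aperyRationalDeriv n t * ((t - (n + 1)) / (t + (n + 1)))
      + aperyRational n t * (2 * (n + 1) / (t + (n + 1)) ^ 2)

lemma hasDerivAt_one_div {t : ℝ} (ht : t ≠ 0) : HasDerivAt (fun t : ℝ => 1 / t) (-1 / t ^ 2) t := by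
  simpa [neg_div] using hasDerivAt_inv ht

lemma hasDerivAt_aperyRational (n : ℕ) (t : ℝ) (ht : 0 < t) :
    HasDerivAt (aperyRational n) (aperyRationalDeriv n t) t := by
  induction n with
  | zero => exact hasDerivAt_one_div ht.ne'
  | succ n ih =>
    have hn : t + ((n : ℝ) + 1) ≠ 0 := by positivity
    have h := ((hasDerivAt_id t).sub_const ((n : ℝ) + 1)).div
      ((hasDerivAt_id t).add_const ((n : ℝ) + 1)) hn
    refine HasDerivAt.congr_deriv (ih.mul h) ?_
    rw [aperyRationalDeriv]
    simp only [id, one_mul, mul_one]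
    congr 3
    ring

lemma abs_aperyRational_le (n : ℕ) (t : ℝ) (ht : 0 < t) : |aperyRational n t| ≤ 1 / t := by
  induction n with
  | zero => rw [aperyRational, abs_of_pos (by positivity)]
  | succ n ih =>
    have hn : 0 < t + ((n : ℝ) + 1) := by positivity
    have h : |(t - ((n : ℝ) + 1)) / (t + (n + 1))| ≤ 1 := by
      rw [abs_div, abs_of_pos hn, div_le_one hn, abs_le]
      constructor <;> linarith [n.cast_nonneg (α := ℝ)]
    simpa [aperyRational] using abs_mul_le_of_abs_le ih h

lemma abs_aperyRationalDeriv_le (n : ℕ) (t : ℝ) (ht : 0 < t) :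
    |aperyRationalDeriv n t| ≤ (n + 1) / t ^ 2 := by
  induction n with
  | zero => rw [aperyRationalDeriv, abs_div, abs_of_pos (by positivity : 0 < t ^ 2)]; simp
  | succ n ih =>
    have hn : 0 < t + ((n : ℝ) + 1) := by positivity
    have h : |(t - ((n : ℝ) + 1)) / (t + (n + 1))| ≤ 1 := by
      rw [abs_div, abs_of_pos hn, div_le_one hn, abs_le]
      constructor <;> linarith [n.cast_nonneg (α := ℝ)]
    have h2 : |2 * ((n : ℝ) + 1) / (t + (n + 1)) ^ 2| ≤ 1 / t := by
      rw [abs_of_pos (by positivity), div_le_div_iff₀ (by positivity) ht]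
      nlinarith [sq_nonneg (t - ((n : ℝ) + 1)), n.cast_nonneg (α := ℝ)]
    rw [aperyRationalDeriv]
    refine (abs_add_le _ _).trans ((add_le_add (abs_mul_le_of_abs_le ih h)
      (abs_mul_le_of_abs_le (abs_aperyRational_le n t ht) h2)).trans (le_of_eq ?_))
    push_cast
    field_simp

lemma aperyRational_succ_add_one (n : ℕ) (t : ℝ) (ht : 0 < t) : aperyRational (n + 1) (t + 1) =
    aperyRational n t * (t ^ 2 / ((t + n + 1) * (t + n + 2))) := by
  induction n with
  | zero =>
    simp only [aperyRational, Nat.cast_zero]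
    field_simp
    ring
  | succ n ih =>
    rw [aperyRational, ih, aperyRational]
    push_cast
    field_simp
    ring

/-- All shifts in `n` and `t` are rational multiples of `aperyRational n t`. Up to sign, the
quadratic polynomial is the one in the certificate for `aperyTerm` with `k - 1` replaced by `-t`. -/
lemma aperyRational_certificate (n : ℕ) (t : ℝ) (ht : 0 < t) :
    ((n : ℝ) + 2) ^ 3 * aperyRational (n + 2) t ^ 2
      - (V12.midCoeff n : ℝ) * aperyRational (n + 1) t ^ 2
      + (V12.lastCoeff : ℝ) * ((n : ℝ) + 1) ^ 3 * aperyRational n t ^ 2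
      = aperyRational (n + 1) (t + 1) ^ 2 *
          (4 * (2 * n + 3) ^ 3 + 4 * (2 * n + 3) * (t + 1) + -(8 * (2 * n + 3)) * (t + 1) ^ 2)
        - aperyRational (n + 1) t ^ 2 *
          (4 * (2 * n + 3) ^ 3 + 4 * (2 * n + 3) * t + -(8 * (2 * n + 3)) * t ^ 2) := by
  rw [aperyRational_succ_add_one n t ht, aperyRational, aperyRational]
  simp only [midCoeff, lastCoeff]
  push_cast
  have h1 : t + n + 1 ≠ 0 := by positivity
  have h2 : t + n + 2 ≠ 0 := by positivity
  rw [show t + ((n : ℝ) + 1) = t + n + 1 by ring, show t + ((n : ℝ) + 1 + 1) = t + n + 2 by ring]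
  field_simp
  ring

/-- The first two sums are `-2ζ(3)` and `12 - 10ζ(3)`, which forces `κ = -12`. The second comes from
partial fractions: the summand is `-10/t³` plus the difference of `g`. The sums grow only
polynomially, against `5^n`. -/
lemma exists_remainder_V12 : ∃ (r : ℕ → ℝ) (κ : ℝ), κ ≠ 0 ∧ V12.Recurs r ∧
    r 0 = κ * (zetaThree / 6) ∧ r 1 = κ * (zetaThree / 6 * V12.secondTerm - 1) ∧
    Tendsto (fun n => r n / V12.growth ^ n) atTop (𝓝 0) := by
  have bA : ∀ (n : ℕ) (s : ℝ), 0 < s → |aperyRational n s| ≤ (n + 1) / s := fun n s hs =>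
    (abs_aperyRational_le n s hs).trans (by gcongr; simp)
  have hs1 := summable_one_div_shift_cube one_pos
  refine ⟨fun n => ∑' m : ℕ, 2 * aperyRational n (1 + m) * aperyRationalDeriv n (1 + m), -12,
    by norm_num, ?_, ?_, ?_, ?_⟩
  · refine recurs_of_rational_certificate V12 one_pos hasDerivAt_aperyRational
      (fun n => hasDerivAt_aperyRational (n + 1)) bA abs_aperyRationalDeriv_le
      (fun n => bA (n + 1)) (fun n => abs_aperyRationalDeriv_le (n + 1)) (fun n => ?_)
      aperyRational_certificate
    induction n with
    | zero => simp [aperyRational]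
    | succ n ih => rw [aperyRational, ih, zero_mul]
  · have : ∀ m : ℕ, 2 * aperyRational 0 (1 + m) * aperyRationalDeriv 0 (1 + m) =
        -2 * (1 / (1 + (m : ℝ)) ^ 3) := fun m => by
      simp only [aperyRational, aperyRationalDeriv]; field_simp
    simp only
    rw [tsum_congr this, tsum_mul_left, zetaThree]; ring
  · set g : ℕ → ℝ := fun m => -8 * (1 / (1 + (m : ℝ))) ^ 3 - 4 * (1 / (1 + (m : ℝ))) ^ 2 with hg
    have : ∀ m : ℕ, 2 * aperyRational 1 (1 + m) * aperyRationalDeriv 1 (1 + m) +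
        10 * (1 / (1 + (m : ℝ)) ^ 3) = g (m + 1) - g m := fun m => by
      simp only [aperyRational, aperyRationalDeriv, hg]; push_cast; field_simp; ring
    have hg0 : Tendsto g atTop (𝓝 0) := by
      have h := tendsto_one_div_add_atTop_nhds_zero_nat (𝕜 := ℝ)
      have h2 := ((h.pow 3).const_mul (-8)).sub ((h.pow 2).const_mul 4)
      norm_num at h2
      refine h2.congr fun m => ?_
      simp only [hg, one_div, inv_pow, add_comm (1 : ℝ)]; ring
    have hsum := summable_two_mul_mul one_pos (bA 1) (abs_aperyRationalDeriv_le 1)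
    have h := tsum_eq_neg_of_telescope (hsum.add (hs1.mul_left 10)) this hg0
    rw [Summable.tsum_add hsum (hs1.mul_left 10), tsum_mul_left] at h
    simp only [secondTerm]
    rw [← zetaThree] at h
    norm_num [hg] at h ⊢
    linarith
  · exact tendsto_tsum_div_pow (θ := 1) one_pos one_pos (by norm_num [growth]) (by simpa using bA)
      (by simpa using abs_aperyRationalDeriv_le)

/-- `∏ (2 s + j) / ∏ (s + j)`, products over `j < n` and `j ≤ n`. -/
noncomputable def doubleRational : ℕ → ℝ → ℝ
  | 0, s => 1 / s
  | n + 1, s => doubleRational n s * ((2 * s + n) / (s + (n + 1)))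

/-- The derivative of `doubleRational`. -/
noncomputable def doubleRationalDeriv : ℕ → ℝ → ℝ
  | 0, s => -1 / s ^ 2
  | n + 1, s => doubleRationalDeriv n s * ((2 * s + n) / (s + (n + 1)))
      + doubleRational n s * ((n + 2) / (s + (n + 1)) ^ 2)

lemma hasDerivAt_doubleRational (n : ℕ) (s : ℝ) (hs : 0 < s) :
    HasDerivAt (doubleRational n) (doubleRationalDeriv n s) s := by
  induction n with
  | zero => exact hasDerivAt_one_div hs.ne'
  | succ n ih =>
    have hn : s + ((n : ℝ) + 1) ≠ 0 := by positivity
    have h := (((hasDerivAt_id s).const_mul 2).add_const (n : ℝ)).div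
      ((hasDerivAt_id s).add_const ((n : ℝ) + 1)) hn
    refine HasDerivAt.congr_deriv (ih.mul h) ?_
    rw [doubleRationalDeriv]
    simp only [id, mul_one]
    congr 3
    ring

lemma abs_doubleRational_le (n : ℕ) (s : ℝ) (hs : 0 < s) : |doubleRational n s| ≤ 2 ^ n / s := by
  induction n with
  | zero => rw [doubleRational, abs_of_pos (by positivity)]; simp
  | succ n ih =>
    have hn : 0 < s + ((n : ℝ) + 1) := by positivity
    have h : |(2 * s + n) / (s + ((n : ℝ) + 1))| ≤ 2 := by
      rw [abs_of_nonneg (by positivity), div_le_iff₀ hn]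
      linarith [n.cast_nonneg (α := ℝ)]
    refine (abs_mul_le_of_abs_le ih h).trans (le_of_eq ?_)
    rw [pow_succ]; ring

lemma abs_doubleRationalDeriv_le (n : ℕ) (s : ℝ) (hs : 0 < s) :
    |doubleRationalDeriv n s| ≤ 2 ^ n * (n + 1) / s ^ 2 := by
  induction n with
  | zero => rw [doubleRationalDeriv, abs_div, abs_of_pos (by positivity : 0 < s ^ 2)]; simp
  | succ n ih =>
    have hn : 0 < s + ((n : ℝ) + 1) := by positivity
    have h : |(2 * s + n) / (s + ((n : ℝ) + 1))| ≤ 2 := by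
      rw [abs_of_nonneg (by positivity), div_le_iff₀ hn]
      linarith [n.cast_nonneg (α := ℝ)]
    have h2 : |((n : ℝ) + 2) / (s + (n + 1)) ^ 2| ≤ 2 / s := by
      rw [abs_of_pos (by positivity), div_le_div_iff₀ (by positivity) hs]
      nlinarith [n.cast_nonneg (α := ℝ), mul_nonneg hs.le (n.cast_nonneg (α := ℝ))]
    rw [doubleRationalDeriv]
    refine (abs_add_le _ _).trans ((add_le_add (abs_mul_le_of_abs_le ih h)
      (abs_mul_le_of_abs_le (abs_doubleRational_le n s hs) h2)).trans (le_of_eq ?_))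
    push_cast
    field_simp
    ring

lemma doubleRational_add_one (n : ℕ) (s : ℝ) (hs : 0 < s) : doubleRational n (s + 1) =
    doubleRational n s * ((2 * s + n) * (2 * s + n + 1) / (2 * (2 * s + 1) * (s + n + 1))) := by
  induction n with
  | zero =>
    simp only [doubleRational, Nat.cast_zero]
    field_simp
    ring
  | succ n ih =>
    rw [doubleRational, ih, doubleRational]
    push_cast
    field_simp
    ring

/-- The rational function in the certificate for `doubleRational`. -/
noncomputable def doubleCertificate (n : ℕ) (s : ℝ) : ℝ :=
  doubleRational n s * ((2 * s - 1) / (s + (n + 1)))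

/-- The factor `2s - 1` in `doubleCertificate` has two uses: after the shift `s ↦ s + 1` it cancels
the denominator in `doubleRational_add_one`, and it vanishes at the starting point `s = 1/2`. -/
lemma doubleRational_certificate (n : ℕ) (s : ℝ) (hs : 0 < s) :
    ((n : ℝ) + 2) ^ 3 * doubleRational (n + 2) s ^ 2
      - (V16.midCoeff n : ℝ) * doubleRational (n + 1) s ^ 2
      + (V16.lastCoeff : ℝ) * ((n : ℝ) + 1) ^ 3 * doubleRational n s ^ 2
      = doubleCertificate n (s + 1) ^ 2 *
          (-(28 * (n + 2) ^ 3 - 80 * (n + 2) ^ 2 + 64 * (n + 2) - 16)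
            + -(16 * (2 * n + 3) * (2 * n + 2)) * (s + 1) + -(16 * (2 * n + 3)) * (s + 1) ^ 2)
        - doubleCertificate n s ^ 2 *
          (-(28 * (n + 2) ^ 3 - 80 * (n + 2) ^ 2 + 64 * (n + 2) - 16)
            + -(16 * (2 * n + 3) * (2 * n + 2)) * s + -(16 * (2 * n + 3)) * s ^ 2) := by
  rw [doubleCertificate, doubleCertificate, doubleRational_add_one n s hs, doubleRational,
    doubleRational]
  simp only [midCoeff, lastCoeff]
  push_cast
  have h1 : s + n + 1 ≠ 0 := by positivity
  have h2 : s + n + 2 ≠ 0 := by positivity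
  have h3 : 2 * s + 1 ≠ 0 := by positivity
  rw [show s + ((n : ℝ) + 1) = s + n + 1 by ring, show s + ((n : ℝ) + 1 + 1) = s + n + 2 by ring,
    show s + 1 + ((n : ℝ) + 1) = s + n + 2 by ring, show 2 * (s + 1) - 1 = 2 * s + 1 by ring]
  field_simp
  ring

lemma hasDerivAt_doubleCertificate (n : ℕ) (s : ℝ) (hs : 0 < s) :
    HasDerivAt (doubleCertificate n) (doubleRationalDeriv n s * ((2 * s - 1) / (s + (n + 1))) +
      doubleRational n s * ((2 * n + 3) / (s + (n + 1)) ^ 2)) s := by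
  have hn : s + ((n : ℝ) + 1) ≠ 0 := by positivity
  have h := (((hasDerivAt_id s).const_mul 2).sub_const (1 : ℝ)).div
    ((hasDerivAt_id s).add_const ((n : ℝ) + 1)) hn
  refine HasDerivAt.congr_deriv ((hasDerivAt_doubleRational n s hs).mul h) ?_
  simp only [id, mul_one]
  congr 3
  ring

lemma abs_doubleCertificate_factor_le (n : ℕ) (s : ℝ) (hs : 0 < s) :
    |(2 * s - 1) / (s + ((n : ℝ) + 1))| ≤ 2 := by
  have hn : 0 < s + ((n : ℝ) + 1) := by positivity
  rw [abs_div, abs_of_pos hn, div_le_iff₀ hn, abs_le]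
  constructor <;> linarith [n.cast_nonneg (α := ℝ)]

/-- Summation over half-integers produces `7ζ(3)` in place of `ζ(3)`. The first two sums are
`-14ζ(3)` and `64 - 56ζ(3)`, hence `κ = -64`. The sums are `O(n² 4^n)`, against `8^n`. -/
lemma exists_remainder_V16 : ∃ (r : ℕ → ℝ) (κ : ℝ), κ ≠ 0 ∧ V16.Recurs r ∧
    r 0 = κ * (7 * zetaThree / 32) ∧ r 1 = κ * (7 * zetaThree / 32 * V16.secondTerm - 1) ∧
    Tendsto (fun n => r n / V16.growth ^ n) atTop (𝓝 0) := by
  have hc : (0 : ℝ) < 1 / 2 := by norm_num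
  have bA : ∀ (n : ℕ) (s : ℝ), 0 < s → |doubleRational n s| ≤ 2 ^ n * (n + 1) / s := fun n s hs =>
    (abs_doubleRational_le n s hs).trans (by
      gcongr
      exact le_mul_of_one_le_right (by positivity) (by simp))
  have hs1 := summable_one_div_shift_cube hc
  refine ⟨fun n => ∑' m : ℕ, 2 * doubleRational n (1 / 2 + m) * doubleRationalDeriv n (1 / 2 + m),
    -64, by norm_num, ?_, ?_, ?_, ?_⟩
  · refine recurs_of_rational_certificate V16 hc hasDerivAt_doubleRational
      hasDerivAt_doubleCertificate bA abs_doubleRationalDeriv_le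
      (E := fun n => 2 ^ n * (n + 1) * 4)
      (fun n s hs => ?_) (fun n s hs => ?_) (fun n => ?_)
      doubleRational_certificate
    · refine (abs_mul_le_of_abs_le (bA n s hs) (abs_doubleCertificate_factor_le n s hs)).trans ?_
      rw [div_mul_eq_mul_div]
      gcongr
      norm_num
    · have h2 : |(2 * (n : ℝ) + 3) / (s + (n + 1)) ^ 2| ≤ 2 / s := by
        rw [abs_of_pos (by positivity), div_le_div_iff₀ (by positivity) hs]
        nlinarith [n.cast_nonneg (α := ℝ), mul_nonneg hs.le (n.cast_nonneg (α := ℝ))]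
      refine (abs_add_le _ _).trans ((add_le_add (abs_mul_le_of_abs_le
        (abs_doubleRationalDeriv_le n s hs) (abs_doubleCertificate_factor_le n s hs))
        (abs_mul_le_of_abs_le (bA n s hs) h2)).trans (le_of_eq ?_))
      field_simp
      ring
    · simp [doubleCertificate]
  · have : ∀ m : ℕ, 2 * doubleRational 0 (1 / 2 + m) * doubleRationalDeriv 0 (1 / 2 + m) =
        -2 * (1 / (1 / 2 + (m : ℝ)) ^ 3) := fun m => by
      have h : (1 / 2 + (m : ℝ)) ≠ 0 := by positivity
      simp only [doubleRational, doubleRationalDeriv]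
      generalize (1 / 2 + (m : ℝ)) = x at *
      field_simp
    simp only
    rw [tsum_congr this, tsum_mul_left, tsum_one_div_half_cube]; ring
  · set g : ℕ → ℝ := fun m => -8 * (1 / (1 / 2 + (m : ℝ))) ^ 3 with hg
    have : ∀ m : ℕ, 2 * doubleRational 1 (1 / 2 + m) * doubleRationalDeriv 1 (1 / 2 + m) +
        8 * (1 / (1 / 2 + (m : ℝ)) ^ 3) = g (m + 1) - g m := fun m => by
      have h : (1 / 2 + (m : ℝ)) ≠ 0 := by positivity
      have h1 : (1 / 2 + (m : ℝ) + 1) ≠ 0 := by positivity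
      simp only [doubleRational, doubleRationalDeriv, hg]
      push_cast
      simp only [add_zero, zero_add]
      rw [show (1 / 2 + ((m : ℝ) + 1)) = 1 / 2 + m + 1 by ring]
      generalize (1 / 2 + (m : ℝ)) = x at *
      field_simp
      ring
    have hg0 : Tendsto g atTop (𝓝 0) := by
      have h : Tendsto (fun m : ℕ => (1 / 2 + (m : ℝ))) atTop atTop :=
        tendsto_atTop_add_const_left _ _ tendsto_natCast_atTop_atTop
      have h2 := ((h.inv_tendsto_atTop.pow 3).const_mul (-8))
      norm_num at h2
      refine h2.congr fun m => ?_
      simp only [hg, one_div]; norm_num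
    have hsum := summable_two_mul_mul hc (bA 1) (abs_doubleRationalDeriv_le 1)
    have h := tsum_eq_neg_of_telescope (hsum.add (hs1.mul_left 8)) this hg0
    rw [Summable.tsum_add hsum (hs1.mul_left 8), tsum_mul_left, tsum_one_div_half_cube] at h
    simp only [secondTerm]
    norm_num [hg] at h ⊢
    linarith
  · exact tendsto_tsum_div_pow (θ := 2) hc two_pos (by norm_num [growth]) bA
      abs_doubleRationalDeriv_le

end RationalMukai

/-! ### The weight 4 forms of level 6, 8 and 9, built from `E₄` -/

open UpperHalfPlane ModularForm

/-- The image of a point of the upper half plane under `z ↦ x z + y`. -/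
noncomputable def affinePoint (x y : ℝ) (hx : 0 < x) (τ : ℍ) : ℍ :=
  ⟨x * τ + y, by simpa using mul_pos hx τ.im_pos⟩

@[simp] lemma coe_affinePoint (x y : ℝ) (hx : 0 < x) (τ : ℍ) :
    (affinePoint x y hx τ : ℂ) = x * τ + y := rfl

/-- The matrix of `z ↦ x z + y`. -/
noncomputable def affineMatrix (x y : ℝ) (hx : 0 < x) : GL (Fin 2) ℝ :=
  Matrix.GeneralLinearGroup.mkOfDetNeZero !![x, y; 0, 1] (by simpa using hx.ne')

lemma coe_affineMatrix (x y : ℝ) (hx : 0 < x) :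
    (affineMatrix x y hx : Matrix (Fin 2) (Fin 2) ℝ) = !![x, y; 0, 1] := rfl

lemma det_affineMatrix (x y : ℝ) (hx : 0 < x) : (affineMatrix x y hx).det.val = x := by
  rw [Matrix.GeneralLinearGroup.val_det_apply, coe_affineMatrix, Matrix.det_fin_two_of]; simp

lemma slash_affineMatrix (x y : ℝ) (hx : 0 < x) (f : ℍ → ℂ) (τ : ℍ) :
    (f ∣[(4 : ℤ)] affineMatrix x y hx) τ = (x : ℂ) ^ 3 * f (affinePoint x y hx τ) := by
  have hd : 0 < (affineMatrix x y hx).det.val := by rwa [det_affineMatrix]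
  have h1 : affineMatrix x y hx • τ = affinePoint x y hx τ := by
    apply UpperHalfPlane.ext
    rw [coe_smul_of_det_pos hd]
    simp [num, denom, coe_affineMatrix]
  have h2 : denom (affineMatrix x y hx) τ = 1 := by simp [denom, coe_affineMatrix]
  rw [slash_apply, h1, h2, det_affineMatrix, UpperHalfPlane.σ, if_pos hd, abs_of_pos hx]
  simp [mul_comm]

/-- Restriction of a modular form to a smaller group. -/
def ModularForm.restrictSubgroup {Γ Γ' : Subgroup (GL (Fin 2) ℝ)} (h : Γ ≤ Γ') {k : ℤ}
    (f : ModularForm Γ' k) : ModularForm Γ k where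
  toFun := f
  slash_action_eq' γ hγ := f.slash_action_eq' γ (h hγ)
  holo' := f.holo'
  bdd_at_cusps' hc := f.bdd_at_cusps' (hc.mono h)

open ConjAct Pointwise in
lemma le_conj_of_exists {Γ : Subgroup SL(2, ℤ)} (g : GL (Fin 2) ℝ)
    (h : ∀ γ ∈ Γ, ∃ δ : SL(2, ℤ), g * (γ : GL (Fin 2) ℝ) = (δ : GL (Fin 2) ℝ) * g) :
    (Γ : Subgroup (GL (Fin 2) ℝ)) ≤ toConjAct g⁻¹ • 𝒮ℒ := by
  rintro _ ⟨γ, hγ, rfl⟩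
  obtain ⟨δ, hδ⟩ := h γ hγ
  rw [Subgroup.mem_pointwise_smul_iff_inv_smul_mem, ← map_inv, inv_inv, toConjAct_smul]
  refine ⟨δ, ?_⟩
  exact eq_mul_inv_of_mul_eq hδ.symm

lemma matrix_fin_two_congr {a b c d a' b' c' d' : ℝ} (ha : a = a') (hb : b = b') (hc : c = c')
    (hd : d = d') : !![a, b; c, d] = !![a', b'; c', d'] := by
  rw [ha, hb, hc, hd]

lemma exists_SL2Z_entries (a b c d : ℤ) (h : a * d - b * c = 1) : ∃ δ : SL(2, ℤ),
    ((δ : GL (Fin 2) ℝ) : Matrix (Fin 2) (Fin 2) ℝ) = !![(a : ℝ), b; c, d] := by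
  refine ⟨⟨!![a, b; c, d], by rw [Matrix.det_fin_two_of, h]⟩, ?_⟩
  ext i j
  fin_cases i <;> fin_cases j <;> rfl

lemma coe_SL2Z_matrix (γ : SL(2, ℤ)) : ((γ : GL (Fin 2) ℝ) : Matrix (Fin 2) (Fin 2) ℝ) =
    !![(γ 0 0 : ℝ), (γ 0 1 : ℝ); (γ 1 0 : ℝ), (γ 1 1 : ℝ)] := by
  ext i j
  fin_cases i <;> fin_cases j <;> simp

lemma SL2Z_det_entries (γ : SL(2, ℤ)) : γ 0 0 * γ 1 1 - γ 0 1 * γ 1 0 = 1 := by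
  have := γ.det_coe
  rwa [Matrix.det_fin_two] at this

open ConjAct Pointwise in
lemma Gamma0_le_conj_dilation {N i : ℕ} (hi : 0 < (i : ℝ)) (hN : i ∣ N) :
    ((CongruenceSubgroup.Gamma0 N : Subgroup SL(2, ℤ)) : Subgroup (GL (Fin 2) ℝ)) ≤
      toConjAct (affineMatrix i 0 hi)⁻¹ • 𝒮ℒ := by
  refine le_conj_of_exists _ fun γ hγ => ?_
  have hc : (i : ℤ) ∣ γ 1 0 := by
    rw [CongruenceSubgroup.Gamma0_mem, ZMod.intCast_zmod_eq_zero_iff_dvd] at hγ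
    exact (Int.natCast_dvd_natCast.2 hN).trans hγ
  obtain ⟨c, hc⟩ := hc
  obtain ⟨δ, hδ⟩ := exists_SL2Z_entries (γ 0 0) (i * γ 0 1) c (γ 1 1) (by
    linear_combination SL2Z_det_entries γ + γ 0 1 * hc)
  refine ⟨δ, Units.ext ?_⟩
  rw [Units.val_mul, Units.val_mul, hδ, coe_SL2Z_matrix, coe_affineMatrix, Matrix.mul_fin_two,
    Matrix.mul_fin_two, hc]
  push_cast
  apply matrix_fin_two_congr <;> ring

open ConjAct Pointwise in
-- Conjugating by the translation by `j/3` produces the fractions `j(d-a)/3` and `j²c/9`. Both are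
-- integers, since `9 ∣ c`, and then `ad ≡ 1` modulo 3 forces `a ≡ d`.
lemma Gamma0_nine_le_conj_translation (j : ℤ) :
    ((CongruenceSubgroup.Gamma0 9 : Subgroup SL(2, ℤ)) : Subgroup (GL (Fin 2) ℝ)) ≤
      toConjAct (affineMatrix 1 (j / 3) one_pos)⁻¹ • 𝒮ℒ := by
  refine le_conj_of_exists _ fun γ hγ => ?_
  have hc : (9 : ℤ) ∣ γ 1 0 := by
    rw [CongruenceSubgroup.Gamma0_mem, ZMod.intCast_zmod_eq_zero_iff_dvd] at hγ
    exact hγ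
  obtain ⟨c, hc⟩ := hc
  have hdet := SL2Z_det_entries γ
  have he : (3 : ℤ) ∣ γ 1 1 - γ 0 0 := by
    have h3 : (γ 0 0 * γ 1 1) % 3 = 1 := by
      have : γ 0 0 * γ 1 1 = 1 + 3 * (3 * γ 0 1 * c) := by
        linear_combination hdet + γ 0 1 * hc
      omega
    rw [Int.mul_emod] at h3
    have h1 := Int.emod_two_eq_zero_or_one (γ 0 0)
    have : γ 0 0 % 3 = 0 ∨ γ 0 0 % 3 = 1 ∨ γ 0 0 % 3 = 2 := by omega
    have : γ 1 1 % 3 = 0 ∨ γ 1 1 % 3 = 1 ∨ γ 1 1 % 3 = 2 := by omega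
    rcases ‹γ 0 0 % 3 = 0 ∨ _› with h | h | h <;> rcases this with h' | h' | h' <;>
      rw [h, h'] at h3 <;> omega
  obtain ⟨e, he⟩ := he
  obtain ⟨δ, hδ⟩ := exists_SL2Z_entries (γ 0 0 + 3 * j * c) (γ 0 1 + j * e - j ^ 2 * c) (9 * c)
    (γ 1 1 - 3 * c * j) (by
      linear_combination hdet + γ 0 1 * hc + 3 * j * c * he)
  have he' : (γ 1 1 : ℝ) - γ 0 0 = 3 * e := by exact_mod_cast he
  refine ⟨δ, Units.ext ?_⟩
  rw [Units.val_mul, Units.val_mul, hδ, coe_SL2Z_matrix, coe_affineMatrix, Matrix.mul_fin_two,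
    Matrix.mul_fin_two, hc]
  push_cast
  apply matrix_fin_two_congr
  · ring
  · linear_combination (j : ℝ) / 3 * he'
  · ring
  · ring

open ConjAct Pointwise in
/-- `E₄` composed with an affine map, as a modular form of higher level. -/
noncomputable def affineE4 {N : ℕ} (x y : ℝ) (hx : 0 < x)
    (h : ((CongruenceSubgroup.Gamma0 N : Subgroup SL(2, ℤ)) : Subgroup (GL (Fin 2) ℝ)) ≤
      toConjAct (affineMatrix x y hx)⁻¹ • 𝒮ℒ) :
    ModularForm ((CongruenceSubgroup.Gamma0 N : Subgroup SL(2, ℤ)) :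
      Subgroup (GL (Fin 2) ℝ)) 4 :=
  ((x : ℂ) ^ 3)⁻¹ • (ModularForm.translate E₄ (affineMatrix x y hx)).restrictSubgroup h

open ConjAct Pointwise in
lemma affineE4_apply {N : ℕ} (x y : ℝ) (hx : 0 < x)
    (h : ((CongruenceSubgroup.Gamma0 N : Subgroup SL(2, ℤ)) : Subgroup (GL (Fin 2) ℝ)) ≤
      toConjAct (affineMatrix x y hx)⁻¹ • 𝒮ℒ) (τ : ℍ) :
    affineE4 x y hx h τ = E₄ (affinePoint x y hx τ) := by
  have h1 : affineE4 x y hx h τ = ((x : ℂ) ^ 3)⁻¹ * (⇑E₄ ∣[(4 : ℤ)] affineMatrix x y hx) τ := rfl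
  have hx' : (x : ℂ) ≠ 0 := by exact_mod_cast hx.ne'
  rw [h1, slash_affineMatrix, inv_mul_cancel_left₀ (pow_ne_zero 3 hx')]

/-- The coefficients of `E₄`. -/
def coeffE4 (n : ℕ) : ℂ := if n = 0 then 1 else 240 * (σ 3 n : ℂ)

lemma hasSum_E4 (τ : ℍ) : HasSum
    (fun n : ℕ => coeffE4 n * Complex.exp (2 * Real.pi * Complex.I * τ) ^ n) (E₄ τ) := by
  refine (ModularForm.hasSum_qExpansion (E₄ : ModularForm 𝒮ℒ 4) one_pos
    one_mem_strictPeriods_SL τ).congr_fun fun n => ?_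
  have hb : bernoulli 4 = -1 / 30 := by
    rw [bernoulli_eq_bernoulli'_of_ne_one (by norm_num), bernoulli'_four]
  rw [EisensteinSeries.E_qExpansion_coeff _ (by decide), coeffE4, Function.Periodic.qParam]
  congr 1
  · split_ifs
    · rfl
    · rw [hb]; norm_num
  · simp

/-- The coefficients of `∑ a n q ^ (i n)`. -/
def dilate (i : ℕ) (a : ℕ → ℂ) (n : ℕ) : ℂ := if i ∣ n then a (n / i) else 0

lemma dilate_mul {i : ℕ} (hi : 0 < i) (a : ℕ → ℂ) (n : ℕ) : dilate i a (i * n) = a n := by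
  rw [dilate, if_pos (dvd_mul_right i n), Nat.mul_div_cancel_left n hi]

lemma hasSum_dilate {i : ℕ} (hi : 0 < i) {a : ℕ → ℂ} {g : ℕ → ℂ} {S : ℂ}
    (h : HasSum (fun n => a n * g (i * n)) S) : HasSum (fun n => dilate i a n * g n) S := by
  have hinj : Function.Injective fun n : ℕ => i * n := fun m n h => Nat.eq_of_mul_eq_mul_left hi h
  rw [← hinj.hasSum_iff]
  · refine h.congr_fun fun n => ?_
    simp only [Function.comp, dilate_mul hi]
  · intro n hn
    rw [dilate, if_neg, zero_mul]
    rintro ⟨m, rfl⟩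
    exact hn ⟨m, rfl⟩

lemma hasSum_E4_dilation {i : ℕ} (hi : 0 < (i : ℝ)) (τ : ℍ) : HasSum
    (fun n : ℕ => dilate i coeffE4 n * Complex.exp (2 * Real.pi * Complex.I * τ) ^ n)
    (E₄ (affinePoint i 0 hi τ)) := by
  apply hasSum_dilate (g := fun n => Complex.exp (2 * Real.pi * Complex.I * τ) ^ n)
    (by exact_mod_cast hi)
  refine (hasSum_E4 (affinePoint i 0 hi τ)).congr_fun fun n => ?_
  rw [coe_affinePoint, pow_mul, ← Complex.exp_nat_mul]
  congr 3
  push_cast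
  ring

/-- A primitive cube root of unity. -/
noncomputable def cubeRoot : ℂ := Complex.exp (2 * Real.pi * Complex.I / 3)

lemma cubeRoot_pow_three : cubeRoot ^ 3 = 1 := by
  have := (Complex.isPrimitiveRoot_exp 3 (by norm_num)).pow_eq_one
  simpa [cubeRoot] using this

lemma cubeRoot_ne_one : cubeRoot ≠ 1 := by
  have := (Complex.isPrimitiveRoot_exp 3 (by norm_num)).ne_one (by norm_num)
  simpa [cubeRoot] using this

lemma cubeRoot_sub_sq_ne_zero : cubeRoot - cubeRoot ^ 2 ≠ 0 := by
  intro h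
  have h0 : cubeRoot ≠ 0 := Complex.exp_ne_zero _
  have h1 : cubeRoot * (1 - cubeRoot) = 0 := by linear_combination h
  rcases mul_eq_zero.1 h1 with h | h
  · exact h0 h
  · exact cubeRoot_ne_one (by linear_combination -h)

lemma hasSum_E4_translation (j : ℕ) (τ : ℍ) : HasSum
    (fun n : ℕ => coeffE4 n * (cubeRoot ^ j) ^ n * Complex.exp (2 * Real.pi * Complex.I * τ) ^ n)
    (E₄ (affinePoint 1 (((j : ℤ) : ℝ) / 3) one_pos τ)) := by
  refine (hasSum_E4 (affinePoint 1 (((j : ℤ) : ℝ) / 3) one_pos τ)).congr_fun fun n => ?_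
  rw [coe_affinePoint, mul_assoc, ← mul_pow, cubeRoot, ← Complex.exp_nat_mul, ← Complex.exp_add]
  congr 3
  push_cast
  ring

lemma chi3_natCast (n : ℕ) : chi3 (n : ZMod 3) =
    if n % 3 = 0 then 0 else if n % 3 = 1 then 1 else -1 := by
  have h : ∀ m : ZMod 3, quadraticChar (ZMod 3) m = if m = 0 then 0 else if m = 1 then 1 else -1 := by
    decide
  rw [chi3, MulChar.ringHomComp_apply, h, ← ZMod.natCast_mod n 3]
  have : n % 3 = 0 ∨ n % 3 = 1 ∨ n % 3 = 2 := by omega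
  rcases this with h | h | h <;> rw [h] <;> simp
  rw [if_neg (by decide), if_neg (by decide)]

/-- The Gauss sum expansion of `χ₃`: twisting by the character is a combination of the translations
by `1/3` and `2/3`. -/
lemma cubeRoot_pow_sub (n : ℕ) : cubeRoot ^ n - (cubeRoot ^ 2) ^ n =
    chi3 (n : ZMod 3) * (cubeRoot - cubeRoot ^ 2) := by
  have h3 := cubeRoot_pow_three
  have key : ∀ x : ℂ, x ^ 3 = 1 → x ^ n = x ^ (n % 3) := fun x hx => by
    conv_lhs => rw [← Nat.div_add_mod n 3, pow_add, pow_mul, hx, one_pow, one_mul]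
  rw [key _ h3, key _ (by rw [← pow_mul, mul_comm, pow_mul, h3, one_pow]), chi3_natCast]
  have : n % 3 = 0 ∨ n % 3 = 1 ∨ n % 3 = 2 := by omega
  rcases this with h | h | h <;> rw [h] <;> norm_num
  linear_combination cubeRoot * h3

namespace RationalMukai

/-- The Fourier coefficients of the weight 4 form. -/
noncomputable def formCoeff : RationalMukai → ℕ → ℂ
  | V12 => fun n => 1 / 240 * (dilate 1 coeffE4 n - 28 * dilate 2 coeffE4 n
      + 63 * dilate 3 coeffE4 n - 36 * dilate 6 coeffE4 n)
  | V16 => fun n => 1 / 240 * (dilate 1 coeffE4 n - 21 * dilate 2 coeffE4 n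
      + 84 * dilate 4 coeffE4 n - 64 * dilate 8 coeffE4 n)
  | V18 => fun n => chi3 (n : ZMod 3) * (σ 3 n : ℂ)

/-- The form of weight 4 and level 6. -/
noncomputable def formSix : ModularForm ((CongruenceSubgroup.Gamma0 6 : Subgroup SL(2, ℤ)) :
    Subgroup (GL (Fin 2) ℝ)) 4 :=
  (1 / 240 : ℂ) • (affineE4 _ _ _
      (Gamma0_le_conj_dilation (N := 6) (i := 1) (by norm_num) (by norm_num))
    - (28 : ℂ) • affineE4 _ _ _
      (Gamma0_le_conj_dilation (N := 6) (i := 2) (by norm_num) (by norm_num))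
    + (63 : ℂ) • affineE4 _ _ _
      (Gamma0_le_conj_dilation (N := 6) (i := 3) (by norm_num) (by norm_num))
    - (36 : ℂ) • affineE4 _ _ _
      (Gamma0_le_conj_dilation (N := 6) (i := 6) (by norm_num) (by norm_num)))

lemma formSix_apply (τ : ℍ) : formSix τ = 1 / 240 * (
      E₄ (affinePoint (1 : ℕ) 0 (by norm_num) τ) - 28 * E₄ (affinePoint (2 : ℕ) 0 (by norm_num) τ)
      + 63 * E₄ (affinePoint (3 : ℕ) 0 (by norm_num) τ) - 36 * E₄ (affinePoint (6 : ℕ) 0 (by norm_num) τ)) := by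
  simp only [formSix, smul_apply, sub_apply, add_apply, affineE4_apply, smul_eq_mul]

lemma hasSum_formSix (τ : ℍ) : HasSum
    (fun n : ℕ => formCoeff V12 n * Complex.exp (2 * Real.pi * Complex.I * τ) ^ n)
    (formSix τ) := by
  rw [formSix_apply]
  have h := fun (i : ℕ) (hi : 0 < (i : ℝ)) => hasSum_E4_dilation hi τ
  refine (((((h 1 (by norm_num)).sub ((h 2 (by norm_num)).mul_left 28)).add
    ((h 3 (by norm_num)).mul_left 63)).sub
    ((h 6 (by norm_num)).mul_left 36)).mul_left (1 / 240)).congr_fun fun n => ?_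
  simp only [formCoeff]
  ring

/-- The form of weight 4 and level 8. -/
noncomputable def formEight : ModularForm ((CongruenceSubgroup.Gamma0 8 : Subgroup SL(2, ℤ)) :
    Subgroup (GL (Fin 2) ℝ)) 4 :=
  (1 / 240 : ℂ) • (affineE4 _ _ _
      (Gamma0_le_conj_dilation (N := 8) (i := 1) (by norm_num) (by norm_num))
    - (21 : ℂ) • affineE4 _ _ _
      (Gamma0_le_conj_dilation (N := 8) (i := 2) (by norm_num) (by norm_num))
    + (84 : ℂ) • affineE4 _ _ _
      (Gamma0_le_conj_dilation (N := 8) (i := 4) (by norm_num) (by norm_num))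
    - (64 : ℂ) • affineE4 _ _ _
      (Gamma0_le_conj_dilation (N := 8) (i := 8) (by norm_num) (by norm_num)))

lemma formEight_apply (τ : ℍ) : formEight τ = 1 / 240 * (
      E₄ (affinePoint (1 : ℕ) 0 (by norm_num) τ) - 21 * E₄ (affinePoint (2 : ℕ) 0 (by norm_num) τ)
      + 84 * E₄ (affinePoint (4 : ℕ) 0 (by norm_num) τ) - 64 * E₄ (affinePoint (8 : ℕ) 0 (by norm_num) τ)) := by
  simp only [formEight, smul_apply, sub_apply, add_apply, affineE4_apply, smul_eq_mul]

lemma hasSum_formEight (τ : ℍ) : HasSum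
    (fun n : ℕ => formCoeff V16 n * Complex.exp (2 * Real.pi * Complex.I * τ) ^ n)
    (formEight τ) := by
  rw [formEight_apply]
  have h := fun (i : ℕ) (hi : 0 < (i : ℝ)) => hasSum_E4_dilation hi τ
  refine (((((h 1 (by norm_num)).sub ((h 2 (by norm_num)).mul_left 21)).add
    ((h 4 (by norm_num)).mul_left 84)).sub
    ((h 8 (by norm_num)).mul_left 64)).mul_left (1 / 240)).congr_fun fun n => ?_
  simp only [formCoeff]
  ring

/-- The form of weight 4 and level 9. -/
noncomputable def formNine : ModularForm ((CongruenceSubgroup.Gamma0 9 : Subgroup SL(2, ℤ)) :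
    Subgroup (GL (Fin 2) ℝ)) 4 :=
  (1 / (240 * (cubeRoot - cubeRoot ^ 2)) : ℂ) • (
    affineE4 _ _ _ (Gamma0_nine_le_conj_translation (1 : ℕ))
    - affineE4 _ _ _ (Gamma0_nine_le_conj_translation (2 : ℕ)))

lemma formNine_apply (τ : ℍ) : formNine τ = 1 / (240 * (cubeRoot - cubeRoot ^ 2)) *
    (E₄ (affinePoint 1 (((1 : ℕ) : ℤ) / 3) one_pos τ)
      - E₄ (affinePoint 1 (((2 : ℕ) : ℤ) / 3) one_pos τ)) := by
  simp only [formNine, smul_apply, sub_apply, affineE4_apply, smul_eq_mul]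

lemma hasSum_formNine (τ : ℍ) : HasSum
    (fun n : ℕ => formCoeff V18 n * Complex.exp (2 * Real.pi * Complex.I * τ) ^ n)
    (formNine τ) := by
  rw [formNine_apply]
  refine (((hasSum_E4_translation 1 τ).sub (hasSum_E4_translation 2 τ)).mul_left
    (1 / (240 * (cubeRoot - cubeRoot ^ 2)))).congr_fun fun n => ?_
  have h := cubeRoot_pow_sub n
  have h0 := cubeRoot_sub_sq_ne_zero
  simp only [formCoeff]
  rcases eq_or_ne n 0 with rfl | hn
  · simp
  · rw [coeffE4, if_neg hn, pow_one]
    generalize cubeRoot - cubeRoot ^ 2 = d at *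
    field_simp
    linear_combination -(σ 3 n : ℂ) * h

/-- The weight 4 form as a modular form. -/
noncomputable def form : (V : RationalMukai) →
    ModularForm ((CongruenceSubgroup.Gamma0 V.level : Subgroup SL(2, ℤ)) :
      Subgroup (GL (Fin 2) ℝ)) 4
  | V12 => formSix
  | V16 => formEight
  | V18 => formNine

lemma hasSum_form (V : RationalMukai) (τ : ℍ) : HasSum
    (fun n : ℕ => V.formCoeff n * Complex.exp (2 * Real.pi * Complex.I * τ) ^ n) (V.form τ) := by
  cases V with
  | V12 => exact hasSum_formSix τ
  | V16 => exact hasSum_formEight τ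
  | V18 => exact hasSum_formNine τ

lemma formCoeff_zero (V : RationalMukai) : V.formCoeff 0 = 0 := by
  cases V <;> simp [formCoeff, dilate, coeffE4] <;> norm_num

end RationalMukai

/-! ### The Fricke involution and the Fourier expansion -/

lemma levelOne_moebius {k : ℤ} (f : ModularForm 𝒮ℒ k) (a b c d : ℤ) (h : a * d - b * c = 1)
    {w z : ℍ} (hw : (w : ℂ) * (c * z + d) = a * z + b) : f w = (c * (z : ℂ) + d) ^ k * f z := by
  let γ : SL(2, ℤ) := ⟨!![a, b; c, d], by rw [Matrix.det_fin_two_of, h]⟩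
  have hd : denom (γ : GL (Fin 2) ℝ) z = c * (z : ℂ) + d := by
    rw [denom, coe_SL2Z_matrix]
    simp [γ]
  have hd0 : c * (z : ℂ) + d ≠ 0 := hd ▸ denom_ne_zero _ z
  have hwz : γ • z = w := by
    apply UpperHalfPlane.ext
    rw [eq_div_of_mul_eq hd0 hw, UpperHalfPlane.specialLinearGroup_apply]
    simp [γ]
  have := SlashInvariantForm.slash_action_eqn'' f
    (show (γ : GL (Fin 2) ℝ) ∈ 𝒮ℒ from ⟨γ, rfl⟩) z
  rw [hd] at this
  rw [← hwz]
  exact this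

/-- Since `i τ' = -1/(j τ)`, the involution pairs the dilations by complementary divisors of `N`;
the coefficients of the forms are antisymmetric under this pairing. -/
lemma E4_dilation_fricke {i j : ℕ} (hi : 0 < (i : ℝ)) (hj : 0 < (j : ℝ)) {N : ℕ} (hN : i * j = N)
    {τ τ' : ℍ} (h : (τ' : ℂ) = -1 / (N * τ)) :
    E₄ (affinePoint i 0 hi τ') = (j * (τ : ℂ)) ^ 4 * E₄ (affinePoint j 0 hj τ) := by
  have hi' : (i : ℂ) ≠ 0 := by exact_mod_cast hi.ne'
  have hj' : (j : ℂ) ≠ 0 := by exact_mod_cast hj.ne'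
  have hτ := τ.ne_zero
  have := levelOne_moebius E₄ 0 (-1) 1 0 (by norm_num) (w := affinePoint i 0 hi τ')
    (z := affinePoint j 0 hj τ) (by
      rw [coe_affinePoint, coe_affinePoint, h, ← hN]
      push_cast
      field_simp
      ring)
  rw [this, coe_affinePoint]
  push_cast
  simp

namespace RationalMukai

lemma sqrt_pow_four (N : ℕ) (z : ℂ) : (z * (√(N : ℝ) : ℝ)) ^ 4 = (N : ℂ) ^ 2 * z ^ 4 := by
  have : (((√(N : ℝ) : ℝ)) : ℂ) ^ 2 = N := by
    rw [← Complex.ofReal_pow, Real.sq_sqrt (Nat.cast_nonneg N)]; simp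
  linear_combination z ^ 4 * ((((√(N : ℝ) : ℝ)) : ℂ) ^ 2 + N) * this

lemma isAtkinLehnerOdd_form (V : RationalMukai) : IsAtkinLehnerOdd V.level V.form := by
  intro τ τ' h
  rw [sqrt_pow_four]
  cases V with
  | V12 =>
    change formSix τ' = -((6 : ℕ) ^ 2 * (τ : ℂ) ^ 4) * formSix τ
    change (τ' : ℂ) = -1 / ((6 : ℕ) * τ) at h
    rw [formSix_apply, formSix_apply,
      E4_dilation_fricke (i := 1) (j := 6) (by norm_num) (by norm_num) rfl h,
      E4_dilation_fricke (i := 2) (j := 3) (by norm_num) (by norm_num) rfl h,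
      E4_dilation_fricke (i := 3) (j := 2) (by norm_num) (by norm_num) rfl h,
      E4_dilation_fricke (i := 6) (j := 1) (by norm_num) (by norm_num) rfl h]
    push_cast
    ring
  | V16 =>
    change formEight τ' = -((8 : ℕ) ^ 2 * (τ : ℂ) ^ 4) * formEight τ
    change (τ' : ℂ) = -1 / ((8 : ℕ) * τ) at h
    rw [formEight_apply, formEight_apply,
      E4_dilation_fricke (i := 1) (j := 8) (by norm_num) (by norm_num) rfl h,
      E4_dilation_fricke (i := 2) (j := 4) (by norm_num) (by norm_num) rfl h,
      E4_dilation_fricke (i := 4) (j := 2) (by norm_num) (by norm_num) rfl h,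
      E4_dilation_fricke (i := 8) (j := 1) (by norm_num) (by norm_num) rfl h]
    push_cast
    ring
  | V18 =>
    change formNine τ' = -((9 : ℕ) ^ 2 * (τ : ℂ) ^ 4) * formNine τ
    change (τ' : ℂ) = -1 / ((9 : ℕ) * τ) at h
    have hτ := τ.ne_zero
    rw [formNine_apply, formNine_apply]
    -- These matrices carry `τ + 2/3` to `τ' + 1/3` and `τ + 1/3` to `τ' + 2/3`, both with
    -- automorphy factor `3τ`. The exchange of the two translates is the source of the minus sign.
    rw [levelOne_moebius E₄ 1 (-1) 3 (-2) (by norm_num)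
      (w := affinePoint 1 (((1 : ℕ) : ℤ) / 3) one_pos τ')
      (z := affinePoint 1 (((2 : ℕ) : ℤ) / 3) one_pos τ) (by
        simp only [coe_affinePoint, h]; push_cast; field_simp; ring),
      levelOne_moebius E₄ 2 (-1) 3 (-1) (by norm_num)
      (w := affinePoint 1 (((2 : ℕ) : ℤ) / 3) one_pos τ')
      (z := affinePoint 1 (((1 : ℕ) : ℤ) / 3) one_pos τ) (by
        simp only [coe_affinePoint, h]; push_cast; field_simp; ring)]
    simp only [coe_affinePoint]
    norm_cast
    push_cast
    ring

lemma eisensteinHarmonic4_eq {i : ℕ} (hi : 0 < (i : ℝ)) (τ : ℍ) :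
    eisensteinHarmonic4 i τ = (i : ℂ) ^ 2 / 240 * E₄ (affinePoint i 0 hi τ) := by
  have hb : bernoulli 4 = -1 / 30 := by
    rw [bernoulli_eq_bernoulli'_of_ne_one (by norm_num), bernoulli'_four]
  rw [eisensteinHarmonic4, EisensteinSeries.q_expansion_bernoulli _ (by decide), hb]
  congr 1
  rw [sub_eq_add_neg, ← neg_mul]
  congr 2
  · norm_num
  · refine tsum_congr fun n => ?_
    rw [zpow_natCast, coe_affinePoint, pow_mul, ← Complex.exp_nat_mul _ i]
    congr 3
    push_cast
    ring

lemma form_eq_formFun (V : RationalMukai) (τ : ℍ) : V.form τ = V.formFun τ := by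
  cases V with
  | V12 =>
    change formSix τ = _
    rw [formSix_apply]
    simp only [formFun]
    rw [eisensteinHarmonic4_eq (i := 1) (by norm_num), eisensteinHarmonic4_eq (i := 2) (by norm_num),
      eisensteinHarmonic4_eq (i := 3) (by norm_num), eisensteinHarmonic4_eq (i := 6) (by norm_num)]
    push_cast
    ring
  | V16 =>
    change formEight τ = _
    rw [formEight_apply]
    simp only [formFun]
    rw [eisensteinHarmonic4_eq (i := 1) (by norm_num), eisensteinHarmonic4_eq (i := 2) (by norm_num),
      eisensteinHarmonic4_eq (i := 4) (by norm_num), eisensteinHarmonic4_eq (i := 8) (by norm_num)]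
    push_cast
    ring
  | V18 =>
    have h := V18.hasSum_form τ
    rw [← h.tsum_eq, h.summable.tsum_eq_zero_add, formCoeff_zero, zero_mul, zero_add]
    exact (tsum_pnat_eq_tsum_succ (f := fun n : ℕ => V18.formCoeff n *
      Complex.exp (2 * Real.pi * Complex.I * τ) ^ n)).symm

lemma qExpansion_form (V : RationalMukai) (n : ℕ) :
    (qExpansion 1 V.form).coeff n = V.formCoeff n := by
  refine (ModularFormClass.qExpansion_coeff_unique one_pos (by simp) (fun τ => ?_) n).symm
  simpa [Function.Periodic.qParam] using V.hasSum_form τ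

end RationalMukai

/-! ### The Dirichlet series and the entire `L`-function -/

lemma LSeriesHasSum.mul_natCast_pow {f : ℕ → ℂ} {s a : ℂ} (k : ℕ) (h : LSeriesHasSum f (s - k) a) :
    LSeriesHasSum (fun n => f n * (n : ℂ) ^ k) s a := by
  refine HasSum.congr_fun h fun n => ?_
  rcases eq_or_ne n 0 with rfl | hn
  · simp
  · have hn' : (n : ℂ) ≠ 0 := by exact_mod_cast hn
    rw [LSeries.term_of_ne_zero hn, LSeries.term_of_ne_zero hn, Complex.cpow_sub _ _ hn',
      Complex.cpow_natCast, div_div_eq_mul_div]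

/-- For completely multiplicative `f`, the product `f σ_k` is the Dirichlet convolution of `f` and
`f n^k`, because `f d * f (n / d) = f n`. -/
lemma LSeriesHasSum.mul_sigma {f : ℕ → ℂ} {s a b : ℂ} (k : ℕ) (hf : ∀ m n, f (m * n) = f m * f n)
    (h : LSeriesHasSum f s a) (h' : LSeriesHasSum f (s - k) b) :
    LSeriesHasSum (fun n => f n * (σ k n : ℂ)) s (a * b) := by
  have := h.convolution (h'.mul_natCast_pow k)
  refine HasSum.congr_fun this fun n => ?_
  rcases eq_or_ne n 0 with rfl | hn
  · simp
  · rw [LSeries.term_of_ne_zero hn, LSeries.term_of_ne_zero hn, LSeries.convolution_def,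
      ArithmeticFunction.sigma_apply]
    congr 1
    simp only
    rw [Nat.sum_divisorsAntidiagonal' (f := fun i j : ℕ => f i * (f j * (j : ℂ) ^ k)), Nat.cast_sum,
      Finset.mul_sum]
    refine Finset.sum_congr rfl fun d hd => ?_
    rw [← mul_assoc, ← hf, Nat.div_mul_cancel (Nat.dvd_of_mem_divisors hd), Nat.cast_pow]

namespace RationalMukai

lemma LSeriesHasSum_sigma_three {s : ℂ} (hs : 4 < s.re) :
    LSeriesHasSum (fun n => (σ 3 n : ℂ)) s (riemannZeta s * riemannZeta (s - 3)) := by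
  have h : ∀ s : ℂ, 1 < s.re → LSeriesHasSum (fun _ => 1) s (riemannZeta s) := fun s hs =>
    LSeriesHasSum_one hs
  have := (h s (by linarith)).mul_sigma (b := riemannZeta (s - 3)) 3 (by simp)
    (h _ (by simp; linarith))
  simpa using this

lemma LSeriesHasSum_dilate_coeffE4 {i : ℕ} (hi : 0 < i) {s : ℂ} (hs : 4 < s.re) :
    LSeriesHasSum (dilate i coeffE4) s
      (240 * ((i : ℂ) ^ (-s) * (riemannZeta s * riemannZeta (s - 3)))) := by
  have hinj : Function.Injective fun n : ℕ => i * n := fun m n h => Nat.eq_of_mul_eq_mul_left hi h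
  rw [LSeriesHasSum, ← hinj.hasSum_iff]
  · refine HasSum.congr_fun (((LSeriesHasSum_sigma_three hs).mul_left ((i : ℂ) ^ (-s))).mul_left 240)
      fun n => ?_
    rcases eq_or_ne n 0 with rfl | hn
    · simp
    · simp only [Function.comp]
      rw [LSeries.term_of_ne_zero (mul_ne_zero hi.ne' hn), LSeries.term_of_ne_zero hn, dilate_mul hi,
        coeffE4, if_neg hn, Nat.cast_mul, Complex.natCast_mul_natCast_cpow, Complex.cpow_neg]
      have : (i : ℂ) ^ s ≠ 0 := by simp [Complex.cpow_eq_zero_iff, hi.ne']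
      have : (n : ℂ) ^ s ≠ 0 := by simp [Complex.cpow_eq_zero_iff, hn]
      field_simp
  · intro n hn
    rcases eq_or_ne n 0 with rfl | hn0
    · simp
    rw [LSeries.term_of_ne_zero hn0, dilate, if_neg, zero_div]
    rintro ⟨m, rfl⟩
    exact hn ⟨m, rfl⟩

/-- The explicit `L`-function. -/
noncomputable def explicitL : RationalMukai → ℂ → ℂ
  | V12 => fun s => (1 - 7 * (2 : ℂ) ^ (2 - s) + 7 * (3 : ℂ) ^ (2 - s) - (6 : ℂ) ^ (2 - s)) *
        riemannZeta s * riemannZeta (s - 3)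
  | V16 => fun s => (1 - 21 / 4 * (2 : ℂ) ^ (2 - s) + 21 / 4 * (4 : ℂ) ^ (2 - s)
        - (8 : ℂ) ^ (2 - s)) * riemannZeta s * riemannZeta (s - 3)
  | V18 => fun s => chi3.LFunction s * chi3.LFunction (s - 3)

lemma cpow_two_sub {x : ℂ} (hx : x ≠ 0) (s : ℂ) : x ^ (2 - s) = x ^ 2 * x ^ (-s) := by
  rw [sub_eq_add_neg, Complex.cpow_add _ _ hx, Complex.cpow_ofNat]

lemma LSeriesHasSum_formCoeff (V : RationalMukai) {s : ℂ} (hs : 4 < s.re) :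
    LSeriesHasSum V.formCoeff s (V.explicitL s) := by
  have h := fun (i : ℕ) (hi : 0 < i) => LSeriesHasSum_dilate_coeffE4 hi hs
  cases V with
  | V12 =>
    have H := ((((h 1 (by norm_num)).sub ((h 2 (by norm_num)).smul 28)).add
      ((h 3 (by norm_num)).smul 63)).sub ((h 6 (by norm_num)).smul 36)).smul (1 / 240)
    convert H using 1
    · ext n
      simp [formCoeff]
    · simp only [explicitL]
      push_cast
      rw [Complex.one_cpow, cpow_two_sub (x := 2) (by norm_num), cpow_two_sub (x := 3) (by norm_num),
        cpow_two_sub (x := 6) (by norm_num)]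
      ring
  | V16 =>
    have H := ((((h 1 (by norm_num)).sub ((h 2 (by norm_num)).smul 21)).add
      ((h 4 (by norm_num)).smul 84)).sub ((h 8 (by norm_num)).smul 64)).smul (1 / 240)
    convert H using 1
    · ext n
      simp [formCoeff]
    · simp only [explicitL]
      push_cast
      rw [Complex.one_cpow, cpow_two_sub (x := 2) (by norm_num), cpow_two_sub (x := 4) (by norm_num),
        cpow_two_sub (x := 8) (by norm_num)]
      ring
  | V18 =>
    have h : ∀ s : ℂ, 1 < s.re → LSeriesHasSum (fun n => chi3 (n : ZMod 3)) s (chi3.LFunction s) :=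
      fun s hs => by
        rw [DirichletCharacter.LFunction_eq_LSeries _ hs]
        exact (ZMod.LSeriesSummable_of_one_lt_re _ hs).LSeriesHasSum
    exact (h s (by linarith)).mul_sigma 3 (by simp) (h _ (by simp; linarith))

lemma isZeroAtImInfty_form (V : RationalMukai) : IsZeroAtImInfty V.form := by
  apply isZeroAtImInfty_of_valueAtInfty_eq_zero
  rw [← UpperHalfPlane.qExpansion_coeff_zero one_pos
    (ModularFormClass.analyticAt_cuspFunction_zero V.form one_pos (by simp))
    (SlashInvariantFormClass.periodic_comp_ofComplex V.form (by simp)), qExpansion_form,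
    formCoeff_zero]

lemma tendsto_affinePoint_atImInfty (x y : ℝ) (hx : 0 < x) :
    Tendsto (affinePoint x y hx) atImInfty atImInfty := by
  rw [atImInfty, tendsto_comap_iff]
  have : (im ∘ affinePoint x y hx) = fun τ => x * τ.im := by
    ext τ
    simp [← coe_im, Function.comp]
  rw [this]
  exact tendsto_comap.const_mul_atTop hx

/-- By the Fricke symmetry `F ∣ S` is `-N⁻² F(τ/N)`, so both constant terms of the pair vanish. The
completed function is then entire and equal to the plain Mellin transform. -/
lemma isStrongFEPair_form (V : RationalMukai) :
    IsStrongFEPair (weakFEPair (by norm_num : (0 : ℤ) < 4) V.form) where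
  hf₀ := V.isZeroAtImInfty_form.valueAtInfty_eq_zero
  hg₀ := by
    have hN : (0 : ℝ) < 1 / V.level := by cases V <;> norm_num [level]
    have hN0 : (V.level : ℂ) ≠ 0 := by cases V <;> norm_num [level]
    have h : ∀ τ : ℍ, ModularForm.translate V.form (ModularGroup.S : GL (Fin 2) ℝ) τ =
        -(1 / (V.level : ℂ) ^ 2) * V.form (affinePoint (1 / V.level) 0 hN τ) := by
      intro τ
      have e1 : ModularForm.translate V.form (ModularGroup.S : GL (Fin 2) ℝ) τ =
          (⇑V.form ∣[(4 : ℤ)] ModularGroup.S) τ := rfl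
      have hτ := τ.ne_zero
      have e2 : V.form (ModularGroup.S • τ) = _ := V.isAtkinLehnerOdd_form
        (affinePoint (1 / V.level) 0 hN τ) (ModularGroup.S • τ) (by
          rw [UpperHalfPlane.modular_S_smul, coe_affinePoint]
          push_cast
          simp
          field_simp)
      rw [e1, ModularForm.SL_slash_apply, e2, sqrt_pow_four, coe_affinePoint, ModularGroup.denom_S]
      push_cast
      have e3 : (τ : ℂ) ^ (-4 : ℤ) = ((τ : ℂ) ^ 4)⁻¹ := by rw [zpow_neg]; rfl
      rw [e3]
      field_simp
      ring
    apply IsZeroAtImInfty.valueAtInfty_eq_zero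
    have h2 := ((V.isZeroAtImInfty_form).comp (tendsto_affinePoint_atImInfty (1 / V.level) 0 hN)).const_mul
      (-(1 / (V.level : ℂ) ^ 2))
    rw [mul_zero] at h2
    exact h2.congr fun τ => (h τ).symm

lemma formL_eq_mellin (V : RationalMukai) (s : ℂ) : formL V.form s =
    mellin (fun t : ℝ => V.form (ofComplex (Complex.I * t))) s * (2 / Complex.Gammaℂ s) := by
  rw [formL, ModularForm.L, ModularForm.Λ, V.isStrongFEPair_form.Λ_eq]
  rfl

lemma differentiable_formL (V : RationalMukai) : Differentiable ℂ (formL V.form) := by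
  have h1 : Differentiable ℂ (ModularForm.Λ (by norm_num : (0 : ℤ) < 4) V.form) :=
    V.isStrongFEPair_form.differentiable_Λ
  intro s
  unfold formL ModularForm.L
  simp only [div_eq_mul_inv]
  have h2 : Differentiable ℂ fun s => (Complex.Gammaℂ s)⁻¹ := by fun_prop
  exact (h1 s).mul ((h2 s).const_mul 2)

/-- Termwise Mellin transformation of the Fourier series along the imaginary axis; the gamma factor
cancels the one in the definition of `L`. -/
lemma formL_eq_explicitL_of_lt (V : RationalMukai) {s : ℂ} (hs : 4 < s.re) :
    formL V.form s = V.explicitL s := by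
  have hs0 : 0 < s.re := by linarith
  have hD := V.LSeriesHasSum_formCoeff hs
  have hterm : ∀ n : ℕ, LSeries.term V.formCoeff s n = V.formCoeff n / (n : ℂ) ^ s := fun n => by
    rcases eq_or_ne n 0 with rfl | hn
    · simp [formCoeff_zero]
    · exact LSeries.term_of_ne_zero hn _ _
  have hm := hasSum_mellin (a := V.formCoeff) (p := fun n => 2 * Real.pi * n)
    (F := fun t : ℝ => V.form (ofComplex (Complex.I * t))) (s := s) (fun n => by
      rcases eq_or_ne n 0 with rfl | hn
      · exact Or.inl V.formCoeff_zero
      · exact Or.inr (by positivity)) hs0 (fun t (ht : 0 < t) => by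
      have := V.hasSum_form (ofComplex (Complex.I * t))
      refine this.congr_fun fun n => ?_
      rw [ofComplex_apply_of_im_pos (by simpa using ht), ← Complex.exp_nat_mul, Complex.ofReal_exp]
      congr 2
      push_cast
      linear_combination (-(2 * Real.pi * n * t) : ℂ) * Complex.I_sq) (by
      have := (hD.summable.norm).mul_left (((2 * Real.pi) ^ s.re)⁻¹)
      refine this.congr fun n => ?_
      rw [hterm, norm_div]
      rcases eq_or_ne n 0 with rfl | hn
      · simp [formCoeff_zero]
      · rw [Complex.norm_natCast_cpow_of_pos (Nat.pos_of_ne_zero hn),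
          Real.mul_rpow (x := 2 * Real.pi) (by positivity) (by positivity)]
        have : (0 : ℝ) < (2 * Real.pi) ^ s.re := by positivity
        generalize (2 * Real.pi) ^ s.re = x at *
        field_simp)
  have hm2 : HasSum (fun n => Complex.Gamma s * V.formCoeff n / ((2 * Real.pi * n : ℝ) : ℂ) ^ s)
      (Complex.Gamma s * (2 * Real.pi : ℂ) ^ (-s) * V.explicitL s) := by
    refine (hD.mul_left (Complex.Gamma s * (2 * Real.pi : ℂ) ^ (-s))).congr_fun fun n => ?_
    have e : ((2 * Real.pi * n : ℝ) : ℂ) ^ s = (2 * Real.pi : ℂ) ^ s * (n : ℂ) ^ s := by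
      rw [Complex.ofReal_mul, Complex.mul_cpow_ofReal_nonneg (by positivity) (by positivity)]
      push_cast; rfl
    rw [hterm, e, Complex.cpow_neg]
    rw [mul_div_mul_comm, div_eq_mul_inv (Complex.Gamma s)]
  rw [formL_eq_mellin, hm.unique hm2, Complex.Gammaℂ_def]
  have h1 : (2 * Real.pi : ℂ) ^ (-s) ≠ 0 := by
    simp [Complex.cpow_eq_zero_iff, Real.pi_ne_zero]
  have h2 := Complex.Gamma_ne_zero_of_re_pos hs0
  field_simp

lemma chi3_ne_one : chi3 ≠ 1 := by
  intro h
  have h2 := chi3_natCast 2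
  rw [h] at h2
  have : IsUnit ((2 : ℕ) : ZMod 3) := by decide
  rw [MulChar.one_apply this] at h2
  norm_num at h2

/-- The identity theorem on the complement of `S`: a countable set does not disconnect the plane,
and its complement meets the half-plane of convergence. -/
lemma eq_explicitL_of_eq (V : RationalMukai) {L : ℂ → ℂ} (hL : Differentiable ℂ L)
    (h : ∀ s : ℂ, 4 < s.re → L s = V.explicitL s) {S : Set ℂ} (hS : S.Countable) (hS' : IsClosed S)
    (hd : ∀ s ∉ S, DifferentiableAt ℂ V.explicitL s) (s : ℂ) (hs : s ∉ S) : L s = V.explicitL s := by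
  have hopen : IsOpen Sᶜ := hS'.isOpen_compl
  have hconn : IsPreconnected Sᶜ :=
    (hS.isConnected_compl_of_one_lt_rank (by rw [Complex.rank_real_complex]; norm_num)).isPreconnected
  have h1 : AnalyticOnNhd ℂ L Sᶜ := fun z _ => hL.analyticAt z
  have h2 : AnalyticOnNhd ℂ V.explicitL Sᶜ :=
    DifferentiableOn.analyticOnNhd (fun z hz => (hd z hz).differentiableWithinAt) hopen
  have hne : (Sᶜ ∩ {z : ℂ | 4 < z.re}).Nonempty := by
    have ho : IsOpen {z : ℂ | 4 < z.re} := isOpen_lt continuous_const Complex.continuous_re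
    have hdense : Dense Sᶜ := hS.dense_compl ℝ
    rw [Set.inter_comm]
    exact hdense.inter_open_nonempty _ ho ⟨5, by norm_num⟩
  obtain ⟨z₀, hz₀, hz₁⟩ := hne
  refine h1.eqOn_of_preconnected_of_eventuallyEq h2 hconn hz₀ ?_ hs
  filter_upwards [(isOpen_lt continuous_const Complex.continuous_re).mem_nhds hz₁] with z hz
  exact h z hz

lemma hasExplicitL_formL (V : RationalMukai) : V.HasExplicitL (formL V.form) := by
  have hz : ∀ s : ℂ, s ∉ ({1, 4} : Set ℂ) → DifferentiableAt ℂ riemannZeta s ∧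
      DifferentiableAt ℂ (fun s => riemannZeta (s - 3)) s := by
    intro s hs
    simp only [Set.mem_insert_iff, Set.mem_singleton_iff, not_or] at hs
    have h3 : s - 3 ≠ 1 := fun h => hs.2 (by linear_combination h)
    exact ⟨differentiableAt_riemannZeta hs.1,
      (differentiableAt_riemannZeta h3).comp s (differentiableAt_id.sub_const 3)⟩
  have hp : ∀ (n : ℕ) [n.AtLeastTwo] (s : ℂ), DifferentiableAt ℂ (fun s : ℂ => (OfNat.ofNat n : ℂ) ^ (2 - s)) s :=
    fun n _ s => (differentiableAt_id.const_sub 2).const_cpow (Or.inl (OfNat.ofNat_ne_zero n))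
  cases V with
  | V12 =>
    intro s h1 h4
    refine V12.eq_explicitL_of_eq V12.differentiable_formL (fun s hs => formL_eq_explicitL_of_lt _ hs)
      (S := {1, 4}) (Set.to_countable _) (Set.toFinite _).isClosed (fun s hs => ?_) s (by simp [h1, h4])
    exact ((((((hp 2 s).const_mul 7).const_sub 1).add ((hp 3 s).const_mul 7)).sub (hp 6 s)).mul
      (hz s hs).1).mul (hz s hs).2
  | V16 =>
    intro s h1 h4
    refine V16.eq_explicitL_of_eq V16.differentiable_formL (fun s hs => formL_eq_explicitL_of_lt _ hs)
      (S := {1, 4}) (Set.to_countable _) (Set.toFinite _).isClosed (fun s hs => ?_) s (by simp [h1, h4])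
    exact ((((((hp 2 s).const_mul (21 / 4)).const_sub 1).add ((hp 4 s).const_mul (21 / 4))).sub
      (hp 8 s)).mul (hz s hs).1).mul (hz s hs).2
  | V18 =>
    refine ⟨fun s hs => ?_, fun s => ?_⟩
    · rw [formL_eq_explicitL_of_lt _ hs]
      have h1 : 1 < s.re := by linarith
      have h3 : 1 < (s - 3).re := by simp; linarith
      have H := (chi3.LSeries_eulerProduct_hasProd h3).mul (chi3.LSeries_eulerProduct_hasProd h1)
      simp only [explicitL]
      rw [DirichletCharacter.LFunction_eq_LSeries _ h1, DirichletCharacter.LFunction_eq_LSeries _ h3,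
        mul_comm]
      simpa only [neg_sub] using H
    · have hχ := DirichletCharacter.differentiable_LFunction chi3_ne_one
      exact V18.eq_explicitL_of_eq V18.differentiable_formL (fun s hs => formL_eq_explicitL_of_lt _ hs)
        (S := ∅) Set.countable_empty isClosed_empty
        (fun s _ => (hχ s).mul ((hχ _).comp s (differentiableAt_id.sub_const 3))) s (by simp)

end RationalMukai

/-! ### The value of `L(χ₃, s)` at 0 and the value of `L(F, s)` at 3 -/

/-- The generating function `∑ χ₃(n) exp (-n t)` in closed form. -/
noncomputable def chi3Gen (t : ℝ) : ℝ := 1 / (Real.exp t + 1 + Real.exp (-t))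

/-- Minus the derivative of `chi3Gen`. -/
noncomputable def chi3GenDeriv (t : ℝ) : ℝ :=
  (Real.exp t - Real.exp (-t)) / (Real.exp t + 1 + Real.exp (-t)) ^ 2

lemma chi3Gen_denom_pos (t : ℝ) : 0 < Real.exp t + 1 + Real.exp (-t) := by positivity

lemma hasDerivAt_chi3Gen (t : ℝ) : HasDerivAt chi3Gen (-chi3GenDeriv t) t := by
  have h := ((Real.hasDerivAt_exp t).add_const 1).add ((Real.hasDerivAt_exp (-t)).comp t (hasDerivAt_neg t))
  have := h.inv (chi3Gen_denom_pos t).ne'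
  refine HasDerivAt.congr_deriv (this.congr_of_eventuallyEq (Eventually.of_forall fun x => ?_)) ?_
  · simp [chi3Gen]
  · simp [chi3GenDeriv]; ring

/-- The character is written through powers of a cube root of unity `ω`, and `∑ n z^n = z/(1-z)²` is
applied at `ωx` and `ω²x` with `x = exp(-t)`; the denominators combine by `(1-ωx)(1-ω²x) = 1 + x +
x²`. -/
lemma hasSum_chi3GenDeriv {t : ℝ} (ht : 0 < t) : HasSum
    (fun n : ℕ => ((n : ℂ) * chi3 (n : ZMod 3)) * (Real.exp (-(n : ℝ) * t) : ℝ)) (chi3GenDeriv t : ℂ) := by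
  set x : ℂ := ((Real.exp (-t) : ℝ) : ℂ) with hx
  have hxn : ‖x‖ < 1 := by
    rw [hx, Complex.norm_real, Real.norm_of_nonneg (Real.exp_pos _).le, Real.exp_lt_one_iff]; linarith
  have hx0 : x ≠ 0 := by rw [hx]; exact_mod_cast (Real.exp_pos _).ne'
  have hω : ‖cubeRoot‖ = 1 := by
    have := Complex.norm_exp_ofReal_mul_I (2 * Real.pi / 3)
    rw [cubeRoot]; convert this using 3; push_cast; ring
  have h1 := hasSum_coe_mul_geometric_of_norm_lt_one (r := cubeRoot * x) (by rw [norm_mul, hω, one_mul]; exact hxn)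
  have h2 := hasSum_coe_mul_geometric_of_norm_lt_one (r := cubeRoot ^ 2 * x)
    (by rw [norm_mul, norm_pow, hω, one_pow, one_mul]; exact hxn)
  have hd := cubeRoot_sub_sq_ne_zero
  have h3 := cubeRoot_pow_three
  have hsum : 1 + cubeRoot + cubeRoot ^ 2 = 0 := by
    have : (cubeRoot - 1) * (1 + cubeRoot + cubeRoot ^ 2) = 0 := by linear_combination h3
    exact (mul_eq_zero.1 this).resolve_left (sub_ne_zero.2 cubeRoot_ne_one)
  have h := (h1.sub h2).mul_left (cubeRoot - cubeRoot ^ 2)⁻¹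
  have hne : ∀ y : ℂ, ‖y‖ < 1 → 1 - y ≠ 0 := fun y hy h => by
    rw [← sub_eq_zero.1 h, norm_one] at hy; exact lt_irrefl _ hy
  have n1 := hne (cubeRoot * x) (by rw [norm_mul, hω, one_mul]; exact hxn)
  have n2 := hne (cubeRoot ^ 2 * x) (by rw [norm_mul, norm_pow, hω, one_pow, one_mul]; exact hxn)
  have hprod : (1 - cubeRoot * x) * (1 - cubeRoot ^ 2 * x) = 1 + x + x ^ 2 := by
    linear_combination x ^ 2 * h3 - x * hsum
  have hval : (cubeRoot - cubeRoot ^ 2)⁻¹ * (cubeRoot * x / (1 - cubeRoot * x) ^ 2 -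
      cubeRoot ^ 2 * x / (1 - cubeRoot ^ 2 * x) ^ 2) = (chi3GenDeriv t : ℂ) := by
    have e1 : (chi3GenDeriv t : ℂ) = (x - x ^ 3) / (1 + x + x ^ 2) ^ 2 := by
      have he : (Real.exp t : ℂ) = x⁻¹ := by
        rw [hx, Real.exp_neg]; push_cast; rw [inv_inv]
      have hp : 1 + x + x ^ 2 ≠ 0 := hprod ▸ mul_ne_zero n1 n2
      rw [chi3GenDeriv]
      push_cast [-Complex.ofReal_exp]
      rw [he, ← hx]
      have : x⁻¹ + 1 + x = (1 + x + x ^ 2) / x := by field_simp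
      rw [this]
      field_simp
    rw [e1, ← hprod, inv_mul_eq_iff_eq_mul₀ hd, div_sub_div _ _ (pow_ne_zero 2 n1) (pow_ne_zero 2 n2),
      ← mul_pow, mul_div_assoc']
    congr 1
    linear_combination x ^ 3 * (cubeRoot ^ 2 - cubeRoot) * h3
  rw [hval] at h
  refine h.congr_fun fun n => ?_
  have e := cubeRoot_pow_sub n
  have ex : ((Real.exp (-(n : ℝ) * t) : ℝ) : ℂ) = x ^ n := by
    rw [hx, ← Complex.ofReal_pow, ← Real.exp_nat_mul]; congr 2; ring
  rw [ex, mul_pow, mul_pow, eq_inv_mul_iff_mul_eq₀ hd]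
  linear_combination -(n : ℂ) * x ^ n * e

lemma abs_chi3GenDeriv_le {t : ℝ} (ht : 0 < t) : |chi3GenDeriv t| ≤ Real.exp (-t) := by
  have h := chi3Gen_denom_pos t
  have h1 : Real.exp t * Real.exp (-t) = 1 := by rw [← Real.exp_add]; simp
  have h2 := Real.exp_pos t
  have h3 := Real.exp_pos (-t)
  have h4 : Real.exp (-t) < Real.exp t := Real.exp_lt_exp.2 (by linarith)
  rw [chi3GenDeriv, abs_of_nonneg (div_nonneg (by linarith) (by positivity)), div_le_iff₀ (by positivity)]
  generalize Real.exp t = x at *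
  generalize Real.exp (-t) = y at *
  have : y * (x + 1 + y) ^ 2 = x + 2 + 3 * y + 2 * y ^ 2 + y ^ 3 := by
    linear_combination (x + 2 + 2 * y) * h1
  nlinarith [pow_pos h3 3]

lemma continuous_chi3GenDeriv : Continuous chi3GenDeriv := by
  unfold chi3GenDeriv
  exact (by fun_prop : Continuous fun t : ℝ => Real.exp t - Real.exp (-t)).div (by fun_prop)
    fun t => pow_ne_zero 2 (chi3Gen_denom_pos t).ne'

/-- The Mellin transform of `chi3GenDeriv` is `Γ(s) L(χ₃, s-1)`, first for `Re s > 2` and by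
continuation for `Re s > 0`. Using the derivative of the generating function places the wanted value
at `s = 1`, inside the half-plane, where the integral is `chi3Gen 0 = 1/3`. -/
lemma chi3_LFunction_zero : chi3.LFunction 0 = 1 / 3 := by
  have hbig : (fun t => (chi3GenDeriv t : ℂ)) =O[atTop] fun t : ℝ => Real.exp (-1 * t) := by
    refine Asymptotics.IsBigO.of_bound 1 ?_
    filter_upwards [eventually_gt_atTop 0] with t ht
    rw [Complex.norm_real, Real.norm_eq_abs, one_mul, Real.norm_of_nonneg (Real.exp_pos _).le, neg_one_mul]
    exact abs_chi3GenDeriv_le ht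
  have hdiff : ∀ s : ℂ, 0 < s.re → DifferentiableAt ℂ (mellin fun t => (chi3GenDeriv t : ℂ)) s := by
    intro s hs
    refine mellin_differentiableAt_of_isBigO_rpow_exp (b := 0) one_pos ?_ hbig ?_ hs
    · exact (Complex.continuous_ofReal.comp continuous_chi3GenDeriv).continuousOn.locallyIntegrableOn
        measurableSet_Ioi
    · refine Asymptotics.IsBigO.of_bound 1 ?_
      filter_upwards [self_mem_nhdsWithin] with t ht
      rw [Complex.norm_real, Real.norm_eq_abs, neg_zero, Real.rpow_zero, norm_one, one_mul]
      exact (abs_chi3GenDeriv_le ht).trans (Real.exp_le_one_iff.2 (by simpa using (le_of_lt ht)))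
  have hlarge : ∀ s : ℂ, 2 < s.re →
      mellin (fun t => (chi3GenDeriv t : ℂ)) s = Complex.Gamma s * chi3.LFunction (s - 1) := by
    intro s hs
    have hs1 : 1 < (s - 1).re := by simp; linarith
    have hD : LSeriesHasSum (fun n : ℕ => (n : ℂ) * chi3 (n : ZMod 3)) s (chi3.LFunction (s - 1)) := by
      have : LSeriesHasSum (fun n : ℕ => chi3 (n : ZMod 3)) (s - (1 : ℕ)) (chi3.LFunction (s - 1)) := by
        rw [Nat.cast_one, DirichletCharacter.LFunction_eq_LSeries _ hs1]
        exact (ZMod.LSeriesSummable_of_one_lt_re _ hs1).LSeriesHasSum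
      simpa [mul_comm] using this.mul_natCast_pow 1
    have hterm : ∀ n : ℕ, LSeries.term (fun n : ℕ => (n : ℂ) * chi3 (n : ZMod 3)) s n =
        ((n : ℂ) * chi3 (n : ZMod 3)) / (n : ℂ) ^ s := fun n => by
      rcases eq_or_ne n 0 with rfl | hn
      · simp
      · exact LSeries.term_of_ne_zero hn _ _
    have hm := hasSum_mellin (a := fun n : ℕ => (n : ℂ) * chi3 (n : ZMod 3)) (p := fun n : ℕ => (n : ℝ))
      (F := fun t => (chi3GenDeriv t : ℂ)) (s := s) (fun n => by
        rcases eq_or_ne n 0 with rfl | hn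
        · exact Or.inl (by simp)
        · exact Or.inr (by positivity)) (by linarith) (fun t ht => hasSum_chi3GenDeriv ht) (by
        refine hD.summable.norm.congr fun n => ?_
        rw [hterm, norm_div]
        rcases eq_or_ne n 0 with rfl | hn
        · simp
        · rw [Complex.norm_natCast_cpow_of_pos (Nat.pos_of_ne_zero hn)])
    refine hm.unique ((hD.mul_left (Complex.Gamma s)).congr_fun fun n => ?_)
    rw [hterm, mul_div_assoc, Complex.ofReal_natCast]
  have hχ := DirichletCharacter.differentiable_LFunction RationalMukai.chi3_ne_one
  have hopen : IsOpen {s : ℂ | 0 < s.re} := isOpen_lt continuous_const Complex.continuous_re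
  have hconn : IsPreconnected {s : ℂ | 0 < s.re} := (convex_halfSpace_re_gt 0).isPreconnected
  have hEq : Set.EqOn (mellin fun t => (chi3GenDeriv t : ℂ))
      (fun s => Complex.Gamma s * chi3.LFunction (s - 1)) {s : ℂ | 0 < s.re} := by
    refine AnalyticOnNhd.eqOn_of_preconnected_of_eventuallyEq (z₀ := 3)
      (DifferentiableOn.analyticOnNhd (fun z hz => (hdiff z hz).differentiableWithinAt) hopen)
      (DifferentiableOn.analyticOnNhd (fun z hz => ?_) hopen) hconn (by simp) ?_
    · refine DifferentiableAt.differentiableWithinAt ?_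
      refine (Complex.differentiableAt_Gamma z fun m h => ?_).mul
        ((hχ _).comp z (differentiableAt_id.sub_const 1))
      rw [h] at hz
      simp at hz
      linarith [m.cast_nonneg (α := ℝ)]
    · filter_upwards [(isOpen_lt continuous_const Complex.continuous_re).mem_nhds
        (show (2 : ℝ) < (3 : ℂ).re by norm_num)] with z hz
      exact hlarge z hz
  have h1 := hEq (show (1 : ℂ) ∈ {s : ℂ | 0 < s.re} by simp)
  simp only [Complex.Gamma_one, one_mul, sub_self] at h1
  rw [← h1, mellin]
  have hint : MeasureTheory.IntegrableOn (fun t => -chi3GenDeriv t) (Set.Ioi 0) := by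
    refine MeasureTheory.Integrable.mono' (g := fun t => Real.exp (-t))
      (integrableOn_exp_neg_Ioi 0) continuous_chi3GenDeriv.neg.aestronglyMeasurable ?_
    refine (MeasureTheory.ae_restrict_iff' measurableSet_Ioi).2 (Eventually.of_forall fun t ht => ?_)
    rw [norm_neg]
    exact abs_chi3GenDeriv_le ht
  have hlim : Tendsto chi3Gen atTop (𝓝 0) := by
    have : Tendsto (fun t : ℝ => Real.exp (-t)) atTop (𝓝 0) :=
      Real.tendsto_exp_neg_atTop_nhds_zero
    refine squeeze_zero (fun t => (one_div_pos.2 (chi3Gen_denom_pos t)).le) (fun t => ?_) this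
    rw [chi3Gen, Real.exp_neg, one_div]
    exact inv_anti₀ (Real.exp_pos t) (by linarith [inv_pos.2 (Real.exp_pos t)])
  have hI := MeasureTheory.integral_Ioi_of_hasDerivAt_of_tendsto'
    (fun t _ => hasDerivAt_chi3Gen t) hint hlim
  rw [MeasureTheory.integral_neg] at hI
  have h0 : chi3Gen 0 = 1 / 3 := by simp [chi3Gen]; norm_num
  have hI' : ∫ t in Set.Ioi (0 : ℝ), chi3GenDeriv t = 1 / 3 := by linarith
  simp only [sub_self, Complex.cpow_zero, one_smul]
  rw [integral_complex_ofReal, hI']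
  norm_num

namespace RationalMukai

lemma formL_three (V : RationalMukai) : formL V.form 3 = V.aperyConstant := by
  have h := V.hasExplicitL_formL
  have h0 : riemannZeta (3 - 3) = -1 / 2 := by rw [sub_self, riemannZeta_zero]
  have hp : ∀ x : ℂ, x ^ (2 - 3 : ℂ) = x⁻¹ := fun x => by
    rw [show (2 - 3 : ℂ) = -1 by norm_num, Complex.cpow_neg_one]
  cases V with
  | V12 =>
    rw [h 3 (by norm_num) (by norm_num), h0, hp, hp, hp, aperyConstant]
    ring
  | V16 =>
    rw [h 3 (by norm_num) (by norm_num), h0, hp, hp, hp, aperyConstant]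
    ring
  | V18 =>
    rw [h.2 3, sub_self, chi3_LFunction_zero, aperyConstant]
    ring

end RationalMukai

/-! ### Level one: `E₂` and Ramanujan's differential equations -/

open scoped Manifold Derivative
open EisensteinSeries (E2)

/-- A weakly modular function of level one and weight less than twelve that vanishes at infinity is
zero. -/
lemma levelOne_eq_zero_of_tendsto {k : ℕ} (hk : k < 12) {h : ℍ → ℂ} (hd : MDiff h)
    (hS : ∀ z, h (ModularGroup.S • z) = (z : ℂ) ^ k * h z)
    (hT : ∀ z, h (ModularGroup.T • z) = h z) (h0 : Tendsto h atImInfty (𝓝 0)) (z : ℍ) :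
    h z = 0 := by
  have hS' : h ∣[(k : ℤ)] ModularGroup.S = h := by
    ext z
    have := z.ne_zero
    rw [SL_slash_apply, hS, ModularGroup.denom_S, zpow_neg, zpow_natCast]
    field_simp
  have hT' : h ∣[(k : ℤ)] ModularGroup.T = h := by
    ext z
    rw [SL_slash_apply, hT, denom, coe_SL2Z_matrix]
    simp [ModularGroup.T]
  have hinv := SlashInvariantForm.slash_action_generators_SL2Z hS' hT'
  let f : CuspForm 𝒮ℒ (k : ℤ) :=
    { toFun := h
      slash_action_eq' := by
        rintro _ ⟨A, rfl⟩
        exact hinv A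
      holo' := hd
      zero_at_cusps' := fun hc => by
        rw [Subgroup.IsArithmetic.isCusp_iff_isCusp_SL2Z] at hc
        rw [OnePoint.isZeroAt_iff_forall_SL2Z hc]
        intro γ _
        rw [hinv]
        exact h0 }
  -- Division by the discriminant gives a form of negative weight `k - 12`.
  have hz : CuspForm.discriminantEquiv f = 0 :=
    rank_zero_iff_forall_zero.mp (levelOne_neg_weight_rank_zero (by lia)) _
  have hf : f = 0 := by simpa using hz
  exact DFunLike.congr_fun hf z

/-- Subtracting the constant term and dividing by `q` gives a series of the same shape, so one step
applied twice reads off the first two coefficients. -/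
lemma tendsto_of_hasSum_qParam {h : ℝ} (hh : 0 < h) {f : ℍ → ℂ} {c : ℕ → ℂ}
    (hf : ∀ τ : ℍ, HasSum (fun m => c m • Function.Periodic.qParam h τ ^ m) (f τ)) :
    Tendsto f atImInfty (𝓝 (c 0)) ∧
      Tendsto (fun τ : ℍ => (f τ - c 0) / Function.Periodic.qParam h τ) atImInfty (𝓝 (c 1)) := by
  have step : ∀ {f : ℍ → ℂ} {c : ℕ → ℂ},
      (∀ τ : ℍ, HasSum (fun m => c m • Function.Periodic.qParam h τ ^ m) (f τ)) →
      (∀ τ : ℍ, HasSum (fun m => c (m + 1) • Function.Periodic.qParam h τ ^ m)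
        ((f τ - c 0) / Function.Periodic.qParam h τ)) ∧ Tendsto f atImInfty (𝓝 (c 0)) := by
    intro f c hf
    have hq : ∀ τ : ℍ, Function.Periodic.qParam h τ ≠ 0 := fun τ =>
      Function.Periodic.qParam_ne_zero _
    have h1 : ∀ τ : ℍ, HasSum (fun m => c (m + 1) • Function.Periodic.qParam h τ ^ m)
        ((f τ - c 0) / Function.Periodic.qParam h τ) := by
      intro τ
      have := ((hasSum_nat_add_iff' 1).2 (hf τ)).div_const (Function.Periodic.qParam h τ)
      simp only [Finset.range_one, Finset.sum_singleton, pow_zero, smul_eq_mul, mul_one] at this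
      refine this.congr_fun fun m => ?_
      rw [smul_eq_mul, pow_succ]
      field_simp [hq τ]
    refine ⟨h1, ?_⟩
    have hb : (fun τ : ℍ => (f τ - c 0) / Function.Periodic.qParam h τ) =O[atImInfty]
        (fun _ => (1 : ℝ)) := isBoundedAtImInfty_of_hasSum_qExpansion hh h1
    have h2 := ((Asymptotics.isLittleO_one_iff ℝ).2
      (UpperHalfPlane.qParam_tendsto_atImInfty hh)).mul_isBigO hb
    have h3 : Tendsto (fun τ => f τ - c 0) atImInfty (𝓝 0) := by
      rw [mul_one, Asymptotics.isLittleO_one_iff] at h2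
      refine h2.congr fun τ => ?_
      field_simp [hq τ]
    simpa using h3.add_const (c 0)
  obtain ⟨h1, h2⟩ := step hf
  exact ⟨h2, (step h1).2⟩

lemma tendsto_E2_atImInfty : Tendsto E2 atImInfty (𝓝 1) ∧
    Tendsto (fun τ : ℍ => (E2 τ - 1) / Function.Periodic.qParam 1 τ) atImInfty (𝓝 (-24)) := by
  have := tendsto_of_hasSum_qParam (f := E2)
    (c := fun m : ℕ => if m = 0 then 1 else -24 * (σ 1 m : ℂ)) one_pos (fun τ => by
    simpa only [Function.Periodic.qParam, Complex.ofReal_one, div_one] using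
      EisensteinSeries.hasSum_qExpansion_E2 (z := τ))
  simpa using this

lemma E2_moebius (a b c d : ℤ) (h : a * d - b * c = 1) {w z : ℍ}
    (hw : (w : ℂ) * (c * z + d) = a * z + b) :
    E2 w = (c * (z : ℂ) + d) ^ 2 * E2 z - 6 * Complex.I / Real.pi * c * (c * z + d) := by
  let γ : SL(2, ℤ) := ⟨!![a, b; c, d], by rw [Matrix.det_fin_two_of, h]⟩
  have hd : denom (γ : GL (Fin 2) ℝ) z = c * (z : ℂ) + d := by
    rw [denom, coe_SL2Z_matrix]
    simp [γ]
  have hd0 : c * (z : ℂ) + d ≠ 0 := hd ▸ denom_ne_zero _ z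
  have hwz : γ • z = w := by
    apply UpperHalfPlane.ext
    rw [eq_div_of_mul_eq hd0 hw, UpperHalfPlane.specialLinearGroup_apply]
    simp [γ]
  have := congrFun (EisensteinSeries.E2_slash_action γ) z
  have hc : γ 1 0 = c := rfl
  simp only [SL_slash_apply, hwz, hd, Pi.sub_apply, Pi.smul_apply, EisensteinSeries.D2, hc,
    riemannZeta_two, zpow_neg, smul_eq_mul] at this
  have hpi : (Real.pi : ℂ) ≠ 0 := by exact_mod_cast Real.pi_ne_zero
  field_simp at this ⊢
  linear_combination this

/-- Cauchy's estimate on the disc of radius `Im z / 2` bounds the derivative by a multiple of `1 /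
Im z`. -/
lemma tendsto_normalizedDeriv_atImInfty {F : ℍ → ℂ} (hF : MDiff F) (hb : IsBoundedAtImInfty F) :
    Tendsto (D F) atImInfty (𝓝 0) := by
  obtain ⟨M, A, hM⟩ := isBoundedAtImInfty_iff.1 hb
  have hev : ∀ᶠ z : ℍ in atImInfty, 2 * A ≤ z.im := tendsto_comap.eventually_ge_atTop _
  have hlim : Tendsto (fun z : ℍ => ‖((2 * Real.pi * Complex.I : ℂ))⁻¹‖ * (M / (z.im / 2)))
      atImInfty (𝓝 0) := by
    rw [← mul_zero ‖((2 * Real.pi * Complex.I : ℂ))⁻¹‖]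
    exact ((tendsto_comap.atTop_div_const two_pos).const_div_atTop M).const_mul _
  refine squeeze_zero_norm' ?_ hlim
  filter_upwards [hev] with z hz
  rw [Derivative.normalizedDerivOfComplex, norm_mul]
  refine mul_le_mul_of_nonneg_left ?_ (norm_nonneg _)
  have hr : 0 < z.im / 2 := half_pos z.im_pos
  have him : ∀ w ∈ Metric.closedBall (z : ℂ) (z.im / 2), z.im / 2 ≤ w.im := by
    intro w hw
    rw [Metric.mem_closedBall, dist_comm, dist_eq_norm] at hw
    have := (le_abs_self _).trans ((Complex.abs_im_le_norm ((z : ℂ) - w)).trans hw)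
    rw [Complex.sub_im, coe_im] at this
    linarith
  have hd : DifferentiableOn ℂ (F ∘ ofComplex) (Metric.closedBall (z : ℂ) (z.im / 2)) :=
    (UpperHalfPlane.mdifferentiable_iff.1 hF).mono fun w hw => hr.trans_le (him w hw)
  refine Complex.norm_deriv_le_of_forall_mem_sphere_norm_le hr
    (hd.diffContOnCl_ball subset_rfl) fun w hw => ?_
  have hw' := him w (Metric.sphere_subset_closedBall hw)
  rw [Function.comp_apply]
  refine hM _ ?_
  rw [ofComplex_apply_of_im_pos (hr.trans_le hw')]
  exact le_trans (by linarith) hw'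

lemma mdifferentiable_comp_affinePoint {F : ℍ → ℂ} (hF : MDiff F) (x y : ℝ) (hx : 0 < x) :
    MDiff (fun z => F (affinePoint x y hx z)) := by
  rw [UpperHalfPlane.mdifferentiable_iff] at hF ⊢
  have h : DifferentiableOn ℂ (fun w : ℂ => (F ∘ ofComplex) (x * w + y)) {z | 0 < z.im} := by
    refine hF.comp (by fun_prop) fun w hw => ?_
    simpa using mul_pos hx hw
  refine h.congr fun w hw => ?_
  have hw' : 0 < ((x : ℂ) * w + y).im := by simpa using mul_pos hx hw
  simp only [Function.comp_apply, ofComplex_apply_of_im_pos hw, ofComplex_apply_of_im_pos hw']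
  rfl

lemma normalizedDeriv_comp_affinePoint {F : ℍ → ℂ} (hF : MDiff F) (x y : ℝ) (hx : 0 < x) (z : ℍ) :
    D (fun z => F (affinePoint x y hx z)) z = x * D F (affinePoint x y hx z) := by
  have h1 : HasDerivAt (F ∘ ofComplex) (deriv (F ∘ ofComplex) (affinePoint x y hx z))
      (x * (z : ℂ) + y) :=
    (UpperHalfPlane.mdifferentiableAt_iff.1 (hF (affinePoint x y hx z))).hasDerivAt
  have h2 : HasDerivAt (fun w : ℂ => (x : ℂ) * w + y) x (z : ℂ) := by
    simpa using ((hasDerivAt_id (z : ℂ)).const_mul (x : ℂ)).add_const (y : ℂ)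
  have h3 := h1.comp (z : ℂ) h2
  have h4 : (fun z => F (affinePoint x y hx z)) ∘ ofComplex =ᶠ[𝓝 (z : ℂ)]
      (F ∘ ofComplex) ∘ fun w : ℂ => (x : ℂ) * w + y := by
    filter_upwards [isOpen_upperHalfPlaneSet.mem_nhds z.im_pos] with w hw
    have hw' : 0 < ((x : ℂ) * w + y).im := by simpa using mul_pos hx hw
    simp only [Function.comp_apply, ofComplex_apply_of_im_pos hw, ofComplex_apply_of_im_pos hw']
    rfl
  rw [Derivative.normalizedDerivOfComplex, Derivative.normalizedDerivOfComplex,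
    (h3.congr_of_eventuallyEq h4).deriv]
  ring

lemma hasDerivAt_comp_ofComplex {F : ℍ → ℂ} (hF : MDiff F) (z : ℍ) :
    HasDerivAt (F ∘ ofComplex) (2 * Real.pi * Complex.I * D F z) (z : ℂ) := by
  have h := (UpperHalfPlane.mdifferentiableAt_iff.1 (hF z)).hasDerivAt
  rwa [Derivative.normalizedDerivOfComplex, mul_inv_cancel_left₀ Complex.two_pi_I_ne_zero]

/-- The extra term `b z^m` accommodates the quasimodular `E₂`; modular forms have `b = 0`. -/
lemma normalizedDeriv_S_smul {F : ℍ → ℂ} (hF : MDiff F) {k m : ℕ} {b : ℂ}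
    (h : ∀ z, F (ModularGroup.S • z) = (z : ℂ) ^ k * F z + b * (z : ℂ) ^ m) (z : ℍ) :
    D F (ModularGroup.S • z) = (z : ℂ) ^ 2 * ((z : ℂ) ^ k * D F z +
      (k * (z : ℂ) ^ (k - 1) * F z + b * (m * (z : ℂ) ^ (m - 1))) / (2 * Real.pi * Complex.I)) := by
  have hz := z.ne_zero
  have hS : ∀ w : ℍ, ((ModularGroup.S • w : ℍ) : ℂ) = -(w : ℂ)⁻¹ := fun w => by
    rw [modular_S_smul, coe_mk, inv_neg]
  have h1 := hasDerivAt_comp_ofComplex hF (ModularGroup.S • z)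
  rw [hS z] at h1
  have h2 : HasDerivAt (fun w : ℂ => -w⁻¹) (((z : ℂ) ^ 2)⁻¹) (z : ℂ) := by
    simpa using (hasDerivAt_inv hz).fun_neg
  have h3 := h1.comp (z : ℂ) h2
  have h4 := (((hasDerivAt_pow k (z : ℂ)).mul (hasDerivAt_comp_ofComplex hF z)).add
    ((hasDerivAt_pow m (z : ℂ)).const_mul b))
  have h5 : (F ∘ ofComplex) ∘ (fun w : ℂ => -w⁻¹) =ᶠ[𝓝 (z : ℂ)]
      (fun w : ℂ => w ^ k * (F ∘ ofComplex) w + b * w ^ m) := by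
    filter_upwards [isOpen_upperHalfPlaneSet.mem_nhds z.im_pos] with w hw
    have e := h ⟨w, hw⟩
    have e2 : ofComplex (-w⁻¹) = ModularGroup.S • (⟨w, hw⟩ : ℍ) := by
      rw [← ofComplex_apply (ModularGroup.S • (⟨w, hw⟩ : ℍ)), hS]
    simp only [Function.comp_apply, e2, e, ofComplex_apply_of_im_pos hw]
  have h6 := h3.unique (h4.congr_of_eventuallyEq h5)
  simp only [Function.comp_apply, ofComplex_apply] at h6
  have hpi : (Real.pi : ℂ) ≠ 0 := by exact_mod_cast Real.pi_ne_zero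
  have hI := Complex.I_ne_zero
  field_simp at h6 ⊢
  linear_combination h6

lemma T_smul_eq_affinePoint (z : ℍ) : ModularGroup.T • z = affinePoint 1 1 one_pos z := by
  rw [modular_T_smul]
  ext
  simp [add_comm]

lemma normalizedDeriv_T_smul {F : ℍ → ℂ} (hF : MDiff F)
    (h : ∀ z, F (ModularGroup.T • z) = F z) (z : ℍ) : D F (ModularGroup.T • z) = D F z := by
  have h1 := normalizedDeriv_comp_affinePoint hF 1 1 one_pos z
  simp only [← T_smul_eq_affinePoint, h] at h1
  rw [h1]
  simp

lemma levelOne_S_smul {k : ℕ} (f : ModularForm 𝒮ℒ k) (z : ℍ) :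
    f (ModularGroup.S • z) = (z : ℂ) ^ k * f z := by
  have hz := z.ne_zero
  have := levelOne_moebius f 0 (-1) 1 0 (by norm_num) (w := ModularGroup.S • z) (z := z) (by
    rw [modular_S_smul, coe_mk, inv_neg]
    push_cast
    field_simp
    ring)
  rw [this]
  simp

lemma levelOne_T_smul {k : ℤ} (f : ModularForm 𝒮ℒ k) (z : ℍ) :
    f (ModularGroup.T • z) = f z := by
  have := levelOne_moebius f 1 1 0 1 (by norm_num) (w := ModularGroup.T • z) (z := z) (by
    rw [T_smul_eq_affinePoint]
    simp)
  rw [this]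
  simp

lemma E2_S_smul (z : ℍ) : E2 (ModularGroup.S • z) =
    (z : ℂ) ^ 2 * E2 z + -(6 * Complex.I / Real.pi) * (z : ℂ) ^ 1 := by
  have hz := z.ne_zero
  have := E2_moebius 0 (-1) 1 0 (by norm_num) (w := ModularGroup.S • z) (z := z) (by
    rw [modular_S_smul, coe_mk, inv_neg]
    push_cast
    field_simp
    ring)
  rw [this]
  push_cast
  ring

lemma E2_add_one {w z : ℍ} (h : (w : ℂ) = z + 1) : E2 w = E2 z := by
  rw [E2_moebius 1 1 0 1 (by norm_num) (w := w) (z := z) (by simp [h])]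
  simp

lemma E2_T_smul (z : ℍ) : E2 (ModularGroup.T • z) = E2 z :=
  E2_add_one (by rw [T_smul_eq_affinePoint]; simp)

lemma tendsto_levelOne_atImInfty {k : ℤ} (f : ModularForm 𝒮ℒ k) :
    Tendsto f atImInfty (𝓝 ((qExpansion 1 f).coeff 0)) :=
  (tendsto_of_hasSum_qParam one_pos fun τ =>
    ModularForm.hasSum_qExpansion f one_pos one_mem_strictPeriods_SL τ).1

lemma tendsto_E4_atImInfty : Tendsto E₄ atImInfty (𝓝 1) := by
  have := tendsto_levelOne_atImInfty E₄
  rwa [EisensteinSeries.E_qExpansion_coeff_zero _ ⟨2, rfl⟩] at this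

lemma tendsto_E6_atImInfty : Tendsto E₆ atImInfty (𝓝 1) := by
  have := tendsto_levelOne_atImInfty E₆
  rwa [EisensteinSeries.E_qExpansion_coeff_zero _ ⟨3, rfl⟩] at this

lemma mdifferentiable_E2 : MDiff E2 := E2_mdifferentiable

/-- Ramanujan's formula for the derivative of `E₂`. -/
lemma normalizedDeriv_E2 (z : ℍ) : D E2 z = (E2 z ^ 2 - E₄ z) / 12 := by
  have h2 := mdifferentiable_E2
  have h := levelOne_eq_zero_of_tendsto (k := 4) (by norm_num)
    (h := fun z => D E2 z - (1 / 12) * (E2 z * E2 z) + (1 / 12) * E₄ z)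
    (((Derivative.normalizedDerivOfComplex_mdifferentiable h2).sub
      (mdifferentiable_const.mul (h2.mul h2))).add (mdifferentiable_const.mul E₄.holo'))
    (fun z => by
      have hpi : (Real.pi : ℂ) ≠ 0 := by exact_mod_cast Real.pi_ne_zero
      have hI := Complex.I_ne_zero
      have hI2 := Complex.I_sq
      rw [normalizedDeriv_S_smul h2 E2_S_smul, E2_S_smul, levelOne_S_smul (k := 4) E₄]
      push_cast
      field_simp
      linear_combination (24 * Real.pi * (z : ℂ) ^ 3 * E2 z - 72 * Complex.I * (z : ℂ) ^ 2) * hI2)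
    (fun z => by
      rw [normalizedDeriv_T_smul h2 E2_T_smul, E2_T_smul, levelOne_T_smul])
    (by
      have t1 := tendsto_normalizedDeriv_atImInfty h2 EisensteinSeries.isBoundedAtImInfty_E2
      have t2 := tendsto_E2_atImInfty.1
      have := (t1.sub ((t2.mul t2).const_mul (1 / 12))).add (tendsto_E4_atImInfty.const_mul (1 / 12))
      convert this using 2
      norm_num) z
  linear_combination h

lemma normalizedDeriv_E4 (z : ℍ) : D E₄ z = (E2 z * E₄ z - E₆ z) / 3 := by
  have h2 := mdifferentiable_E2
  have h4 : MDiff E₄ := E₄.holo'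
  have h := levelOne_eq_zero_of_tendsto (k := 6) (by norm_num)
    (h := fun z => D E₄ z - (1 / 3) * (E2 z * E₄ z) + (1 / 3) * E₆ z)
    (((Derivative.normalizedDerivOfComplex_mdifferentiable h4).sub
      (mdifferentiable_const.mul (h2.mul h4))).add (mdifferentiable_const.mul E₆.holo'))
    (fun z => by
      have hpi : (Real.pi : ℂ) ≠ 0 := by exact_mod_cast Real.pi_ne_zero
      have hI := Complex.I_ne_zero
      have hI2 := Complex.I_sq
      rw [normalizedDeriv_S_smul (k := 4) (m := 0) (b := 0) h4
        (fun z => by simpa using levelOne_S_smul (k := 4) E₄ z), E2_S_smul,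
        levelOne_S_smul (k := 4) E₄, levelOne_S_smul (k := 6) E₆]
      push_cast
      field_simp
      linear_combination (12 * (z : ℂ) ^ 5 * E₄ z) * hI2)
    (fun z => by
      rw [normalizedDeriv_T_smul h4 (levelOne_T_smul _), E2_T_smul, levelOne_T_smul,
        levelOne_T_smul])
    (by
      have t1 := tendsto_normalizedDeriv_atImInfty h4 (tendsto_E4_atImInfty.isBigO_one ℝ)
      have := (t1.sub ((tendsto_E2_atImInfty.1.mul tendsto_E4_atImInfty).const_mul (1 / 3))).add
        (tendsto_E6_atImInfty.const_mul (1 / 3))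
      convert this using 2
      norm_num) z
  linear_combination h

lemma normalizedDeriv_E6 (z : ℍ) : D E₆ z = (E2 z * E₆ z - E₄ z ^ 2) / 2 := by
  have h2 := mdifferentiable_E2
  have h4 : MDiff E₄ := E₄.holo'
  have h6 : MDiff E₆ := E₆.holo'
  have h := levelOne_eq_zero_of_tendsto (k := 8) (by norm_num)
    (h := fun z => D E₆ z - (1 / 2) * (E2 z * E₆ z) + (1 / 2) * (E₄ z * E₄ z))
    (((Derivative.normalizedDerivOfComplex_mdifferentiable h6).sub
      (mdifferentiable_const.mul (h2.mul h6))).add (mdifferentiable_const.mul (h4.mul h4)))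
    (fun z => by
      have hpi : (Real.pi : ℂ) ≠ 0 := by exact_mod_cast Real.pi_ne_zero
      have hI := Complex.I_ne_zero
      have hI2 := Complex.I_sq
      rw [normalizedDeriv_S_smul (k := 6) (m := 0) (b := 0) h6
        (fun z => by simpa using levelOne_S_smul (k := 6) E₆ z), E2_S_smul,
        levelOne_S_smul (k := 4) E₄, levelOne_S_smul (k := 6) E₆]
      push_cast
      field_simp
      linear_combination (6 * (z : ℂ) ^ 7 * E₆ z) * hI2)
    (fun z => by
      rw [normalizedDeriv_T_smul h6 (levelOne_T_smul _), E2_T_smul, levelOne_T_smul,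
        levelOne_T_smul])
    (by
      have t1 := tendsto_normalizedDeriv_atImInfty h6 (tendsto_E6_atImInfty.isBigO_one ℝ)
      have := (t1.sub ((tendsto_E2_atImInfty.1.mul tendsto_E6_atImInfty).const_mul (1 / 2))).add
        ((tendsto_E4_atImInfty.mul tendsto_E4_atImInfty).const_mul (1 / 2))
      convert this using 2
      norm_num) z
  linear_combination h

/-! ### Level three forms, their algebraic relation and their derivatives -/

namespace LevelThree

/-- `3 E₂(3 z) - E₂(z)`. -/
noncomputable def rootInf (z : ℍ) : ℂ := 3 * E2 (affinePoint 3 0 three_pos z) - E2 z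

/-- `E₂((z + j) / 3) / 3 - E₂(z)`. -/
noncomputable def root (j : ℕ) (z : ℍ) : ℂ :=
  1 / 3 * E2 (affinePoint (1 / 3) (j / 3) (by norm_num) z) - E2 z

lemma mdifferentiable_rootInf : MDiff rootInf :=
  (mdifferentiable_const.mul (mdifferentiable_comp_affinePoint mdifferentiable_E2 _ _ _)).sub
    mdifferentiable_E2

lemma mdifferentiable_root (j : ℕ) : MDiff (root j) :=
  (mdifferentiable_const.mul (mdifferentiable_comp_affinePoint mdifferentiable_E2 _ _ _)).sub
    mdifferentiable_E2

/-- The quasimodular part of `E₂` cancels in each root, so the modular group permutes the four roots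
with weight 2, like the points of the projective line over `𝔽₃`: `T` fixes `rootInf` and cycles the
others, `S` exchanges `∞` with 0 and 1 with 2. -/
lemma rootInf_T_smul (z : ℍ) : rootInf (ModularGroup.T • z) = rootInf z := by
  have e := E2_moebius 1 3 0 1 (by norm_num)
    (w := affinePoint 3 0 three_pos (ModularGroup.T • z)) (z := affinePoint 3 0 three_pos z) (by
      rw [T_smul_eq_affinePoint]
      simp only [coe_affinePoint]
      push_cast
      ring)
  rw [rootInf, rootInf, e, E2_T_smul]
  simp

lemma root_T_smul (j : ℕ) (z : ℍ) : root j (ModularGroup.T • z) = root (j + 1) z := by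
  rw [root, root, E2_T_smul]
  congr 3
  ext
  rw [T_smul_eq_affinePoint]
  simp only [coe_affinePoint]
  push_cast
  ring

lemma root_three (z : ℍ) : root 3 z = root 0 z := by
  rw [root, root, E2_add_one (z := affinePoint (1 / 3) ((0 : ℕ) / 3) (by norm_num) z)]
  simp only [coe_affinePoint]
  push_cast
  ring

lemma coe_S_smul (z : ℍ) : ((ModularGroup.S • z : ℍ) : ℂ) = -1 / z := by
  rw [modular_S_smul, coe_mk, inv_neg, neg_div, one_div]

lemma rootInf_S_smul (z : ℍ) : rootInf (ModularGroup.S • z) = (z : ℂ) ^ 2 * root 0 z := by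
  have hz := z.ne_zero
  have e := E2_moebius 0 (-1) 1 0 (by norm_num)
    (w := affinePoint 3 0 three_pos (ModularGroup.S • z))
    (z := affinePoint (1 / 3) ((0 : ℕ) / 3) (by norm_num) z) (by
      simp only [coe_affinePoint, coe_S_smul]
      push_cast
      field_simp
      ring)
  rw [rootInf, root, e, E2_S_smul]
  simp only [coe_affinePoint]
  push_cast
  ring

lemma root_zero_S_smul (z : ℍ) : root 0 (ModularGroup.S • z) = (z : ℂ) ^ 2 * rootInf z := by
  have hz := z.ne_zero
  have e := E2_moebius 0 (-1) 1 0 (by norm_num)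
    (w := affinePoint (1 / 3) ((0 : ℕ) / 3) (by norm_num) (ModularGroup.S • z))
    (z := affinePoint 3 0 three_pos z) (by
      simp only [coe_affinePoint, coe_S_smul]
      push_cast
      field_simp
      ring)
  rw [rootInf, root, e, E2_S_smul]
  simp only [coe_affinePoint]
  push_cast
  ring

lemma root_one_S_smul (z : ℍ) : root 1 (ModularGroup.S • z) = (z : ℂ) ^ 2 * root 2 z := by
  have hz := z.ne_zero
  have e := E2_moebius 1 (-1) 3 (-2) (by norm_num)
    (w := affinePoint (1 / 3) ((1 : ℕ) / 3) (by norm_num) (ModularGroup.S • z))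
    (z := affinePoint (1 / 3) ((2 : ℕ) / 3) (by norm_num) z) (by
      simp only [coe_affinePoint, coe_S_smul]
      push_cast
      field_simp
      ring)
  rw [root, root, e, E2_S_smul]
  simp only [coe_affinePoint]
  push_cast
  ring

lemma root_two_S_smul (z : ℍ) : root 2 (ModularGroup.S • z) = (z : ℂ) ^ 2 * root 1 z := by
  have hz := z.ne_zero
  have e := E2_moebius 2 (-1) 3 (-1) (by norm_num)
    (w := affinePoint (1 / 3) ((2 : ℕ) / 3) (by norm_num) (ModularGroup.S • z))
    (z := affinePoint (1 / 3) ((1 : ℕ) / 3) (by norm_num) z) (by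
      simp only [coe_affinePoint, coe_S_smul]
      push_cast
      field_simp
      ring)
  rw [root, root, e, E2_S_smul]
  simp only [coe_affinePoint]
  push_cast
  ring

lemma tendsto_rootInf : Tendsto rootInf atImInfty (𝓝 2) := by
  have h := ((tendsto_E2_atImInfty.1.comp
    (RationalMukai.tendsto_affinePoint_atImInfty 3 0 three_pos)).const_mul 3).sub tendsto_E2_atImInfty.1
  convert h using 2
  · rfl
  · norm_num

lemma tendsto_root (j : ℕ) : Tendsto (root j) atImInfty (𝓝 (-2 / 3)) := by
  have h := ((tendsto_E2_atImInfty.1.comp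
    (RationalMukai.tendsto_affinePoint_atImInfty (1 / 3) (j / 3) (by norm_num))).const_mul (1 / 3)).sub
      tendsto_E2_atImInfty.1
  convert h using 2
  · rfl
  · norm_num

/-- The power sums of the four roots are modular forms of level one. -/
lemma powerSum_eq {p : ℕ} (hp : p < 6) {E : ℍ → ℂ} (hE : MDiff E)
    (hES : ∀ z, E (ModularGroup.S • z) = (z : ℂ) ^ (2 * p) * E z)
    (hET : ∀ z, E (ModularGroup.T • z) = E z)
    (hlim : Tendsto E atImInfty (𝓝 (2 ^ p + 3 * (-2 / 3) ^ p))) (z : ℍ) :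
    rootInf z ^ p + root 0 z ^ p + root 1 z ^ p + root 2 z ^ p = E z := by
  have h := levelOne_eq_zero_of_tendsto (k := 2 * p) (by lia)
    (h := fun z => rootInf z ^ p + root 0 z ^ p + root 1 z ^ p + root 2 z ^ p - E z)
    ((((((mdifferentiable_rootInf.pow p).add ((mdifferentiable_root 0).pow p)).add
      ((mdifferentiable_root 1).pow p)).add ((mdifferentiable_root 2).pow p))).sub hE)
    (fun z => by
      rw [rootInf_S_smul, root_zero_S_smul, root_one_S_smul, root_two_S_smul, hES]
      ring)
    (fun z => by
      rw [rootInf_T_smul, root_T_smul, root_T_smul, root_T_smul, root_three, hET]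
      ring)
    (by
      have := (((((tendsto_rootInf.pow p).add ((tendsto_root 0).pow p)).add
        ((tendsto_root 1).pow p)).add ((tendsto_root 2).pow p))).sub hlim
      convert this using 2
      ring) z
  linear_combination h

/-- Here and in the next three lemmas the scalar is the constant term `2^p + 3(-2/3)^p`; in weight
below 12 it identifies the form. -/
lemma sum_roots (z : ℍ) : rootInf z + root 0 z + root 1 z + root 2 z = 0 := by
  have := powerSum_eq (p := 1) (by norm_num) (E := fun _ => 0) mdifferentiable_const
    (fun z => by simp) (fun z => rfl) (by norm_num) z
  simpa using this

lemma sum_roots_sq (z : ℍ) :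
    rootInf z ^ 2 + root 0 z ^ 2 + root 1 z ^ 2 + root 2 z ^ 2 = 16 / 3 * E₄ z := by
  refine powerSum_eq (p := 2) (by norm_num) (E := fun z => 16 / 3 * E₄ z)
    (mdifferentiable_const.mul E₄.holo') (fun z => ?_) (fun z => ?_) ?_ z
  · rw [levelOne_S_smul (k := 4) E₄]; ring
  · rw [levelOne_T_smul]
  · convert tendsto_E4_atImInfty.const_mul (16 / 3) using 2
    norm_num

lemma sum_roots_cube (z : ℍ) :
    rootInf z ^ 3 + root 0 z ^ 3 + root 1 z ^ 3 + root 2 z ^ 3 = 64 / 9 * E₆ z := by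
  refine powerSum_eq (p := 3) (by norm_num) (E := fun z => 64 / 9 * E₆ z)
    (mdifferentiable_const.mul E₆.holo') (fun z => ?_) (fun z => ?_) ?_ z
  · rw [levelOne_S_smul (k := 6) E₆]; ring
  · rw [levelOne_T_smul]
  · convert tendsto_E6_atImInfty.const_mul (64 / 9) using 2
    norm_num

lemma sum_roots_pow_four (z : ℍ) : rootInf z ^ 4 + root 0 z ^ 4 + root 1 z ^ 4 + root 2 z ^ 4 =
    448 / 27 * (E₄ z * E₄ z) := by
  refine powerSum_eq (p := 4) (by norm_num) (E := fun z => 448 / 27 * (E₄ z * E₄ z))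
    (mdifferentiable_const.mul (E₄.holo'.mul E₄.holo')) (fun z => ?_) (fun z => ?_) ?_ z
  · rw [levelOne_S_smul (k := 4) E₄]; ring
  · rw [levelOne_T_smul]
  · convert (tendsto_E4_atImInfty.mul tendsto_E4_atImInfty).const_mul (448 / 27) using 2
    norm_num

lemma cubeRoot_sub_sq_sq : (cubeRoot - cubeRoot ^ 2) ^ 2 = -3 := by
  have h : cubeRoot ^ 2 + cubeRoot + 1 = 0 := by
    apply mul_left_cancel₀ (sub_ne_zero.2 cubeRoot_ne_one)
    linear_combination cubeRoot_pow_three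
  linear_combination (cubeRoot ^ 2 - 3 * cubeRoot + 3) * h

/-- A weight two form of level three, with constant term one. -/
noncomputable def formF (z : ℍ) : ℂ := 3 / 8 * (rootInf z - root 0 z)

/-- The weight two form of level three with coefficients `χ₃(n) σ₁(n)`. -/
noncomputable def formG (z : ℍ) : ℂ :=
  1 / (8 * (cubeRoot - cubeRoot ^ 2)) * (root 2 z - root 1 z)

/-- The weight two form of level three that is odd under the inversion. -/
noncomputable def formS (z : ℍ) : ℂ := 3 / 4 * (rootInf z + root 0 z)

lemma mdifferentiable_formF : MDiff formF :=
  mdifferentiable_const.mul (mdifferentiable_rootInf.sub (mdifferentiable_root 0))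

lemma mdifferentiable_formG : MDiff formG :=
  mdifferentiable_const.mul ((mdifferentiable_root 2).sub (mdifferentiable_root 1))

lemma mdifferentiable_formS : MDiff formS :=
  mdifferentiable_const.mul (mdifferentiable_rootInf.add (mdifferentiable_root 0))

lemma formF_S_smul (z : ℍ) : formF (ModularGroup.S • z) = -(z : ℂ) ^ 2 * formF z := by
  rw [formF, formF, rootInf_S_smul, root_zero_S_smul]; ring

lemma formG_S_smul (z : ℍ) : formG (ModularGroup.S • z) = -(z : ℂ) ^ 2 * formG z := by
  rw [formG, formG, root_one_S_smul, root_two_S_smul]; ring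

lemma formS_S_smul (z : ℍ) : formS (ModularGroup.S • z) = (z : ℂ) ^ 2 * formS z := by
  rw [formS, formS, rootInf_S_smul, root_zero_S_smul]; ring

lemma rootInf_eq (z : ℍ) : rootInf z = 2 / 3 * formS z + 4 / 3 * formF z := by
  rw [formS, formF]; ring

lemma root_zero_eq (z : ℍ) : root 0 z = 2 / 3 * formS z - 4 / 3 * formF z := by
  rw [formS, formF]; ring

lemma root_two_sub_root_one (z : ℍ) :
    root 2 z - root 1 z = 8 * (cubeRoot - cubeRoot ^ 2) * formG z := by
  have := cubeRoot_sub_sq_ne_zero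
  rw [formG, ← mul_assoc, mul_one_div_cancel (mul_ne_zero (by norm_num) this), one_mul]

lemma root_one_eq (z : ℍ) :
    root 1 z = -2 / 3 * formS z - 4 * (cubeRoot - cubeRoot ^ 2) * formG z := by
  linear_combination 1 / 2 * sum_roots z - 1 / 2 * rootInf_eq z - 1 / 2 * root_zero_eq z
    - 1 / 2 * root_two_sub_root_one z

lemma root_two_eq (z : ℍ) :
    root 2 z = -2 / 3 * formS z + 4 * (cubeRoot - cubeRoot ^ 2) * formG z := by
  linear_combination root_one_eq z + root_two_sub_root_one z

lemma E4_eq (z : ℍ) : 3 * E₄ z = formS z ^ 2 + 2 * formF z ^ 2 - 54 * formG z ^ 2 := by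
  have h := sum_roots_sq z
  rw [rootInf_eq, root_zero_eq, root_one_eq, root_two_eq] at h
  linear_combination -9 / 16 * h + 18 * formG z ^ 2 * cubeRoot_sub_sq_sq

lemma E6_eq (z : ℍ) : E₆ z = formS z * (formF z ^ 2 + 27 * formG z ^ 2) := by
  have h := sum_roots_cube z
  rw [rootInf_eq, root_zero_eq, root_one_eq, root_two_eq] at h
  linear_combination -9 / 64 * h - 9 * formS z * formG z ^ 2 * cubeRoot_sub_sq_sq

/-- As the roots sum to zero, they are combinations of `formF`, `formG` and `formS`. The second and
third power sums express `E₄` and `E₆` in these, and the fourth, a multiple of `E₄²`, becomes a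
relation between them. -/
lemma sq_relation (z : ℍ) : (formS z ^ 2 - formF z ^ 2 + 27 * formG z ^ 2) ^ 2 =
    (18 * (formF z * formG z)) ^ 2 := by
  have h := sum_roots_pow_four z
  have e := E4_eq z
  have e' : E₄ z = (formS z ^ 2 + 2 * formF z ^ 2 - 54 * formG z ^ 2) / 3 := by
    linear_combination e / 3
  rw [rootInf_eq, root_zero_eq, root_one_eq, root_two_eq, e'] at h
  have h4 : (cubeRoot - cubeRoot ^ 2) ^ 4 = 9 := by
    linear_combination ((cubeRoot - cubeRoot ^ 2) ^ 2 - 3) * cubeRoot_sub_sq_sq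
  linear_combination -243 / 256 * h + 81 * formS z ^ 2 * formG z ^ 2 * cubeRoot_sub_sq_sq +
    486 * formG z ^ 4 * h4

/-- If the product vanished, `sq_relation` would give `S² = f² - 27g²`, and then `E₄³ - E₆²` would
be a multiple of `(fg)²`, contradicting the nonvanishing of the discriminant. -/
lemma formF_mul_formG_ne_zero (z : ℍ) : formF z * formG z ≠ 0 := by
  intro h
  have hd := ModularForm.discriminant_ne_zero z
  rw [discriminant_eq_E₄_cube_sub_E₆_sq] at hd
  have h1 : formS z ^ 2 = formF z ^ 2 - 27 * formG z ^ 2 := by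
    have := sq_relation z
    rw [h, mul_zero, zero_pow two_ne_zero] at this
    linear_combination pow_eq_zero_iff two_ne_zero |>.1 this
  have e4 : E₄ z = formF z ^ 2 - 27 * formG z ^ 2 := by
    linear_combination E4_eq z / 3 + h1 / 3
  apply hd
  rw [e4, E6_eq, mul_pow, h1]
  linear_combination (-(formF z ^ 2 - 27 * formG z ^ 2) * 108 * formF z * formG z / 1728) * h

lemma tendsto_E2_affine {x y : ℝ} (hx : 0 < x) {l : ℂ}
    (h : Tendsto (fun z : ℍ => Function.Periodic.qParam 1 (affinePoint x y hx z) /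
      Function.Periodic.qParam 3 z) atImInfty (𝓝 l)) :
    Tendsto (fun z : ℍ => (E2 (affinePoint x y hx z) - 1) / Function.Periodic.qParam 3 z)
      atImInfty (𝓝 (-24 * l)) := by
  have h1 := (tendsto_E2_atImInfty.2.comp
    (RationalMukai.tendsto_affinePoint_atImInfty x y hx)).mul h
  refine h1.congr fun z => ?_
  rw [Function.comp_apply, div_mul_div_cancel₀ (Function.Periodic.qParam_ne_zero _)]

lemma qParam_three_tendsto_zero :
    Tendsto (fun z : ℍ => Function.Periodic.qParam 3 z) atImInfty (𝓝 0) :=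
  UpperHalfPlane.qParam_tendsto_atImInfty three_pos

lemma tendsto_E2_sub_one : Tendsto (fun z : ℍ => (E2 z - 1) / Function.Periodic.qParam 3 z)
    atImInfty (𝓝 0) := by
  have h : Tendsto (fun z : ℍ => Function.Periodic.qParam 1 (affinePoint 1 0 one_pos z) /
      Function.Periodic.qParam 3 z) atImInfty (𝓝 0) := by
    refine (zero_pow (M₀ := ℂ) two_ne_zero ▸ qParam_three_tendsto_zero.pow 2).congr fun z => ?_
    rw [eq_div_iff (Function.Periodic.qParam_ne_zero _), ← pow_succ, Function.Periodic.qParam,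
      Function.Periodic.qParam, ← Complex.exp_nat_mul, coe_affinePoint]
    congr 1
    push_cast
    ring
  have h1 := tendsto_E2_affine one_pos h
  rw [mul_zero] at h1
  refine h1.congr fun z => ?_
  congr 3
  ext
  simp

lemma tendsto_E2_three_mul : Tendsto (fun z : ℍ =>
    (E2 (affinePoint 3 0 three_pos z) - 1) / Function.Periodic.qParam 3 z) atImInfty (𝓝 0) := by
  have h : Tendsto (fun z : ℍ => Function.Periodic.qParam 1 (affinePoint 3 0 three_pos z) /
      Function.Periodic.qParam 3 z) atImInfty (𝓝 0) := by
    refine (zero_pow (M₀ := ℂ) (by norm_num : 8 ≠ 0) ▸ qParam_three_tendsto_zero.pow 8).congr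
      fun z => ?_
    rw [eq_div_iff (Function.Periodic.qParam_ne_zero _), ← pow_succ, Function.Periodic.qParam,
      Function.Periodic.qParam, ← Complex.exp_nat_mul, coe_affinePoint]
    congr 1
    push_cast
    ring
  simpa using tendsto_E2_affine three_pos h

lemma tendsto_E2_third (j : ℕ) : Tendsto (fun z : ℍ =>
    (E2 (affinePoint (1 / 3) (j / 3) (by norm_num) z) - 1) / Function.Periodic.qParam 3 z)
    atImInfty (𝓝 (-24 * cubeRoot ^ j)) := by
  refine tendsto_E2_affine _ (tendsto_const_nhds.congr fun z => ?_)
  rw [eq_div_iff (Function.Periodic.qParam_ne_zero _), cubeRoot, ← Complex.exp_nat_mul,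
    Function.Periodic.qParam, Function.Periodic.qParam, ← Complex.exp_add, coe_affinePoint]
  congr 1
  push_cast
  ring

lemma tendsto_formF_sub_one :
    Tendsto (fun z : ℍ => (formF z - 1) / Function.Periodic.qParam 3 z) atImInfty (𝓝 3) := by
  have h := ((tendsto_E2_three_mul.const_mul (9 / 8)).sub ((tendsto_E2_third 0).const_mul (1 / 8)))
  convert h using 2
  · rw [formF, rootInf, root]; ring
  · norm_num

lemma tendsto_formS_sub_one :
    Tendsto (fun z : ℍ => (formS z - 1) / Function.Periodic.qParam 3 z) atImInfty (𝓝 (-6)) := by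
  have h := ((tendsto_E2_three_mul.const_mul (9 / 4)).add
    ((tendsto_E2_third 0).const_mul (1 / 4))).sub (tendsto_E2_sub_one.const_mul (3 / 2))
  convert h using 2
  · rw [formS, rootInf, root]; ring
  · norm_num

lemma tendsto_formG_div :
    Tendsto (fun z : ℍ => formG z / Function.Periodic.qParam 3 z) atImInfty (𝓝 1) := by
  have h := ((tendsto_E2_third 2).sub (tendsto_E2_third 1)).const_mul
    (1 / (24 * (cubeRoot - cubeRoot ^ 2)))
  have h0 := cubeRoot_sub_sq_ne_zero
  convert h using 2
  · rw [formG, root, root, mul_comm 24, mul_comm 8, ← div_div, ← div_div]; ring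
  · rw [show (-24 * cubeRoot ^ 2 - -24 * cubeRoot ^ 1) = 24 * (cubeRoot - cubeRoot ^ 2) by ring,
      one_div_mul_cancel (mul_ne_zero (by norm_num) h0)]

lemma tendsto_of_tendsto_sub_div {h : ℍ → ℂ} {c l : ℂ}
    (H : Tendsto (fun z : ℍ => (h z - c) / Function.Periodic.qParam 3 z) atImInfty (𝓝 l)) :
    Tendsto h atImInfty (𝓝 c) := by
  have := (H.mul qParam_three_tendsto_zero).add_const c
  rw [mul_zero, zero_add] at this
  refine this.congr fun z => ?_
  rw [div_mul_cancel₀ _ (Function.Periodic.qParam_ne_zero _), sub_add_cancel]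

lemma tendsto_formF : Tendsto formF atImInfty (𝓝 1) :=
  tendsto_of_tendsto_sub_div tendsto_formF_sub_one

lemma tendsto_formS : Tendsto formS atImInfty (𝓝 1) :=
  tendsto_of_tendsto_sub_div tendsto_formS_sub_one

lemma tendsto_formG : Tendsto formG atImInfty (𝓝 0) :=
  tendsto_of_tendsto_sub_div (by simpa using tendsto_formG_div)

/-- The upper half plane is connected and `fg` has no zero, so one sign of the square root in
`sq_relation` holds everywhere. The leading coefficients in `exp(2πiz/3)`, -18 against 18, decide
it. -/
lemma formS_sq (z : ℍ) : formS z ^ 2 = formF z ^ 2 - 18 * formF z * formG z - 27 * formG z ^ 2 := by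
  have hF := mdifferentiable_formF.continuous
  have hG := mdifferentiable_formG.continuous
  have hS := mdifferentiable_formS.continuous
  have key := (isPreconnected_univ (α := ℍ)).eq_or_eq_neg_of_sq_eq
    (f := fun z => formS z ^ 2 - formF z ^ 2 + 27 * formG z ^ 2)
    (g := fun z => 18 * (formF z * formG z)) (by fun_prop) (by fun_prop)
    (fun z _ => sq_relation z) (fun {z} _ => mul_ne_zero (by norm_num) (formF_mul_formG_ne_zero z))
  rcases key with h | h
  · exfalso
    have h1 : Tendsto (fun z : ℍ => (formS z ^ 2 - formF z ^ 2 + 27 * formG z ^ 2) /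
        Function.Periodic.qParam 3 z) atImInfty (𝓝 (-18)) := by
      have := ((tendsto_formS_sub_one.mul (tendsto_formS.add_const 1)).sub
        (tendsto_formF_sub_one.mul (tendsto_formF.add_const 1))).add
        ((tendsto_formG_div.mul tendsto_formG).const_mul 27)
      convert this using 2
      · ring
      · norm_num
    have h2 : Tendsto (fun z : ℍ => (18 * (formF z * formG z)) /
        Function.Periodic.qParam 3 z) atImInfty (𝓝 18) := by
      have := (tendsto_formF.mul tendsto_formG_div).const_mul 18
      convert this using 2
      · ring
      · norm_num
    have h3 := tendsto_nhds_unique (h1.congr fun z => congrArg (· / _) (h (Set.mem_univ z))) h2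
    norm_num at h3
  · have := h (Set.mem_univ z)
    simp only [Pi.neg_apply] at this
    linear_combination this

lemma E4_eq' (z : ℍ) : E₄ z = formF z ^ 2 - 6 * formF z * formG z - 27 * formG z ^ 2 := by
  linear_combination E4_eq z / 3 + formS_sq z / 3
lemma normalizedDeriv_relations (z : ℍ) :
    (2 * formS z * D formS z + 4 * formF z * D formF z - 108 * formG z * D formG z = 3 * D E₄ z) ∧
    (D formS z * (formF z ^ 2 + 27 * formG z ^ 2) + formS z * (2 * formF z * D formF z
      + 54 * formG z * D formG z) = D E₆ z) ∧
    (2 * formS z * D formS z = 2 * formF z * D formF z - 18 * (D formF z * formG z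
      + formF z * D formG z) - 54 * formG z * D formG z) := by
  have hF := hasDerivAt_comp_ofComplex mdifferentiable_formF z
  have hG := hasDerivAt_comp_ofComplex mdifferentiable_formG z
  have hS := hasDerivAt_comp_ofComplex mdifferentiable_formS z
  have h4 := hasDerivAt_comp_ofComplex (F := E₄) E₄.holo' z
  have h6 := hasDerivAt_comp_ofComplex (F := E₆) E₆.holo' z
  have hF2 := hF.mul hF
  have hG2 := hG.mul hG
  have hS2 := hS.mul hS
  have e1 := ((hS2.add (hF2.const_mul 2)).sub (hG2.const_mul 54)).unique
    ((h4.const_mul 3).congr_of_eventuallyEq (.of_forall fun w => by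
      have := E4_eq (ofComplex w)
      simp only [Pi.sub_apply, Pi.add_apply, Pi.mul_apply, Function.comp_apply]
      linear_combination -this))
  have e2 := (hS.mul (hF2.add (hG2.const_mul 27))).unique
    (h6.congr_of_eventuallyEq (.of_forall fun w => by
      have := E6_eq (ofComplex w)
      simp only [Pi.add_apply, Pi.mul_apply, Function.comp_apply]
      linear_combination -this))
  have e3 := hS2.unique (((hF2.sub ((hF.mul hG).const_mul 18)).sub
    (hG2.const_mul 27)).congr_of_eventuallyEq (.of_forall fun w => by
      have := formS_sq (ofComplex w)
      simp only [Pi.sub_apply, Pi.mul_apply, Function.comp_apply]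
      linear_combination this))
  simp only [Function.comp_apply, ofComplex_apply, Pi.add_apply, Pi.mul_apply] at e1 e2 e3
  refine ⟨?_, ?_, ?_⟩ <;> apply mul_left_cancel₀ Complex.two_pi_I_ne_zero
  · linear_combination e1
  · linear_combination e2
  · linear_combination e3

/-- Cramer's rule: modulo the relation `hs` the determinant of the system is, up to sign, `7776
(fg)²`. -/
lemma cramer_eq_zero {f g s a b c : ℂ} (hs : s ^ 2 = f ^ 2 - 18 * f * g - 27 * g ^ 2)
    (h : f * g ≠ 0) (h1 : s * c + 2 * f * a - 54 * g * b = 0)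
    (h2 : s * c - f * a + 9 * (f * b + g * a) + 27 * g * b = 0)
    (h3 : (f ^ 2 + 27 * g ^ 2) * c + s * (2 * f * a + 54 * g * b) = 0) :
    a = 0 ∧ b = 0 ∧ c = 0 := by
  have h0 : 7776 * (f * g) ^ 2 ≠ 0 := mul_ne_zero (by norm_num) (pow_ne_zero 2 h)
  refine ⟨?_, ?_, ?_⟩ <;> apply mul_left_cancel₀ h0
  · linear_combination (-(54 * s ^ 2 * g - (f ^ 2 + 27 * g ^ 2) * (9 * f + 27 * g))) * h1
      + (54 * s ^ 2 * g + 54 * g * (f ^ 2 + 27 * g ^ 2)) * h2 - s * (9 * f + 81 * g) * h3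
      + 18 * a * (f ^ 2 + 18 * f * g - 27 * g ^ 2) * hs
  · linear_combination (2 * s ^ 2 * f - (f ^ 2 + 27 * g ^ 2) * (-f + 9 * g)) * h1
      - (2 * s ^ 2 * f - 2 * f * (f ^ 2 + 27 * g ^ 2)) * h2 + s * (-3 * f + 9 * g) * h3
      + 18 * b * (f ^ 2 + 18 * f * g - 27 * g ^ 2) * hs
  · linear_combination ((-f + 9 * g) * 54 * s * g - (9 * f + 27 * g) * 2 * s * f) * h1
      - 216 * f * g * s * h2 + (2 * f * (9 * f + 27 * g) + 54 * g * (-f + 9 * g)) * h3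
      + 18 * c * (f ^ 2 + 18 * f * g - 27 * g ^ 2) * hs

/-- Differentiating the expressions for `E₄`, `E₆` and `S²` and inserting Ramanujan's formulas gives
a linear system for the three derivatives. The stated values solve it, and `cramer_eq_zero` makes
the solution unique. -/
lemma normalizedDeriv_forms (z : ℍ) :
    D formF z = formF z * (E2 z - formS z) / 6 ∧ D formG z = formG z * (E2 z + formS z) / 6 ∧
      D formS z = (E2 z * formS z - (formF z ^ 2 + 27 * formG z ^ 2)) / 6 := by
  obtain ⟨e1, e2, e3⟩ := normalizedDeriv_relations z
  rw [normalizedDeriv_E4, E6_eq, E4_eq'] at e1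
  rw [normalizedDeriv_E6, E6_eq, E4_eq'] at e2
  have hs := formS_sq z
  have h := cramer_eq_zero (a := D formF z - formF z * (E2 z - formS z) / 6)
    (b := D formG z - formG z * (E2 z + formS z) / 6)
    (c := D formS z - (E2 z * formS z - (formF z ^ 2 + 27 * formG z ^ 2)) / 6) hs
    (formF_mul_formG_ne_zero z)
    (by linear_combination e1 / 2 - E2 z / 6 * hs)
    (by linear_combination e3 / 2 - E2 z / 6 * hs)
    (by linear_combination e2 + (formF z ^ 2 - 27 * formG z ^ 2) / 3 * hs)
  exact ⟨sub_eq_zero.1 h.1, sub_eq_zero.1 h.2.1, sub_eq_zero.1 h.2.2⟩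

/-- By `E₄ = E₂² - 12 D E₂`, the difference of the two translates of `E₄` is quadratic in the roots
plus a multiple of the derivative of `formG`, which is known. The level 9 variable is `z/3`. -/
lemma formNine_eq (z : ℍ) :
    RationalMukai.formNine (affinePoint (1 / 3) 0 (by norm_num) z) = formG z * formS z := by
  have hw : ∀ j : ℕ, affinePoint 1 ((j : ℤ) / 3) one_pos (affinePoint (1 / 3) 0 (by norm_num) z) =
      affinePoint (1 / 3) (j / 3) (by norm_num) z := fun j => by
    ext
    simp only [coe_affinePoint]
    push_cast
    ring
  rw [RationalMukai.formNine_apply, hw, hw]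
  have hr := cubeRoot_sub_sq_ne_zero
  have hE : ∀ j : ℕ, E2 (affinePoint (1 / 3) (j / 3) (by norm_num) z) = 3 * (root j z + E2 z) :=
    fun j => by rw [root]; ring
  have hE4 : ∀ j : ℕ, E₄ (affinePoint (1 / 3) (j / 3) (by norm_num) z) =
      9 * (root j z + E2 z) ^ 2 - 12 * D E2 (affinePoint (1 / 3) (j / 3) (by norm_num) z) :=
    fun j => by rw [normalizedDeriv_E2, hE]; ring
  have hd : ∀ j : ℕ, HasDerivAt ((root j) ∘ ofComplex) (2 * Real.pi * Complex.I *
      (1 / 9 * D E2 (affinePoint (1 / 3) (j / 3) (by norm_num) z) - D E2 z)) (z : ℂ) := fun j => by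
    have h1 := hasDerivAt_comp_ofComplex
      (mdifferentiable_comp_affinePoint mdifferentiable_E2 (1 / 3) (j / 3) (by norm_num)) z
    rw [normalizedDeriv_comp_affinePoint mdifferentiable_E2] at h1
    refine ((h1.const_mul (1 / 3)).sub
      (hasDerivAt_comp_ofComplex mdifferentiable_E2 z)).congr_deriv ?_
    push_cast
    ring
  have hG := (hasDerivAt_comp_ofComplex mdifferentiable_formG z).unique
    ((((hd 2).sub (hd 1)).const_mul (1 / (8 * (cubeRoot - cubeRoot ^ 2)))))
  have hG' : D formG z = 1 / (8 * (cubeRoot - cubeRoot ^ 2)) *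
      (1 / 9 * D E2 (affinePoint (1 / 3) ((2 : ℕ) / 3) (by norm_num) z)
        - 1 / 9 * D E2 (affinePoint (1 / 3) ((1 : ℕ) / 3) (by norm_num) z)) := by
    apply mul_left_cancel₀ Complex.two_pi_I_ne_zero
    linear_combination hG
  rw [(normalizedDeriv_forms z).2.1] at hG'
  have h8 : 8 * (cubeRoot - cubeRoot ^ 2) * (1 / (8 * (cubeRoot - cubeRoot ^ 2))) = 1 :=
    mul_one_div_cancel (mul_ne_zero (by norm_num) hr)
  have hG'' := congrArg (8 * (cubeRoot - cubeRoot ^ 2) * ·) hG'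
  simp only [← mul_assoc, h8, one_mul] at hG''
  rw [hE4, hE4, root_one_eq, root_two_eq, one_div_mul_eq_div,
    div_eq_iff (mul_ne_zero (by norm_num) hr)]
  linear_combination -108 * hG''
-- Restriction to the imaginary axis
/-- The point `i y` of the upper half plane (for positive `y`). -/
noncomputable def axisPoint (y : ℝ) : ℍ := ofComplex (Complex.I * y)

lemma coe_axisPoint {y : ℝ} (hy : 0 < y) : (axisPoint y : ℂ) = Complex.I * y := by
  rw [axisPoint, ofComplex_apply_of_im_pos (by simpa using hy)]

lemma tendsto_axisPoint : Tendsto axisPoint atTop atImInfty := by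
  rw [atImInfty, tendsto_comap_iff]
  refine tendsto_id.congr' ?_
  filter_upwards [eventually_gt_atTop 0] with y hy
  simp [Function.comp_apply, ← coe_im, coe_axisPoint hy]

lemma qParam_axisPoint {y : ℝ} (hy : 0 < y) :
    Function.Periodic.qParam 3 (axisPoint y) = (Real.exp (-(2 * Real.pi / 3) * y) : ℝ) := by
  rw [Function.Periodic.qParam, coe_axisPoint hy, Complex.ofReal_exp]
  congr 1
  push_cast
  linear_combination 2 * Real.pi * y / 3 * Complex.I_sq

/-- The deviation from the constant term decays like `exp(-2πy/3)`. The factor `y²` is what the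
boundary terms of the integration by parts require. -/
lemma tendsto_sq_mul_axis {H : ℍ → ℂ} {c : ℝ} {l : ℂ}
    (h : Tendsto (fun z : ℍ => (H z - c) / Function.Periodic.qParam 3 z) atImInfty (𝓝 l)) :
    Tendsto (fun y : ℝ => y ^ 2 * ((H (axisPoint y)).re - c)) atTop (𝓝 0) := by
  have h1 : Tendsto (fun y : ℝ => y ^ 2 * Real.exp (-(2 * Real.pi / 3) * y)) atTop (𝓝 0) := by
    have := tendsto_rpow_mul_exp_neg_mul_atTop_nhds_zero 2 (2 * Real.pi / 3)
      (div_pos Real.two_pi_pos three_pos)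
    exact_mod_cast this
  have h2 := ((Complex.continuous_re.tendsto l).comp (h.comp tendsto_axisPoint)).mul h1
  rw [mul_zero] at h2
  refine h2.congr' ?_
  filter_upwards [eventually_gt_atTop 0] with y hy
  simp only [Function.comp_apply]
  rw [qParam_axisPoint hy, Complex.div_ofReal_re, Complex.sub_re, Complex.ofReal_re]
  have := Real.exp_ne_zero (-(2 * Real.pi / 3) * y)
  field_simp

lemma E2_neg_conj {w z : ℍ} (h : (w : ℂ) = -(starRingEnd ℂ) z) :
    E2 w = (starRingEnd ℂ) (E2 z) := by
  refine (EisensteinSeries.hasSum_qExpansion_E2 (z := w)).unique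
    ((Complex.hasSum_conj'.2 (EisensteinSeries.hasSum_qExpansion_E2 (z := z))).congr_fun fun n => ?_)
  simp only [smul_eq_mul, map_mul, map_pow, ← Complex.exp_conj, h]
  congr 1
  · split_ifs <;> simp [map_ofNat]
  · congr 2
    simp [map_ofNat]

lemma conj_cubeRoot_sub : (starRingEnd ℂ) (cubeRoot - cubeRoot ^ 2) = -(cubeRoot - cubeRoot ^ 2) := by
  have h : (starRingEnd ℂ) cubeRoot = cubeRoot ^ 2 := by
    have h1 : (starRingEnd ℂ) cubeRoot * cubeRoot = 1 := by
      rw [cubeRoot, ← Complex.exp_conj, ← Complex.exp_add, ← Complex.exp_zero]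
      congr 1
      simp only [map_div₀, map_mul, map_ofNat, Complex.conj_ofReal, Complex.conj_I]
      ring
    linear_combination cubeRoot ^ 2 * h1 - (starRingEnd ℂ) cubeRoot * cubeRoot_pow_three
  rw [map_sub, map_pow, h]
  linear_combination -cubeRoot * cubeRoot_pow_three

lemma conj_E2_affine_axis {x y : ℝ} (hx : 0 < x) (hy : 0 < y) {a b : ℝ} (k : ℤ) (hab : a + b = k) :
    (starRingEnd ℂ) (E2 (affinePoint x a hx (axisPoint y))) =
      E2 (affinePoint x b hx (axisPoint y)) := by
  have h : (starRingEnd ℂ) (affinePoint x a hx (axisPoint y) : ℂ) =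
      -((affinePoint x b hx (axisPoint y) : ℂ) - k) := by
    have : (a : ℂ) + b = k := by exact_mod_cast hab
    simp only [coe_affinePoint, coe_axisPoint hy, map_add, map_mul, Complex.conj_ofReal,
      Complex.conj_I]
    linear_combination this
  have e := E2_moebius 1 (-k) 0 1 (by norm_num) (w := affinePoint 1 (-k) one_pos
    (affinePoint x b hx (axisPoint y))) (z := affinePoint x b hx (axisPoint y)) (by
      simp only [coe_affinePoint]
      push_cast
      ring)
  rw [← E2_neg_conj (w := affinePoint 1 (-k) one_pos (affinePoint x b hx (axisPoint y))), e]
  · simp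
  · rw [h, coe_affinePoint]
    push_cast
    ring

lemma conj_E2_axis {y : ℝ} (hy : 0 < y) :
    (starRingEnd ℂ) (E2 (axisPoint y)) = E2 (axisPoint y) := by
  refine (E2_neg_conj ?_).symm
  rw [coe_axisPoint hy]
  simp

lemma conj_rootInf_axis {y : ℝ} (hy : 0 < y) :
    (starRingEnd ℂ) (rootInf (axisPoint y)) = rootInf (axisPoint y) := by
  rw [rootInf, map_sub, map_mul, conj_E2_affine_axis three_pos hy (b := 0) 0 (by simp),
    conj_E2_axis hy]
  simp [map_ofNat]

lemma conj_root_axis {y : ℝ} (hy : 0 < y) {i j : ℕ} (k : ℤ) (h : (i : ℝ) + j = 3 * k) :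
    (starRingEnd ℂ) (root i (axisPoint y)) = root j (axisPoint y) := by
  rw [root, map_sub, map_mul, conj_E2_affine_axis _ hy (b := j / 3) k (by linear_combination h / 3),
    conj_E2_axis hy, root]
  simp [map_ofNat]

lemma ofReal_re_of_conj {z : ℂ} (h : (starRingEnd ℂ) z = z) : ((z.re : ℝ) : ℂ) = z :=
  Complex.conj_eq_iff_re.1 h

lemma ofReal_re_E2_axis {y : ℝ} (hy : 0 < y) : ((E2 (axisPoint y)).re : ℂ) = E2 (axisPoint y) :=
  ofReal_re_of_conj (conj_E2_axis hy)

lemma ofReal_re_formF_axis {y : ℝ} (hy : 0 < y) :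
    ((formF (axisPoint y)).re : ℂ) = formF (axisPoint y) := by
  apply ofReal_re_of_conj
  rw [formF, map_mul, map_sub, conj_rootInf_axis hy, conj_root_axis hy (j := 0) 0 (by simp)]
  simp [map_ofNat]

lemma ofReal_re_formS_axis {y : ℝ} (hy : 0 < y) :
    ((formS (axisPoint y)).re : ℂ) = formS (axisPoint y) := by
  apply ofReal_re_of_conj
  rw [formS, map_mul, map_add, conj_rootInf_axis hy, conj_root_axis hy (j := 0) 0 (by simp)]
  simp [map_ofNat]

/-- Conjugation exchanges roots 1 and 2 and also changes the sign of `ω - ω²` in the normalization.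
-/
lemma ofReal_re_formG_axis {y : ℝ} (hy : 0 < y) :
    ((formG (axisPoint y)).re : ℂ) = formG (axisPoint y) := by
  apply ofReal_re_of_conj
  rw [formG, map_mul, map_sub, conj_root_axis hy (j := 1) 1 (by norm_num),
    conj_root_axis hy (j := 2) 1 (by norm_num), map_div₀, map_mul, conj_cubeRoot_sub]
  simp only [map_one, map_ofNat, mul_neg, div_neg]
  ring

lemma hasDerivAt_axis_re {F : ℍ → ℂ} (hF : MDiff F) {y : ℝ} (hy : 0 < y) {d : ℝ}
    (hd : D F (axisPoint y) = d) :
    HasDerivAt (fun y : ℝ => (F (axisPoint y)).re) (-(2 * Real.pi * d)) y := by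
  have h1 := hasDerivAt_comp_ofComplex hF (axisPoint y)
  rw [coe_axisPoint hy, hd] at h1
  have h2 : HasDerivAt (fun y : ℝ => Complex.I * (y : ℂ)) Complex.I y := by
    simpa using (Complex.ofRealCLM.hasDerivAt (x := y)).const_mul Complex.I
  have h3 := (Complex.reCLM.hasFDerivAt.comp_hasDerivAt y (h1.scomp y h2))
  refine h3.congr_deriv ?_
  rw [Complex.reCLM_apply, smul_eq_mul, show Complex.I * (2 * Real.pi * Complex.I * (d : ℂ)) =
    ((-(2 * Real.pi * d) : ℝ) : ℂ) by push_cast; linear_combination 2 * Real.pi * d * Complex.I_sq]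
  exact Complex.ofReal_re _

lemma axisPoint_inv {y : ℝ} (hy : 0 < y) : axisPoint y⁻¹ = ModularGroup.S • axisPoint y := by
  ext
  rw [coe_S_smul, coe_axisPoint hy, coe_axisPoint (inv_pos.2 hy)]
  have hy' : (y : ℂ) ≠ 0 := by exact_mod_cast hy.ne'
  have hI := Complex.I_ne_zero
  push_cast
  field_simp
  linear_combination Complex.I_sq
/-- `E₂(i y)`. -/
noncomputable def axisE (y : ℝ) : ℝ := (E2 (axisPoint y)).re

/-- `formF (i y)`. -/
noncomputable def axisF (y : ℝ) : ℝ := (formF (axisPoint y)).re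

/-- `formG (i y)`. -/
noncomputable def axisG (y : ℝ) : ℝ := (formG (axisPoint y)).re

/-- `formS (i y)`. -/
noncomputable def axisS (y : ℝ) : ℝ := (formS (axisPoint y)).re

lemma ofReal_axisE {y : ℝ} (hy : 0 < y) : (axisE y : ℂ) = E2 (axisPoint y) :=
  ofReal_re_E2_axis hy

lemma ofReal_axisF {y : ℝ} (hy : 0 < y) : (axisF y : ℂ) = formF (axisPoint y) :=
  ofReal_re_formF_axis hy

lemma ofReal_axisG {y : ℝ} (hy : 0 < y) : (axisG y : ℂ) = formG (axisPoint y) :=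
  ofReal_re_formG_axis hy

lemma ofReal_axisS {y : ℝ} (hy : 0 < y) : (axisS y : ℂ) = formS (axisPoint y) :=
  ofReal_re_formS_axis hy

lemma axisS_sq {y : ℝ} (hy : 0 < y) :
    axisS y ^ 2 = axisF y ^ 2 - 18 * axisF y * axisG y - 27 * axisG y ^ 2 := by
  have := formS_sq (axisPoint y)
  rw [← ofReal_axisF hy, ← ofReal_axisG hy, ← ofReal_axisS hy] at this
  exact_mod_cast this

lemma axisF_ne_zero {y : ℝ} (hy : 0 < y) : axisF y ≠ 0 := by
  have := left_ne_zero_of_mul (formF_mul_formG_ne_zero (axisPoint y))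
  rw [← ofReal_axisF hy] at this
  exact_mod_cast this

lemma axisG_ne_zero {y : ℝ} (hy : 0 < y) : axisG y ≠ 0 := by
  have := right_ne_zero_of_mul (formF_mul_formG_ne_zero (axisPoint y))
  rw [← ofReal_axisG hy] at this
  exact_mod_cast this

/-- The rate `2 π / 3` of decay at infinity. -/
noncomputable def rate : ℝ := 2 * Real.pi / 3

lemma rate_pos : 0 < rate := div_pos Real.two_pi_pos three_pos

lemma hasDerivAt_axisE {y : ℝ} (hy : 0 < y) : HasDerivAt axisE (-rate *
    ((axisE y ^ 2 - (axisF y ^ 2 - 6 * axisF y * axisG y - 27 * axisG y ^ 2)) / 4)) y := by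
  refine (hasDerivAt_axis_re mdifferentiable_E2 hy
    (d := (axisE y ^ 2 - (axisF y ^ 2 - 6 * axisF y * axisG y - 27 * axisG y ^ 2)) / 12)
    ?_).congr_deriv (by rw [rate]; ring)
  rw [normalizedDeriv_E2, E4_eq', ← ofReal_axisE hy, ← ofReal_axisF hy, ← ofReal_axisG hy]
  push_cast
  rfl

lemma hasDerivAt_axisF {y : ℝ} (hy : 0 < y) :
    HasDerivAt axisF (-rate * (axisF y * (axisE y - axisS y) / 2)) y := by
  refine (hasDerivAt_axis_re mdifferentiable_formF hy
    (d := axisF y * (axisE y - axisS y) / 6) ?_).congr_deriv (by rw [rate]; ring)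
  rw [(normalizedDeriv_forms _).1, ← ofReal_axisE hy, ← ofReal_axisF hy, ← ofReal_axisS hy]
  push_cast
  rfl

lemma hasDerivAt_axisG {y : ℝ} (hy : 0 < y) :
    HasDerivAt axisG (-rate * (axisG y * (axisE y + axisS y) / 2)) y := by
  refine (hasDerivAt_axis_re mdifferentiable_formG hy
    (d := axisG y * (axisE y + axisS y) / 6) ?_).congr_deriv (by rw [rate]; ring)
  rw [(normalizedDeriv_forms _).2.1, ← ofReal_axisE hy, ← ofReal_axisG hy, ← ofReal_axisS hy]
  push_cast
  rfl

lemma hasDerivAt_axisS {y : ℝ} (hy : 0 < y) : HasDerivAt axisS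
    (-rate * ((axisE y * axisS y - (axisF y ^ 2 + 27 * axisG y ^ 2)) / 2)) y := by
  refine (hasDerivAt_axis_re mdifferentiable_formS hy
    (d := (axisE y * axisS y - (axisF y ^ 2 + 27 * axisG y ^ 2)) / 6) ?_).congr_deriv
    (by rw [rate]; ring)
  rw [(normalizedDeriv_forms _).2.2, ← ofReal_axisE hy, ← ofReal_axisF hy, ← ofReal_axisG hy,
    ← ofReal_axisS hy]
  push_cast
  rfl

lemma axisF_inv {y : ℝ} (hy : 0 < y) : axisF y⁻¹ = y ^ 2 * axisF y := by
  have h := formF_S_smul (axisPoint y)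
  rw [← axisPoint_inv hy, ← ofReal_axisF hy, ← ofReal_axisF (inv_pos.2 hy), coe_axisPoint hy] at h
  have : (axisF y⁻¹ : ℂ) = ((y ^ 2 * axisF y : ℝ) : ℂ) := by
    push_cast
    linear_combination h - (y : ℂ) ^ 2 * axisF y * Complex.I_sq
  exact_mod_cast this

lemma axisG_inv {y : ℝ} (hy : 0 < y) : axisG y⁻¹ = y ^ 2 * axisG y := by
  have h := formG_S_smul (axisPoint y)
  rw [← axisPoint_inv hy, ← ofReal_axisG hy, ← ofReal_axisG (inv_pos.2 hy), coe_axisPoint hy] at h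
  have : (axisG y⁻¹ : ℂ) = ((y ^ 2 * axisG y : ℝ) : ℂ) := by
    push_cast
    linear_combination h - (y : ℂ) ^ 2 * axisG y * Complex.I_sq
  exact_mod_cast this

lemma axisS_inv {y : ℝ} (hy : 0 < y) : axisS y⁻¹ = -y ^ 2 * axisS y := by
  have h := formS_S_smul (axisPoint y)
  rw [← axisPoint_inv hy, ← ofReal_axisS hy, ← ofReal_axisS (inv_pos.2 hy), coe_axisPoint hy] at h
  have : (axisS y⁻¹ : ℂ) = ((-y ^ 2 * axisS y : ℝ) : ℂ) := by
    push_cast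
    linear_combination h + (y : ℂ) ^ 2 * axisS y * Complex.I_sq
  exact_mod_cast this

lemma axisE_inv {y : ℝ} (hy : 0 < y) : rate * axisE y⁻¹ = -rate * y ^ 2 * axisE y + 4 * y := by
  have h := E2_S_smul (axisPoint y)
  have hpi : (Real.pi : ℂ) ≠ 0 := by exact_mod_cast Real.pi_ne_zero
  rw [← axisPoint_inv hy, ← ofReal_axisE hy, ← ofReal_axisE (inv_pos.2 hy), coe_axisPoint hy] at h
  have : ((rate * axisE y⁻¹ : ℝ) : ℂ) = ((-rate * y ^ 2 * axisE y + 4 * y : ℝ) : ℂ) := by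
    rw [rate]
    push_cast
    rw [h]
    field_simp
    linear_combination (2 * Real.pi * (y : ℂ) ^ 2 * axisE y - 12 * y) * Complex.I_sq
  exact_mod_cast this

lemma tendsto_sq_mul_axisE : Tendsto (fun y => y ^ 2 * (axisE y - 1)) atTop (𝓝 0) :=
  tendsto_sq_mul_axis (c := 1) (by simpa using tendsto_E2_sub_one)

lemma tendsto_sq_mul_axisF : Tendsto (fun y => y ^ 2 * (axisF y - 1)) atTop (𝓝 0) :=
  tendsto_sq_mul_axis (c := 1) (by simpa using tendsto_formF_sub_one)

lemma tendsto_sq_mul_axisS : Tendsto (fun y => y ^ 2 * (axisS y - 1)) atTop (𝓝 0) :=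
  tendsto_sq_mul_axis (c := 1) (by simpa using tendsto_formS_sub_one)

lemma tendsto_sq_mul_axisG : Tendsto (fun y => y ^ 2 * axisG y) atTop (𝓝 0) := by
  have := tendsto_sq_mul_axis (c := 0) (by simpa using tendsto_formG_div)
  simp only [sub_zero] at this
  exact this

lemma tendsto_of_tendsto_sq_mul {u : ℝ → ℝ} (h : Tendsto (fun y => y ^ 2 * u y) atTop (𝓝 0)) :
    Tendsto (fun y => y * u y) atTop (𝓝 0) ∧ Tendsto u atTop (𝓝 0) := by
  have hi : Tendsto (fun y : ℝ => y⁻¹) atTop (𝓝 0) := tendsto_inv_atTop_zero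
  have h1 := hi.mul h
  have h2 := hi.mul h1
  simp only [mul_zero] at h1 h2
  constructor
  · refine h1.congr' ?_
    filter_upwards [eventually_gt_atTop 0] with y hy
    field_simp
  · refine h2.congr' ?_
    filter_upwards [eventually_gt_atTop 0] with y hy
    field_simp

lemma tendsto_axisE : Tendsto axisE atTop (𝓝 1) := by
  simpa using (tendsto_of_tendsto_sq_mul tendsto_sq_mul_axisE).2.add_const 1

lemma tendsto_axisF : Tendsto axisF atTop (𝓝 1) := by
  simpa using (tendsto_of_tendsto_sq_mul tendsto_sq_mul_axisF).2.add_const 1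

lemma tendsto_axisS : Tendsto axisS atTop (𝓝 1) := by
  simpa using (tendsto_of_tendsto_sq_mul tendsto_sq_mul_axisS).2.add_const 1

lemma tendsto_axisG : Tendsto axisG atTop (𝓝 0) :=
  (tendsto_of_tendsto_sq_mul tendsto_sq_mul_axisG).2

lemma pos_of_eventually_pos {u : ℝ → ℝ} (hu : ContinuousOn u (Set.Ioi 0))
    (h0 : ∀ y, 0 < y → u y ≠ 0) (h : ∀ᶠ y in atTop, 0 < u y) {y : ℝ} (hy : 0 < y) : 0 < u y := by
  obtain ⟨x, hx, hx0⟩ := (h.and (eventually_gt_atTop 0)).exists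
  by_contra hneg
  obtain ⟨w, hw, hw0⟩ := isPreconnected_Ioi.intermediate_value (Set.mem_Ioi.2 hy)
    (Set.mem_Ioi.2 hx0) hu ⟨not_lt.1 hneg, hx.le⟩
  exact h0 w hw hw0

lemma axisF_pos {y : ℝ} (hy : 0 < y) : 0 < axisF y :=
  pos_of_eventually_pos (fun _ hx => (hasDerivAt_axisF hx).continuousAt.continuousWithinAt)
    (fun _ => axisF_ne_zero) (tendsto_axisF.eventually_const_lt one_pos) hy

lemma axisG_pos {y : ℝ} (hy : 0 < y) : 0 < axisG y := by
  refine pos_of_eventually_pos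
    (fun _ hx => (hasDerivAt_axisG hx).continuousAt.continuousWithinAt) (fun _ => axisG_ne_zero) ?_ hy
  have h := (Complex.continuous_re.tendsto 1).comp (tendsto_formG_div.comp tendsto_axisPoint)
  filter_upwards [h.eventually_const_lt one_pos, eventually_gt_atTop 0] with y h hy
  simp only [Function.comp_apply] at h
  rw [qParam_axisPoint hy, Complex.div_ofReal_re] at h
  exact (div_pos_iff_of_pos_right (Real.exp_pos _)).1 h

/-! ### The modular function `t` and Bol's identity for `t^m / f` -/

/-- The modular function `t = g / f` on the imaginary axis. -/
noncomputable def axisT (y : ℝ) : ℝ := axisG y / axisF y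

lemma axisT_pos {y : ℝ} (hy : 0 < y) : 0 < axisT y := div_pos (axisG_pos hy) (axisF_pos hy)

/-- Positivity of `S²/f² = 1 - 18t - 27t²`. -/
lemma axisT_le {y : ℝ} (hy : 0 < y) : axisT y ≤ 1 / 18 := by
  have h := axisS_sq hy
  have hF := axisF_pos hy
  have hG := axisG_pos hy
  rw [axisT, div_le_iff₀ hF]
  by_contra hlt
  have h1 := mul_pos hF (sub_pos.2 (not_le.1 hlt))
  nlinarith [sq_nonneg (axisS y), pow_pos hG 2]

lemma continuousOn_axisT : ContinuousOn axisT (Set.Ioi 0) := fun _ hx =>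
  ((hasDerivAt_axisG hx).continuousAt.div (hasDerivAt_axisF hx).continuousAt
    (axisF_ne_zero hx)).continuousWithinAt

lemma hasDerivAt_axisT {y : ℝ} (hy : 0 < y) :
    HasDerivAt axisT (-rate * (axisT y * axisS y)) y := by
  have hF := axisF_ne_zero hy
  refine ((hasDerivAt_axisG hy).div (hasDerivAt_axisF hy) hF).congr_deriv ?_
  rw [axisT]
  field_simp
  ring

/-- `t ^ m / f` on the imaginary axis. -/
noncomputable def powDiv (m : ℕ) (y : ℝ) : ℝ := axisT y ^ m / axisF y

/-- The logarithmic derivative of `powDiv m`, up to the factor `-rate`. -/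
noncomputable def logPowDiv (m : ℕ) (y : ℝ) : ℝ := (m + 1 / 2) * axisS y - axisE y / 2

/-- The derivative of `logPowDiv m`, up to the factor `-rate`. -/
noncomputable def logPowDivDeriv (m : ℕ) (y : ℝ) : ℝ :=
  (m + 1 / 2) * ((axisE y * axisS y - (axisF y ^ 2 + 27 * axisG y ^ 2)) / 2) -
    (axisE y ^ 2 - (axisF y ^ 2 - 6 * axisF y * axisG y - 27 * axisG y ^ 2)) / 8

lemma hasDerivAt_powDiv (m : ℕ) {y : ℝ} (hy : 0 < y) :
    HasDerivAt (powDiv m) (-rate * (powDiv m y * logPowDiv m y)) y := by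
  have hF := axisF_ne_zero hy
  refine (((hasDerivAt_axisT hy).pow m).div (hasDerivAt_axisF hy) hF).congr_deriv ?_
  have h : (m : ℝ) * axisT y ^ (m - 1) * axisT y = m * axisT y ^ m := by
    rcases m with _ | m
    · simp
    · rw [Nat.add_sub_cancel, pow_succ, mul_assoc]
  rw [powDiv, logPowDiv, div_eq_iff (pow_ne_zero 2 hF)]
  simp only [Pi.pow_apply]
  field_simp
  linear_combination (-2 * rate * axisS y) * h

lemma hasDerivAt_logPowDiv (m : ℕ) {y : ℝ} (hy : 0 < y) :
    HasDerivAt (logPowDiv m) (-rate * logPowDivDeriv m y) y := by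
  refine (((hasDerivAt_axisS hy).const_mul (m + 1 / 2 : ℝ)).sub
    ((hasDerivAt_axisE hy).div_const 2)).congr_deriv ?_
  rw [logPowDivDeriv]
  ring

/-- Let `h = t^m/f`, with normalized logarithmic derivative `w`. As `h'''/h = w³ + 3ww' + w''`, the
statement says that the third derivative of `h` is `S f t^m` times a quadratic polynomial in `t`. As
in Bol's identity for weight -2, `E₂` drops out; the coefficients are those of the recurrence. -/
lemma hasDerivAt_logPowDivDeriv (m : ℕ) {y : ℝ} (hy : 0 < y) :
    HasDerivAt (logPowDivDeriv m) (-rate * (axisS y * (m ^ 3 * axisF y ^ 2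
      - 3 * (2 * m + 1) * (3 * m ^ 2 + 3 * m + 1) * axisF y * axisG y
      - 27 * (m + 1) ^ 3 * axisG y ^ 2) - logPowDiv m y ^ 3
      - 3 * logPowDiv m y * logPowDivDeriv m y)) y := by
  have hE := hasDerivAt_axisE hy
  have hF := hasDerivAt_axisF hy
  have hG := hasDerivAt_axisG hy
  have hS := hasDerivAt_axisS hy
  have h := ((((hE.mul hS).sub ((hF.pow 2).add ((hG.pow 2).const_mul 27))).div_const 2).const_mul
    (m + 1 / 2 : ℝ)).sub (((hE.pow 2).sub (((hF.pow 2).sub ((hF.const_mul 6).mul hG)).sub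
      ((hG.pow 2).const_mul 27))).div_const 8)
  refine h.congr_deriv ?_
  rw [logPowDiv, logPowDivDeriv]
  push_cast
  linear_combination (-rate * (m + 1 / 2) ^ 3 * axisS y) * axisS_sq hy

/-- The primitive whose boundary values give the recurrence of the moments. -/
noncomputable def momentPrimitive (m : ℕ) (y : ℝ) : ℝ :=
  powDiv m y * (rate ^ 2 * y ^ 2 * (logPowDiv m y ^ 2 + logPowDivDeriv m y)
    + 2 * rate * y * logPowDiv m y + 2)

/-- The integrand of the `n`-th moment. -/
noncomputable def momentIntegrand (n : ℕ) (y : ℝ) : ℝ := y ^ 2 * (axisG y * axisS y) * axisT y ^ n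

/-- With `h = t^m/f` the primitive is `y²h'' - 2yh' + 2h`, whose derivative is `y²h'''`. The
truncated index `m - 1` at `m = 0` is harmless because of the factor `m³`. -/
lemma hasDerivAt_momentPrimitive (m : ℕ) {y : ℝ} (hy : 0 < y) :
    HasDerivAt (momentPrimitive m) (-rate ^ 3 * (m ^ 3 * momentIntegrand (m - 1) y
      - 3 * (2 * m + 1) * (3 * m ^ 2 + 3 * m + 1) * momentIntegrand m y
      - 27 * (m + 1) ^ 3 * momentIntegrand (m + 1) y)) y := by
  have h0 := hasDerivAt_powDiv m hy
  have h1 := hasDerivAt_logPowDiv m hy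
  have h2 := hasDerivAt_logPowDivDeriv m hy
  have h := h0.mul ((((((hasDerivAt_pow 2 y).const_mul (rate ^ 2)).mul
    ((h1.pow 2).add h2))).add (((hasDerivAt_id y).const_mul (2 * rate)).mul h1)).add_const 2)
  refine h.congr_deriv ?_
  have hF := axisF_ne_zero hy
  have hG : axisG y = axisT y * axisF y := by rw [axisT, div_mul_cancel₀ _ hF]
  have hm : (m : ℝ) ^ 3 * (axisT y * axisT y ^ (m - 1)) = m ^ 3 * axisT y ^ m := by
    rcases m with _ | m
    · simp
    · rw [Nat.add_sub_cancel, pow_succ' (axisT y) m]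
  have hP : powDiv m y * axisF y = axisT y ^ m := by rw [powDiv, div_mul_cancel₀ _ hF]
  simp only [Pi.mul_apply, Pi.add_apply, Pi.pow_apply, id, momentIntegrand]
  rw [hG]
  push_cast
  linear_combination (-rate ^ 3 * y ^ 2 * axisS y * axisF y * (m ^ 3
    - 3 * (2 * m + 1) * (3 * m ^ 2 + 3 * m + 1) * axisT y - 27 * (m + 1) ^ 3 * axisT y ^ 2)) * hP
    + rate ^ 3 * y ^ 2 * axisS y * axisF y * hm

end LevelThree

/-! ### Boundary values and the recurrence of the moments -/

open MeasureTheory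

namespace LevelThree

lemma tendsto_logPowDivDeriv (m : ℕ) : Tendsto (logPowDivDeriv m) atTop (𝓝 0) := by
  have h := ((((tendsto_axisE.mul tendsto_axisS).sub ((tendsto_axisF.pow 2).add
    ((tendsto_axisG.pow 2).const_mul 27))).div_const 2).const_mul (m + 1 / 2 : ℝ)).sub
      (((tendsto_axisE.pow 2).sub (((tendsto_axisF.pow 2).sub
        ((tendsto_axisF.const_mul 6).mul tendsto_axisG)).sub
          ((tendsto_axisG.pow 2).const_mul 27))).div_const 8)
  convert h using 2
  · rfl
  · norm_num

lemma tendsto_logPowDiv (m : ℕ) : Tendsto (logPowDiv m) atTop (𝓝 m) := by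
  convert (tendsto_axisS.const_mul (m + 1 / 2 : ℝ)).sub (tendsto_axisE.div_const 2) using 2
  · rfl
  · ring

lemma tendsto_axisT : Tendsto axisT atTop (𝓝 0) := by
  have h := tendsto_axisG.div tendsto_axisF one_ne_zero
  rw [zero_div] at h
  exact h

lemma tendsto_powDiv_zero : Tendsto (powDiv 0) atTop (𝓝 1) := by
  have h := tendsto_axisF.inv₀ one_ne_zero
  rw [inv_one] at h
  refine h.congr fun y => ?_
  rw [powDiv, pow_zero, one_div]

lemma tendsto_sq_mul_powDiv_succ (m : ℕ) :
    Tendsto (fun y => y ^ 2 * powDiv (m + 1) y) atTop (𝓝 0) := by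
  have h := (tendsto_sq_mul_axisG.div (tendsto_axisF.pow 2) (by norm_num)).mul (tendsto_axisT.pow m)
  rw [zero_div, zero_mul] at h
  refine h.congr' ?_
  filter_upwards [eventually_gt_atTop 0] with y hy
  have := axisF_ne_zero hy
  simp only [Pi.div_apply, powDiv, pow_succ _ m]
  rw [axisT]
  field_simp

/-- The second derivative of `powDiv m`, up to the factor `rate ^ 2`. -/
lemma tendsto_powDiv_deriv_two (m : ℕ) :
    Tendsto (fun y => powDiv m y * (logPowDiv m y ^ 2 + logPowDivDeriv m y)) atTop (𝓝 0) := by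
  rcases m with _ | m
  · have h := tendsto_powDiv_zero.mul (((tendsto_logPowDiv 0).pow 2).add (tendsto_logPowDivDeriv 0))
    simpa using h
  · have h := (tendsto_of_tendsto_sq_mul (tendsto_sq_mul_powDiv_succ m)).2.mul
      (((tendsto_logPowDiv (m + 1)).pow 2).add (tendsto_logPowDivDeriv (m + 1)))
    simpa using h

lemma tendsto_momentPrimitive_succ (m : ℕ) :
    Tendsto (momentPrimitive (m + 1)) atTop (𝓝 0) := by
  have h2 := tendsto_sq_mul_powDiv_succ m
  obtain ⟨h1, h0⟩ := tendsto_of_tendsto_sq_mul h2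
  have hw := tendsto_logPowDiv (m + 1)
  have h := (((h2.mul ((hw.pow 2).add (tendsto_logPowDivDeriv (m + 1)))).const_mul (rate ^ 2)).add
    ((h1.mul hw).const_mul (2 * rate))).add (h0.const_mul 2)
  convert h using 2
  · rw [momentPrimitive]; ring
  · simp

/-- For `m = 0` the function `h = 1/f` tends to 1 while `yh'` and `y²h''` tend to 0. The resulting 2
is the only nonzero boundary value; it fixes the first moment in terms of the zeroth. -/
lemma tendsto_momentPrimitive_zero : Tendsto (momentPrimitive 0) atTop (𝓝 2) := by
  have e2 := tendsto_sq_mul_axisE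
  have f2 := tendsto_sq_mul_axisF
  have g2 := tendsto_sq_mul_axisG
  have s2 := tendsto_sq_mul_axisS
  have hw2 : Tendsto (fun y => y ^ 2 * logPowDiv 0 y) atTop (𝓝 0) := by
    convert (s2.const_mul (1 / 2)).sub (e2.const_mul (1 / 2)) using 2
    · rw [logPowDiv]; push_cast; ring
    · simp
  obtain ⟨hw1, hw0⟩ := tendsto_of_tendsto_sq_mul hw2
  have hd : Tendsto (fun y => y ^ 2 * logPowDivDeriv 0 y) atTop (𝓝 0) := by
    have h := (((e2.mul tendsto_axisS).add (s2.sub ((f2.mul (tendsto_axisF.add_const 1)).add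
      ((g2.mul tendsto_axisG).const_mul 27)))).const_mul (1 / 4)).sub
      (((e2.mul (tendsto_axisE.add_const 1)).sub ((f2.mul (tendsto_axisF.add_const 1)).sub
        ((g2.mul ((tendsto_axisF.const_mul 6).add (tendsto_axisG.const_mul 27)))))).const_mul (1 / 8))
    convert h using 2
    · rw [logPowDivDeriv]; push_cast; ring
    · simp
  have h := tendsto_powDiv_zero.mul (((((hw2.mul hw0).add hd).const_mul (rate ^ 2)).add
    (hw1.const_mul (2 * rate))).add_const 2)
  convert h using 2
  · rw [momentPrimitive]; ring
  · simp

/-- Weight -2 gives `h(1/y) = h(y)/y²`, under which `y²h'' - 2yh' + 2h` at `1/y` becomes `h''(y)`.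
The behaviour at 0 is thus read off at infinity. -/
lemma momentPrimitive_inv (m : ℕ) {y : ℝ} (hy : 0 < y) : momentPrimitive m y⁻¹ =
    rate ^ 2 * (powDiv m y * (logPowDiv m y ^ 2 + logPowDivDeriv m y)) := by
  have hF := axisF_ne_zero hy
  have hr := rate_pos.ne'
  have hy0 := hy.ne'
  have hE : axisE y⁻¹ = -y ^ 2 * axisE y + 4 * y / rate := by
    have := axisE_inv hy
    apply mul_left_cancel₀ hr
    rw [this, mul_add, mul_div_cancel₀ _ hr]
    ring
  have hT : axisT y⁻¹ = axisT y := by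
    rw [axisT, axisT, axisF_inv hy, axisG_inv hy, mul_div_mul_left _ _ (pow_ne_zero 2 hy0)]
  have hP : powDiv m y⁻¹ = powDiv m y / y ^ 2 := by
    rw [powDiv, powDiv, hT, axisF_inv hy, mul_comm, div_div]
  have hw : logPowDiv m y⁻¹ = -y ^ 2 * logPowDiv m y - 2 * y / rate := by
    rw [logPowDiv, logPowDiv, hE, axisS_inv hy]
    ring
  have hd : logPowDivDeriv m y⁻¹ = y ^ 4 * logPowDivDeriv m y
      - 2 * y ^ 3 / rate * logPowDiv m y - 2 * y ^ 2 / rate ^ 2 := by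
    rw [logPowDivDeriv, logPowDivDeriv, logPowDiv, hE, axisS_inv hy, axisF_inv hy, axisG_inv hy]
    field_simp
    ring
  rw [momentPrimitive, hP, hw, hd]
  field_simp
  ring

lemma tendsto_momentPrimitive_nhdsGT_zero (m : ℕ) :
    Tendsto (momentPrimitive m) (𝓝[>] 0) (𝓝 0) := by
  have h := ((tendsto_powDiv_deriv_two m).const_mul (rate ^ 2)).comp
    (tendsto_inv_nhdsGT_zero (𝕜 := ℝ))
  rw [mul_zero] at h
  refine h.congr' ?_
  filter_upwards [self_mem_nhdsWithin] with y hy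
  rw [Function.comp_apply, ← momentPrimitive_inv m (inv_pos.2 hy), inv_inv]

lemma form_axis {y : ℝ} (hy : 0 < y) :
    RationalMukai.V18.form (ofComplex (Complex.I * ((1 / 3 * y : ℝ) : ℂ))) =
      ((axisG y * axisS y : ℝ) : ℂ) := by
  change RationalMukai.formNine (axisPoint (1 / 3 * y)) = _
  have h : axisPoint (1 / 3 * y) = affinePoint (1 / 3) 0 (by norm_num) (axisPoint y) := by
    ext
    rw [coe_affinePoint, coe_axisPoint hy, coe_axisPoint (by positivity)]
    push_cast
    ring
  rw [h, formNine_eq, Complex.ofReal_mul, ofReal_axisG hy, ofReal_axisS hy]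

/-- The factor 27 comes from the change of variable `t = y/3` at `s = 3`. -/
lemma hasMellin_axis : HasMellin (fun y : ℝ => ((axisG y * axisS y : ℝ) : ℂ)) 3
    (27 * mellin (fun t : ℝ => RationalMukai.V18.form (ofComplex (Complex.I * t))) 3) := by
  have h1 : MellinConvergent
      (fun t : ℝ => RationalMukai.V18.form (ofComplex (Complex.I * t))) 3 :=
    (RationalMukai.V18.isStrongFEPair_form.hasMellin 3).1
  have h3 : (0 : ℝ) < 1 / 3 := by norm_num
  have hm := mellin_comp_mul_left
    (fun t : ℝ => RationalMukai.V18.form (ofComplex (Complex.I * t))) 3 h3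
  have hc := (MellinConvergent.comp_mul_left h3).2 h1
  have e : Set.EqOn (fun y : ℝ => (y : ℂ) ^ ((3 : ℂ) - 1) • RationalMukai.V18.form (ofComplex
      (Complex.I * ((1 / 3 * y : ℝ) : ℂ)))) (fun y : ℝ => (y : ℂ) ^ ((3 : ℂ) - 1) •
      ((axisG y * axisS y : ℝ) : ℂ)) (Set.Ioi 0) := fun y hy => by
    simp only [form_axis hy]
  refine ⟨hc.congr_fun e measurableSet_Ioi, ?_⟩
  rw [mellin, ← setIntegral_congr_fun measurableSet_Ioi e]
  refine hm.trans ?_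
  rw [smul_eq_mul]
  congr 1
  rw [show (-3 : ℂ) = ((-3 : ℤ) : ℂ) by norm_num, Complex.cpow_intCast]
  norm_num

lemma cpow_three_sub_one (y : ℝ) : (y : ℂ) ^ ((3 : ℂ) - 1) = ((y ^ 2 : ℝ) : ℂ) := by
  rw [show (3 : ℂ) - 1 = ((2 : ℕ) : ℂ) by norm_num, Complex.cpow_natCast]
  push_cast
  rfl

/-- The moments `∫ g S t ^ n y² dy` over the positive real numbers. -/
noncomputable def moment (n : ℕ) : ℝ := ∫ y in Set.Ioi 0, momentIntegrand n y

lemma integrableOn_momentIntegrand_zero : IntegrableOn (momentIntegrand 0) (Set.Ioi 0) := by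
  have h := hasMellin_axis.1.re
  refine h.congr (.of_forall fun y => ?_)
  change RCLike.re ((y : ℂ) ^ ((3 : ℂ) - 1) • ((axisG y * axisS y : ℝ) : ℂ)) = _
  rw [cpow_three_sub_one, smul_eq_mul, ← Complex.ofReal_mul, momentIntegrand, pow_zero, mul_one]
  exact Complex.ofReal_re _

lemma ofReal_moment_zero : (moment 0 : ℂ) =
    27 * mellin (fun t : ℝ => RationalMukai.V18.form (ofComplex (Complex.I * t))) 3 := by
  rw [← hasMellin_axis.2, mellin, moment, ← integral_complex_ofReal]
  refine setIntegral_congr_fun measurableSet_Ioi fun y _ => ?_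
  simp only [cpow_three_sub_one, smul_eq_mul, ← Complex.ofReal_mul, momentIntegrand, pow_zero,
    mul_one]

lemma norm_momentIntegrand_le (n : ℕ) {y : ℝ} (hy : 0 < y) :
    ‖momentIntegrand n y‖ ≤ (1 / 18) ^ n * ‖momentIntegrand 0 y‖ := by
  have h : momentIntegrand n y = axisT y ^ n * momentIntegrand 0 y := by
    rw [momentIntegrand, momentIntegrand]; ring
  rw [h, norm_mul, norm_pow, Real.norm_of_nonneg (axisT_pos hy).le]
  gcongr
  · exact (axisT_pos hy).le
  · exact axisT_le hy

lemma continuousOn_momentIntegrand (n : ℕ) : ContinuousOn (momentIntegrand n) (Set.Ioi 0) := by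
  have hG : ContinuousOn axisG (Set.Ioi 0) := fun _ hx =>
    (hasDerivAt_axisG hx).continuousAt.continuousWithinAt
  have hS : ContinuousOn axisS (Set.Ioi 0) := fun _ hx =>
    (hasDerivAt_axisS hx).continuousAt.continuousWithinAt
  exact ((continuousOn_pow 2).mul (hG.mul hS)).mul (continuousOn_axisT.pow n)

lemma integrableOn_momentIntegrand (n : ℕ) : IntegrableOn (momentIntegrand n) (Set.Ioi 0) := by
  refine Integrable.mono' (integrableOn_momentIntegrand_zero.norm.const_mul ((1 / 18) ^ n))
    ((continuousOn_momentIntegrand n).aestronglyMeasurable measurableSet_Ioi) ?_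
  filter_upwards [ae_restrict_mem measurableSet_Ioi] with y hy
  exact norm_momentIntegrand_le n hy

lemma abs_moment_le (n : ℕ) :
    |moment n| ≤ (1 / 18) ^ n * ∫ y in Set.Ioi 0, ‖momentIntegrand 0 y‖ := by
  have h := norm_integral_le_of_norm_le (f := momentIntegrand n)
    (integrableOn_momentIntegrand_zero.norm.const_mul ((1 / 18) ^ n)) (by
      filter_upwards [ae_restrict_mem measurableSet_Ioi] with y hy
      exact norm_momentIntegrand_le n hy)
  rwa [integral_const_mul] at h

lemma moment_relation (m : ℕ) {L : ℝ} (hL : Tendsto (momentPrimitive m) atTop (𝓝 L)) :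
    -rate ^ 3 * (m ^ 3 * moment (m - 1) - 3 * (2 * m + 1) * (3 * m ^ 2 + 3 * m + 1) * moment m
      - 27 * (m + 1) ^ 3 * moment (m + 1)) = L := by
  have hi := integrableOn_momentIntegrand
  have h1 := (hi (m - 1)).const_mul ((m : ℝ) ^ 3)
  have h2 := (hi m).const_mul (3 * (2 * m + 1) * (3 * m ^ 2 + 3 * m + 1) : ℝ)
  have h3 := (hi (m + 1)).const_mul (27 * (m + 1) ^ 3 : ℝ)
  have h12 : Integrable (fun y => m ^ 3 * momentIntegrand (m - 1) y
      - 3 * (2 * m + 1) * (3 * m ^ 2 + 3 * m + 1) * momentIntegrand m y)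
      (volume.restrict (Set.Ioi 0)) := h1.sub h2
  -- The primitive is redefined at 0 by its right limit, since `axisPoint 0` is not a meaningful
  -- value.
  have hFTC := integral_Ioi_of_hasDerivAt_of_tendsto
    (f := Function.update (momentPrimitive m) 0 0) (a := 0) (m := L)
    (by
      rw [continuousWithinAt_update_same, Set.Ici_sdiff_left]
      exact tendsto_momentPrimitive_nhdsGT_zero m)
    (fun y hy => (hasDerivAt_momentPrimitive m hy).congr_of_eventuallyEq (by
      filter_upwards [isOpen_Ioi.mem_nhds hy] with x hx
      exact Function.update_of_ne (ne_of_gt hx) _ _))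
    ((h12.sub h3).const_mul (-rate ^ 3))
    (hL.congr' (by
      filter_upwards [eventually_gt_atTop 0] with x hx
      exact (Function.update_of_ne (ne_of_gt hx) _ _).symm))
  rw [Function.update_self, sub_zero, integral_const_mul, integral_sub h12 h3,
    integral_sub h1 h2, integral_const_mul, integral_const_mul, integral_const_mul] at hFTC
  exact hFTC

end LevelThree

/-! ### The small solution for `V18` and the limits -/

namespace RationalMukai
open LevelThree

lemma exists_remainder_V18 : ∃ (r : ℕ → ℝ) (κ l : ℝ), κ ≠ 0 ∧ V18.Recurs r ∧
    (l : ℂ) = formL V18.form 3 ∧ r 0 = κ * l ∧ r 1 = κ * (l * V18.secondTerm - 1) ∧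
    Tendsto (fun n => r n / V18.growth ^ n) atTop (𝓝 0) := by
  have hr := rate_pos.ne'
  -- Multiplication by `(-27)^n` turns the moment relation, whose outer coefficients appear in the
  -- opposite order, into the recurrence. The case `m = 0` gives `r 1 = 3 r 0 - 2/rate³`, hence `κ`;
  -- then `l = r 0 / κ`, which is `L(F, 3)` because `rate³/2` times the 27 of the rescaling is
  -- `(2π)³/Γ(3)`.
  refine ⟨fun n => (-27) ^ n * moment n, 2 / rate ^ 3, moment 0 * rate ^ 3 / 2,
    div_ne_zero two_ne_zero (pow_ne_zero 3 hr), fun n => ?_, ?_, ?_, ?_, ?_⟩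
  · have h := moment_relation (n + 1) (tendsto_momentPrimitive_succ n)
    rcases mul_eq_zero.1 h with h | h
    · exact absurd h (neg_ne_zero.2 (pow_ne_zero 3 hr))
    · rw [Nat.add_sub_cancel] at h
      simp only [midCoeff, lastCoeff]
      push_cast at h ⊢
      linear_combination (-27) ^ (n + 1) * h
  · rw [formL_eq_mellin, Complex.Gammaℂ_def]
    have h3 : Complex.Gamma 3 = 2 := by
      rw [show (3 : ℂ) = (2 : ℕ) + 1 by norm_num, Complex.Gamma_nat_eq_factorial]
      norm_num
    have hpi : (Real.pi : ℂ) ≠ 0 := by exact_mod_cast Real.pi_ne_zero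
    rw [h3, show (-3 : ℂ) = ((-3 : ℤ) : ℂ) by norm_num, Complex.cpow_intCast]
    push_cast
    rw [ofReal_moment_zero, rate]
    push_cast
    field_simp
    ring
  · simp only [pow_zero, one_mul]
    field_simp
  · have h := moment_relation 0 tendsto_momentPrimitive_zero
    simp only [secondTerm]
    push_cast at h ⊢
    field_simp
    linear_combination -h
  -- The ratio is `27 · (1/18) / 7`: the bound `t ≤ 1/18` against the growth rate 7.
  · have h : Tendsto (fun n : ℕ => (3 / 14 : ℝ) ^ n * ∫ y in Set.Ioi 0, ‖momentIntegrand 0 y‖)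
        atTop (𝓝 0) := by
      have := (tendsto_pow_atTop_nhds_zero_of_lt_one (r := (3 / 14 : ℝ)) (by norm_num)
        (by norm_num)).mul_const (∫ y in Set.Ioi 0, ‖momentIntegrand 0 y‖)
      rwa [zero_mul] at this
    refine squeeze_zero_norm (fun n => ?_) h
    rw [norm_div, norm_mul, norm_pow, norm_pow, show growth V18 = 7 from rfl,
      Real.norm_of_nonneg (by norm_num : (0 : ℝ) ≤ 7), div_le_iff₀ (by positivity)]
    calc ‖(-27 : ℝ)‖ ^ n * ‖moment n‖ ≤ 27 ^ n * ((1 / 18) ^ n *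
        ∫ y in Set.Ioi 0, ‖momentIntegrand 0 y‖) := by
          gcongr
          · norm_num
          · exact abs_moment_le n
      _ = _ := by
          rw [mul_right_comm, ← mul_assoc, ← mul_pow, ← mul_pow]
          norm_num

lemma tendsto_formL (V : RationalMukai) (a : ℕ → ℤ) (b : ℕ → ℚ)
    (ha : V.IsIntegralSolution a) (hb : V.IsSecondSolution b) :
    Tendsto (fun n => ((b n : ℚ) : ℂ) / ((a n : ℤ) : ℂ)) atTop (𝓝 (formL V.form 3)) := by
  cases V with
  | V12 =>
    obtain ⟨r, κ, hκ, hr, h0, h1, hlim⟩ := exists_remainder_V12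
    have h := tendsto_div_of_remainder hκ hr h0 h1 hlim ha hb
    rw [Complex.ofReal_div, ofReal_zetaThree] at h
    rw [formL_three, aperyConstant]
    exact_mod_cast h
  | V16 =>
    obtain ⟨r, κ, hκ, hr, h0, h1, hlim⟩ := exists_remainder_V16
    have h := tendsto_div_of_remainder hκ hr h0 h1 hlim ha hb
    rw [Complex.ofReal_div, Complex.ofReal_mul, ofReal_zetaThree] at h
    rw [formL_three, aperyConstant]
    exact_mod_cast h
  | V18 =>
    obtain ⟨r, κ, l, hκ, hr, hl, h0, h1, hlim⟩ := exists_remainder_V18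
    rw [← hl]
    exact tendsto_div_of_remainder hκ hr h0 h1 hlim ha hb

end RationalMukai

theorem mainTheorem5 (V : RationalMukai) :
    -- the sequences `a` and `b` are well defined
    (∃! a : ℕ → ℤ, V.IsIntegralSolution a) ∧
    (∃! b : ℕ → ℚ, V.IsSecondSolution b) ∧
    -- the weight 4 modular form `F = ∑_{n ≥ 1} c_n q ^ n` and its entire `L`-function
    ∃ F : ModularForm ((CongruenceSubgroup.Gamma0 V.level : Subgroup SL(2, ℤ)) :
        Subgroup (GL (Fin 2) ℝ)) 4,
      (∀ τ : ℍ, F τ = V.formFun τ) ∧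
      IsAtkinLehnerOdd V.level F ∧
      (UpperHalfPlane.qExpansion 1 F).coeff 0 = 0 ∧
      Differentiable ℂ (formL F) ∧
      (∀ s : ℂ, 4 < s.re →
        LSeriesHasSum (fun n => (UpperHalfPlane.qExpansion 1 F).coeff n) s (formL F s)) ∧
      V.HasExplicitL (formL F) ∧
      -- the limit and its value
      (∀ (a : ℕ → ℤ) (b : ℕ → ℚ), V.IsIntegralSolution a → V.IsSecondSolution b →
        Tendsto (fun n => ((b n : ℚ) : ℂ) / ((a n : ℤ) : ℂ)) atTop (𝓝 (formL F 3))) ∧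
      formL F 3 = V.aperyConstant := by
  exact ⟨V.existsUnique_integralSolution, V.existsUnique_secondSolution, V.form, V.form_eq_formFun,
    V.isAtkinLehnerOdd_form, (V.qExpansion_form 0).trans V.formCoeff_zero, V.differentiable_formL,
    fun s hs => by
      simp only [V.qExpansion_form]
      rw [V.formL_eq_explicitL_of_lt hs]
      exact V.LSeriesHasSum_formCoeff hs,
    V.hasExplicitL_formL, V.tendsto_formL, V.formL_three⟩
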